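/- **Setting.** Let $\Gamma$ be a connected oriented multigraph (multiple edges and loops allowed) with vertex set $V$, edge set $E$ and finite vertex degrees. $E_v^-$ and $E_v^+$ denote the sets of edges starting, resp. ending, at $v$, and $E_v=E_v^-\cup E_v^+$. For each $v\in V$ let $S_v=\mathbb{C}\cup\{\infty\}$ be a Riemann sphere with standard coordinate $z$. For each edge $e$ from $v$ to $v'$ let $p_e^-\in S_v$ and $p_e^+\in S_{v'}$ be points different from $\infty$, with complex coordinates (biholomorphisms) $z_e^\pm:D_e^\pm\to D(0,\rho)$ around them, $z_e^\pm(p_e^\pm)=0$, $\rho>0$ independent of $e$. In each sphere the disks $D_e^\pm$ are disjoint, and for some constants $c_1,c_2>0$ one has $c_1|z_e^\pm(z)|\le|z-p_e^\pm|\le c_2|z_e^\pm(z)|$ for all $e\in E$ and $z\in D_e^\pm$ (admissible coordinates). For $\mathbf t=(t_e)_{e\in E}$ with $|t_e|<\rho^2$, let $\Sigma_{\mathbf t}$ be the (possibly noded) Riemann surface obtained from $\bigsqcup_v S_v$ as follows: for each $e$ with $t_e\ne0$ remove the disks $|z_e^\pm|\le|t_e|/\rho$ and identify $z\in D_e^-$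 with $z'\in D_e^+$ whenever $z_e^-(z)z_e^+(z')=t_e$; for each $e$ with $t_e=0$ identify $p_e^-$ with $p_e^+$. Let $\gamma_e$ be the homology class of $\partial D_e^+$. Let $\|\cdot\|_E$, $\|\cdot\|_V$ be norms on subspaces $\mathcal B_E\subset\mathbb{C}^E$, $\mathcal B_V\subset\mathbb{C}^V$ which are admissible: (1) $\mathcal B_E$ and $\mathcal B_V$ are Banach spaces; (2) the norms are monotonic: if $|\alpha_e|\le|\alpha'_e|$ for all $e$ and $\alpha'\in\mathcal B_E$, then $\alpha\in\mathcal B_E$ and $\|\alpha\|_E\le\|\alpha'\|_E$, and similarly for $\|\cdot\|_V$; (3) $\alpha\mapsto(\sum_{e\in E_v}|\alpha_e|)_{v\in V}$ is bounded from $\mathcal B_E$ to $\mathcal B_V$; (4) $u\mapsto(|u_v|+|u_{v'}|)_{e=vv'}$ is bounded from $\mathcal B_V$ to $\mathcal B_E$; (5) the space of families $(\lambda_{e,n})_{e\in E,n\in\mathbb{N}}$ for which $\|(\sup_n|\lambda_{e,n}|)_{e}\|_E$ is defined is a Banach space. In each $S_v$ let $q_{v,i}$, $1\le i\le n_v$,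 be distinct points (one of them may be $\infty$), with integers $m_{v,i}\ge1$, and let $Q=\sum_{v,i}m_{v,i}q_{v,i}$. Assume that the numbers $n_v$ and $m_{v,i}$ are uniformly bounded, and that for some $r>0$, in each $S_v$ the disks $D_e^-$ ($e\in E_v^-$), $D_e^+$ ($e\in E_v^+$) and $D(q_{v,i},r)$ are disjoint, where $D(\infty,r)$ means $\{|z|\ge1/r\}$. Fix $\epsilon$ with $0<\epsilon\le\rho c_1$ and $\epsilon<r$, and let $\Omega_{v,\epsilon}$ be $S_v$ minus the disks $D(p_e^\pm,\epsilon)$ and $D(q_{v,i},\epsilon)$. Let $\mathcal M^1(\Sigma_{\mathbf t},Q)$ be the space of meromorphic differentials $\omega$ on $\Sigma_{\mathbf t}$ that have at most poles of order $m_{v,i}$ at $q_{v,i}$, are otherwise holomorphic away from the nodes, have at each node at most simple poles at the two points $p_e^\pm$, with opposite residues, and for which the norm $$\|\omega\|_\Omega=\Big\|\Big(\sup_{\Omega_{v,\epsilon}}\Big|\frac{\omega}{dz}\Big|\Big)_{v\in V}\Big\|_V$$ is defined. Write the principal part of $\omega$ at $q_{v,i}$ as $P_{v,i}(\omega)=\sum_{n=1}^{m_{v,i}}a_{v,i,n}\frac{dz}{(z-q_{v,i})^n}$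 if $q_{v,i}\ne\infty$, and as $\sum_{n=1}^{m_{v,i}}a_{v,i,n}\frac{dw}{w^n}$ with $w=1/z$ if $q_{v,i}=\infty$. Let $\mathcal B_P$ be the space of families $P=(P_{v,i})$ of principal parts for which the norm $\|P\|_P=\|(\sup_{i,n}|a_{v,i,n}|)_{v\in V}\|_V$ is defined. **Theorem.** There is $\delta>0$ (with $\delta<\rho^2$) such that for all $\mathbf t$ with $\sup_e|t_e|\le\delta$, the operator $$\omega\mapsto\Big(\Big(\int_{\gamma_e}\omega\Big)_{e\in E},\,P(\omega)\Big)$$ is an isomorphism of Banach spaces from $\mathcal M^1(\Sigma_{\mathbf t},Q)$ onto the subspace of those $(\alpha,P)\in\mathcal B_E\times\mathcal B_P$ that satisfy $$\forall v\in V,\qquad\sum_{e\in E_v^+}\alpha_e-\sum_{e\in E_v^-}\alpha_e+2\pi i\sum_{i=1}^{n_v}a_{v,i,1}=0.$$ -/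

import Mathlib

open scoped ENNReal Topology

noncomputable section

namespace OpeningNodes

/-! ### Norms that may take the value `∞` -/

/-- An extended-valued seminorm on a complex vector space. -/
structure ESeminorm (X : Type*) [AddCommGroup X] [Module ℂ X] where
  toFun : X → ℝ≥0∞
  add_le' : ∀ x y, toFun (x + y) ≤ toFun x + toFun y
  smul' : ∀ (c : ℂ) (x : X), toFun (c • x) = ‖c‖ₑ * toFun x

namespace ESeminorm

variable {X : Type*} [AddCommGroup X] [Module ℂ X]

instance : CoeFun (ESeminorm X) (fun _ => X → ℝ≥0∞) := ⟨ESeminorm.toFun⟩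

theorem map_zero (p : ESeminorm X) : p 0 = 0 := by
  simpa using p.smul' 0 0

/-- The subspace of the vectors for which the norm is defined (that is, finite). -/
def finite (p : ESeminorm X) : Submodule ℂ X where
  carrier := {x | p x < ∞}
  add_mem' := fun {x y} hx hy =>
    lt_of_le_of_lt (p.add_le' x y) (ENNReal.add_lt_top.2 ⟨hx, hy⟩)
  zero_mem' := by simp [p.map_zero]
  smul_mem' := fun c x hx => by
    simp only [Set.mem_ofPred_eq, p.smul'] at hx ⊢
    exact ENNReal.mul_lt_top enorm_lt_top hx

/-- The subspace of the vectors of finite norm, as a (semi)normed space of its own. It is a type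
synonym, so that no topology of `X` is inherited. -/
def Space (p : ESeminorm X) : Type _ := p.finite

instance (p : ESeminorm X) : AddCommGroup p.Space := inferInstanceAs (AddCommGroup p.finite)
instance (p : ESeminorm X) : Module ℂ p.Space := inferInstanceAs (Module ℂ p.finite)

/-- The inclusion of the space of the vectors of finite norm. -/
def val (p : ESeminorm X) : p.Space →ₗ[ℂ] X := p.finite.subtype

theorem val_lt_top (p : ESeminorm X) (x : p.Space) : p (p.val x) < ∞ := x.2

instance (p : ESeminorm X) : Norm p.Space := ⟨fun x => (p (p.val x)).toReal⟩

theorem norm_def (p : ESeminorm X) (x : p.Space) : ‖x‖ = (p (p.val x)).toReal := rfl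

theorem core (p : ESeminorm X) : SeminormedSpace.Core ℂ p.Space where
  norm_nonneg x := ENNReal.toReal_nonneg
  norm_smul c x := by
    rw [norm_def, norm_def, map_smul, p.smul', ENNReal.toReal_mul, toReal_enorm]
  norm_triangle x y := by
    rw [norm_def, norm_def, norm_def, map_add,
      ← ENNReal.toReal_add (p.val_lt_top x).ne (p.val_lt_top y).ne]
    exact ENNReal.toReal_mono
      (ENNReal.add_lt_top.2 ⟨p.val_lt_top x, p.val_lt_top y⟩).ne (p.add_le' _ _)

instance (p : ESeminorm X) : SeminormedAddCommGroup p.Space :=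
  SeminormedAddCommGroup.ofCore p.core

instance (p : ESeminorm X) : NormedSpace ℂ p.Space where
  norm_smul_le c x := (p.core.norm_smul c x).le

/-- The supremum of the absolute values of a family of linear forms. -/
def supAbs {κ : Type*} (φ : κ → X →ₗ[ℂ] ℂ) : ESeminorm X where
  toFun x := ⨆ k, ‖φ k x‖ₑ
  add_le' x y := by
    refine iSup_le fun k => ?_
    rw [map_add]
    exact (enorm_add_le _ _).trans
      (add_le_add (le_iSup (fun k => ‖φ k x‖ₑ) k) (le_iSup (fun k => ‖φ k y‖ₑ) k))
  smul' c x := by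
    simp only [map_smul, smul_eq_mul, enorm_mul, ENNReal.mul_iSup]

end ESeminorm

/-- A norm on a subspace of `ι → ℂ`, extended by the value `∞` outside that subspace, which is
monotonic. (So if `|α| ≤ |β|` and the norm of `β` is defined, then so is that of `α`.) -/
structure MonotonicNorm (ι : Type*) extends ESeminorm (ι → ℂ) where
  eq_zero' : ∀ α, toFun α = 0 → α = 0
  mono' : ∀ α β : ι → ℂ, (∀ i, ‖α i‖ ≤ ‖β i‖) → toFun α ≤ toFun β

namespace MonotonicNorm

variable {ι : Type*} {X : Type*} [AddCommGroup X] [Module ℂ X]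

instance : CoeFun (MonotonicNorm ι) (fun _ => (ι → ℂ) → ℝ≥0∞) := ⟨fun N => N.toFun⟩

/-- The Banach space (once it is complete) on which the norm is defined. -/
abbrev Space (N : MonotonicNorm ι) : Type _ := N.toESeminorm.Space

open Classical in
/-- The norm of a sequence of elements of `[0, ∞]`; it is `∞` if a term is infinite. -/
def ext (N : MonotonicNorm ι) (u : ι → ℝ≥0∞) : ℝ≥0∞ :=
  if ∀ i, u i ≠ ∞ then N (fun i => ((u i).toReal : ℂ)) else ∞

theorem ext_of_ne_top (N : MonotonicNorm ι) {u : ι → ℝ≥0∞} (h : ∀ i, u i ≠ ∞) :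
    N.ext u = N (fun i => ((u i).toReal : ℂ)) := if_pos h

theorem ext_of_not (N : MonotonicNorm ι) {u : ι → ℝ≥0∞} (h : ¬ ∀ i, u i ≠ ∞) :
    N.ext u = ∞ := if_neg h

/-- The norm `‖(s_i(x))_i‖` of the sequence of values of seminorms `s_i`. -/
def comp (N : MonotonicNorm ι) (s : ι → ESeminorm X) : ESeminorm X where
  toFun x := N.ext (fun i => s i x)
  add_le' x y := by
    by_cases hx : ∀ i, s i x ≠ ∞
    swap
    · rw [N.ext_of_not hx]; simp
    by_cases hy : ∀ i, s i y ≠ ∞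
    swap
    · rw [N.ext_of_not hy]; simp
    have hxy : ∀ i, s i x + s i y ≠ ∞ := fun i => ENNReal.add_ne_top.2 ⟨hx i, hy i⟩
    have h : ∀ i, s i (x + y) ≠ ∞ := fun i => ne_top_of_le_ne_top (hxy i) ((s i).add_le' x y)
    rw [N.ext_of_ne_top hx, N.ext_of_ne_top hy, N.ext_of_ne_top h]
    refine le_trans (N.mono' _
      ((fun i => ((s i x).toReal : ℂ)) + fun i => ((s i y).toReal : ℂ)) fun i => ?_)
      (N.add_le' _ _)
    rw [Pi.add_apply, ← Complex.ofReal_add, ← ENNReal.toReal_add (hx i) (hy i),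
      Complex.norm_of_nonneg ENNReal.toReal_nonneg, Complex.norm_of_nonneg ENNReal.toReal_nonneg]
    exact ENNReal.toReal_mono (hxy i) ((s i).add_le' x y)
  smul' c x := by
    by_cases hc : c = 0
    · subst hc
      have h0 : ∀ i, s i ((0 : ℂ) • x) = 0 := fun i => by rw [(s i).smul']; simp
      have h : ∀ i, s i ((0 : ℂ) • x) ≠ ∞ := fun i => by rw [h0 i]; simp
      rw [N.ext_of_ne_top h]
      simp only [h0]
      have := N.toESeminorm.map_zero
      simpa [Pi.zero_def] using this
    · by_cases hx : ∀ i, s i x ≠ ∞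
      · have h : ∀ i, s i (c • x) ≠ ∞ := fun i => by
          rw [(s i).smul']; exact ENNReal.mul_ne_top enorm_ne_top (hx i)
        rw [N.ext_of_ne_top h, N.ext_of_ne_top hx, ← N.smul']
        have key : ∀ i, ‖(((s i (c • x)).toReal : ℝ) : ℂ)‖ =
            ‖(c • fun i => (((s i x).toReal : ℝ) : ℂ)) i‖ := fun i => by
          rw [(s i).smul', ENNReal.toReal_mul, toReal_enorm, Pi.smul_apply, smul_eq_mul,
            norm_mul, Complex.ofReal_mul, norm_mul, Complex.norm_of_nonneg (norm_nonneg c)]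
        exact le_antisymm (N.mono' _ _ fun i => (key i).le) (N.mono' _ _ fun i => (key i).ge)
      · have h : ¬ ∀ i, s i (c • x) ≠ ∞ := fun h => hx fun i hi => h i (by
          rw [(s i).smul', hi]
          exact ENNReal.mul_top (by simpa using hc))
        rw [N.ext_of_not h, N.ext_of_not hx, ENNReal.mul_top (by simpa using hc)]

end MonotonicNorm

/-! ### Graphs -/

/-- An oriented multigraph (multiple edges and loops are allowed) with finite degrees. -/
structure MultiGraph (V E : Type*) where
  src : E → V
  tgt : E → V
  finite_degree : ∀ v, {e | src e = v ∨ tgt e = v}.Finite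

namespace MultiGraph

variable {V E : Type*} (Γ : MultiGraph V E)

/-- The set `E_v` of the edges adjacent to `v`. -/
def edges (v : V) : Finset E := (Γ.finite_degree v).toFinset

/-- The set `E_v⁻` of the edges that start at `v`. -/
def outEdges (v : V) : Finset E :=
  ((Γ.finite_degree v).subset fun _ h => Or.inl h : {e | Γ.src e = v}.Finite).toFinset

/-- The set `E_v⁺` of the edges that end at `v`. -/
def inEdges (v : V) : Finset E :=
  ((Γ.finite_degree v).subset fun _ h => Or.inr h : {e | Γ.tgt e = v}.Finite).toFinset

/-- Any two vertices are joined by a path that ignores the orientation. -/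
def Connected : Prop :=
  ∀ u v : V, Relation.ReflTransGen
    (fun a b => ∃ e, (Γ.src e = a ∧ Γ.tgt e = b) ∨ (Γ.src e = b ∧ Γ.tgt e = a)) u v

/-- The ends of the edge `e` are `(e, false)` (the sign `-`) and `(e, true)` (the sign `+`);
`vert` is the vertex at which an end sits. -/
def vert (h : E × Bool) : V := cond h.2 (Γ.tgt h.1) (Γ.src h.1)

end MultiGraph

variable {V E : Type*} {Γ : MultiGraph V E}

/-! ### Admissible norms and coordinates -/

/-- Admissibility of a pair of monotonic norms on edge sequences and vertex sequences. -/
structure AdmissibleNorms (Γ : MultiGraph V E) (NE : MonotonicNorm E) (NV : MonotonicNorm V) :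
    Prop where
  complete_edge : CompleteSpace NE.Space
  complete_vertex : CompleteSpace NV.Space
  edge_to_vertex : ∃ C : NNReal, ∀ α : E → ℂ, NE α < ∞ →
    NV (fun v => ((∑ e ∈ Γ.edges v, ‖α e‖ : ℝ) : ℂ)) ≤ C * NE α
  vertex_to_edge : ∃ C : NNReal, ∀ u : V → ℂ, NV u < ∞ →
    NE (fun e => ((‖u (Γ.src e)‖ + ‖u (Γ.tgt e)‖ : ℝ) : ℂ)) ≤ C * NV u
  /-- the space of the families `(λ_{e,n})` for which `‖(sup_n |λ_{e,n}|)_e‖` is defined -/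
  complete_sup : CompleteSpace
    (NE.comp fun e => ESeminorm.supAbs
      fun n : ℕ => (LinearMap.proj n ∘ₗ LinearMap.proj e : (E → ℕ → ℂ) →ₗ[ℂ] ℂ)).Space

/-- Nodes `p_e^±` and admissible coordinates `z_e^± : D_e^± ≃ D(0, ρ)` around them. The disk
`D_e^±` is the source of the chart. All nodes are finite points of the spheres `ℂ ∪ {∞}`. -/
structure AdmissibleCoordinates (Γ : MultiGraph V E) where
  ρ : ℝ
  ρ_pos : 0 < ρ
  /-- the node -/
  p : E × Bool → ℂ
  /-- the coordinate -/
  z : E × Bool → OpenPartialHomeomorph ℂ ℂ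
  holo : ∀ h, DifferentiableOn ℂ (z h) (z h).source
  target_eq : ∀ h, (z h).target = Metric.ball 0 ρ
  p_mem : ∀ h, p h ∈ (z h).source
  z_p : ∀ h, z h (p h) = 0
  disjoint : ∀ h h', h ≠ h' → Γ.vert h = Γ.vert h' → Disjoint (z h).source (z h').source
  c₁ : ℝ
  c₂ : ℝ
  c₁_pos : 0 < c₁
  c₂_pos : 0 < c₂
  lower : ∀ h, ∀ x ∈ (z h).source, c₁ * ‖z h x‖ ≤ ‖x - p h‖
  upper : ∀ h, ∀ x ∈ (z h).source, ‖x - p h‖ ≤ c₂ * ‖z h x‖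

/-! ### Poles and principal parts -/

/-- The (finite part of the) disk `D(q, r)` in the Riemann sphere: the disk `|z - q| < r` if `q`
is finite, and `|z| ≥ 1 / r` if `q = ∞`. -/
def disk (q : OnePoint ℂ) (r : ℝ) : Set ℂ :=
  {z | (∃ a : ℂ, q = a ∧ z ∈ Metric.ball a r) ∨ (q = OnePoint.infty ∧ r⁻¹ ≤ ‖z‖)}

open Classical in
/-- The coefficient of the differential `f(z) dz` in the standard coordinate `u` centred at the
point `q` of the Riemann sphere: `z = q + u` if `q` is finite, and `z = 1 / u` if `q = ∞`. -/
def localCoeff (f : ℂ → ℂ) (q : OnePoint ℂ) (u : ℂ) : ℂ :=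
  if q = OnePoint.infty then -(f u⁻¹ / u ^ 2) else f (q.elim 0 id + u)

/-- The differential `f(z) dz` has the principal part `∑_{n=1}^m a_n du / u^n` at the point `q`, in
the standard coordinate `u` there: the difference is holomorphic near `q`. (The coefficient `a_n`
is `a ⟨n - 1, _⟩`. For `m = 0` this says that `f(z) dz` is holomorphic at `q`.) -/
def HasPrincipalPart (f : ℂ → ℂ) (q : OnePoint ℂ) {m : ℕ} (a : Fin m → ℂ) : Prop :=
  ∃ g : ℂ → ℂ, AnalyticAt ℂ g 0 ∧
    ∀ᶠ u in 𝓝[≠] (0 : ℂ), localCoeff f q u - ∑ n : Fin m, a n / u ^ (n.1 + 1) = g u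

/-- A divisor of poles: distinct points `q_{v,i}` of the sphere `S_v`, of order `m_{v,i} ≥ 1`. -/
structure Poles (V : Type*) where
  n : V → ℕ
  q : ∀ v, Fin (n v) → OnePoint ℂ
  q_inj : ∀ v, Function.Injective (q v)
  m : ∀ v, Fin (n v) → ℕ
  m_pos : ∀ v i, 0 < m v i

namespace Poles

variable (Q : Poles V)

/-- The number of poles in each sphere and the orders of the poles are uniformly bounded. -/
def UniformlyBounded : Prop := ∃ K : ℕ, ∀ v, Q.n v ≤ K ∧ ∀ i, Q.m v i ≤ K

/-- In each sphere, the disks `D_e^±` and `D(q_{v,i}, r)` are disjoint (that the disks `D_e^±` are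
mutually disjoint is part of admissibility). -/
def Separated (A : AdmissibleCoordinates Γ) (r : ℝ) : Prop :=
  (∀ v i h, Γ.vert h = v → Disjoint (A.z h).source (disk (Q.q v i) r)) ∧
  ∀ v i j, i ≠ j → Disjoint (disk (Q.q v i) r) (disk (Q.q v j) r)

/-- Families of coefficients `a_{v,i,n}` of principal parts, `1 ≤ n ≤ m_{v,i}`. -/
abbrev Parts : Type _ := ∀ (v : V) (i : Fin (Q.n v)), Fin (Q.m v i) → ℂ

/-- The norm `‖(sup_{i,n} |a_{v,i,n}|)_v‖_V` on families of principal parts. -/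
def partNorm (NV : MonotonicNorm V) : ESeminorm Q.Parts :=
  NV.comp fun v => ESeminorm.supAbs fun k : (Σ i : Fin (Q.n v), Fin (Q.m v i)) =>
    (LinearMap.proj k.2 ∘ₗ LinearMap.proj k.1 ∘ₗ LinearMap.proj v : Q.Parts →ₗ[ℂ] ℂ)

end Poles

theorem localCoeff_add (f g : ℂ → ℂ) (q : OnePoint ℂ) (u : ℂ) :
    localCoeff (f + g) q u = localCoeff f q u + localCoeff g q u := by
  unfold localCoeff; split_ifs <;> simp only [Pi.add_apply]; ring

theorem localCoeff_smul (c : ℂ) (f : ℂ → ℂ) (q : OnePoint ℂ) (u : ℂ) :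
    localCoeff (c • f) q u = c * localCoeff f q u := by
  unfold localCoeff; split_ifs <;> simp only [Pi.smul_apply, smul_eq_mul]; ring

theorem HasPrincipalPart.zero (q : OnePoint ℂ) (m : ℕ) :
    HasPrincipalPart 0 q (0 : Fin m → ℂ) := by
  refine ⟨0, analyticAt_const, Filter.Eventually.of_forall fun u => ?_⟩
  simp [localCoeff]

theorem HasPrincipalPart.add {f g : ℂ → ℂ} {q : OnePoint ℂ} {m : ℕ} {a b : Fin m → ℂ}
    (hf : HasPrincipalPart f q a) (hg : HasPrincipalPart g q b) :
    HasPrincipalPart (f + g) q (a + b) := by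
  obtain ⟨F, hF, hF'⟩ := hf
  obtain ⟨G, hG, hG'⟩ := hg
  refine ⟨F + G, hF.add hG, ?_⟩
  filter_upwards [hF', hG'] with u h1 h2
  rw [localCoeff_add, Pi.add_apply, ← h1, ← h2]
  simp only [Pi.add_apply, add_div, Finset.sum_add_distrib]
  ring

theorem HasPrincipalPart.smul {f : ℂ → ℂ} {q : OnePoint ℂ} {m : ℕ} {a : Fin m → ℂ} (c : ℂ)
    (hf : HasPrincipalPart f q a) : HasPrincipalPart (c • f) q (c • a) := by
  obtain ⟨F, hF, hF'⟩ := hf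
  refine ⟨c • F, hF.const_smul, ?_⟩
  filter_upwards [hF'] with u h1
  rw [localCoeff_smul, Pi.smul_apply, ← h1]
  simp only [Pi.smul_apply, smul_eq_mul, mul_sub, Finset.mul_sum, mul_div_assoc]

/-! ### The surface `Σ_t` and its differentials -/

namespace AdmissibleCoordinates

variable (A : AdmissibleCoordinates Γ)

/-- The closed disk `|z_e^±| ≤ |t_e| / ρ` that is removed from `D_e^±` (the node if `t_e = 0`). -/
def removed (t : E → ℂ) (h : E × Bool) : Set ℂ :=
  {x | x ∈ (A.z h).source ∧ ‖A.z h x‖ ≤ ‖t h.1‖ / A.ρ}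

/-- The sphere `S_v` without the removed disks, without the poles and without `∞`: the part of the
surface `Σ_t` that comes from `S_v`, away from nodes, poles and `∞`. -/
def piece (Q : Poles V) (t : E → ℂ) (v : V) : Set ℂ :=
  {x | (∀ h, Γ.vert h = v → x ∉ A.removed t h) ∧ ∀ i, (x : OnePoint ℂ) ≠ Q.q v i}

/-- The identification map `φ_e = (z_e^+)⁻¹ ∘ (t_e / z_e^-)`: the point `x` of the annulus
`|t_e| / ρ < |z_e^-| < ρ` is glued to the point `x'` with `z_e^-(x) z_e^+(x') = t_e`. -/
def glue (t : E → ℂ) (e : E) (x : ℂ) : ℂ := (A.z (e, true)).symm (t e / A.z (e, false) x)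

/-- `ω = (f_v dz)_v` is a meromorphic differential on `Σ_t` with at most poles of order `m_{v,i}` at
`q_{v,i}`. The (possibly noded) surface `Σ_t` is glued from the spheres `S_v` minus the removed
disks, so `ω` is given by differentials on these, with coefficients `f_v = ω / dz`, that agree under
the gluing maps. Off the domain of definition `f_v` is normalised to be `0`. -/
structure IsMeromorphic (Q : Poles V) (t : E → ℂ) (ω : V → ℂ → ℂ) : Prop where
  holo : ∀ v, DifferentiableOn ℂ (ω v) (A.piece Q t v)
  off : ∀ v, ∀ x, x ∉ A.piece Q t v → ω v x = 0
  /-- holomorphic at `∞`, unless this is one of the poles -/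
  infty : ∀ v, (∀ i, Q.q v i ≠ OnePoint.infty) →
    HasPrincipalPart (ω v) OnePoint.infty (0 : Fin 0 → ℂ)
  /-- at most a pole of order `m_{v,i}` at `q_{v,i}` -/
  pole : ∀ v i, ∃ a : Fin (Q.m v i) → ℂ, HasPrincipalPart (ω v) (Q.q v i) a
  /-- `φ_e^* ω = ω` on the annulus that is glued when the node is opened -/
  neck : ∀ e, t e ≠ 0 → ∀ x ∈ (A.z (e, false)).source, ‖t e‖ / A.ρ < ‖A.z (e, false) x‖ →
    ω (Γ.tgt e) (A.glue t e x) * deriv (A.glue t e) x = ω (Γ.src e) x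
  /-- at most simple poles, with opposite residues, on the two sides of a node -/
  node : ∀ e, t e = 0 → ∃ c : ℂ,
    HasPrincipalPart (ω (Γ.tgt e)) (A.p (e, true)) (fun _ : Fin 1 => c) ∧
    HasPrincipalPart (ω (Γ.src e)) (A.p (e, false)) (fun _ : Fin 1 => -c)

/-- The vector space of the meromorphic differentials on `Σ_t` with poles bounded by `Q`. -/
def forms (Q : Poles V) (t : E → ℂ) : Submodule ℂ (V → ℂ → ℂ) where
  carrier := {ω | A.IsMeromorphic Q t ω}
  zero_mem' :=
    { holo := fun v => differentiableOn_const 0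
      off := fun _ _ _ => rfl
      infty := fun v _ => HasPrincipalPart.zero _ 0
      pole := fun v i => ⟨0, HasPrincipalPart.zero _ _⟩
      neck := fun e _ x _ _ => by simp
      node := fun e _ => ⟨0, HasPrincipalPart.zero _ 1, by
        simpa [Pi.zero_def] using HasPrincipalPart.zero (A.p (e, false) : OnePoint ℂ) 1⟩ }
  add_mem' := fun {ω η} hω hη =>
    { holo := fun v => (hω.holo v).add (hη.holo v)
      off := fun v x hx => by simp [hω.off v x hx, hη.off v x hx]
      infty := fun v hv => by
        simpa using (hω.infty v hv).add (hη.infty v hv)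
      pole := fun v i => by
        obtain ⟨a, ha⟩ := hω.pole v i
        obtain ⟨b, hb⟩ := hη.pole v i
        exact ⟨a + b, ha.add hb⟩
      neck := fun e he x hx hx' => by
        simp only [Pi.add_apply, add_mul, hω.neck e he x hx hx', hη.neck e he x hx hx']
      node := fun e he => by
        obtain ⟨c, h1, h2⟩ := hω.node e he
        obtain ⟨d, k1, k2⟩ := hη.node e he
        refine ⟨c + d, h1.add k1, ?_⟩
        rw [neg_add]
        exact h2.add k2 }
  smul_mem' := fun c ω hω =>
    { holo := fun v => (hω.holo v).const_smul c
      off := fun v x hx => by simp [hω.off v x hx]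
      infty := fun v hv => by simpa using (hω.infty v hv).smul c
      pole := fun v i => by
        obtain ⟨a, ha⟩ := hω.pole v i
        exact ⟨c • a, ha.smul c⟩
      neck := fun e he x hx hx' => by
        simp only [Pi.smul_apply, smul_eq_mul, mul_assoc, hω.neck e he x hx hx']
      node := fun e he => by
        obtain ⟨d, h1, h2⟩ := hω.node e he
        refine ⟨c * d, h1.smul c, ?_⟩
        rw [← mul_neg]
        exact h2.smul c }

/-- The (finite part of the) domain `Ω_{v,ε}`: the sphere `S_v` minus the disks `D(p_e^±, ε)` and
`D(q_{v,i}, ε)`. -/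
def Omega (Q : Poles V) (ε : ℝ) (v : V) : Set ℂ :=
  {x | (∀ h, Γ.vert h = v → x ∉ Metric.ball (A.p h) ε) ∧ ∀ i, x ∉ disk (Q.q v i) ε}

/-- The norm `‖ω‖_Ω = ‖(sup_{Ω_{v,ε}} |ω / dz|)_v‖_V`. -/
def formNorm (Q : Poles V) (t : E → ℂ) (NV : MonotonicNorm V) (ε : ℝ) :
    ESeminorm (A.forms Q t) :=
  NV.comp fun v => ESeminorm.supAbs fun x : A.Omega Q ε v =>
    (LinearMap.proj x.1 ∘ₗ LinearMap.proj v ∘ₗ (A.forms Q t).subtype : A.forms Q t →ₗ[ℂ] ℂ)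

/-- The space `M¹(Σ_t, Q)` of the meromorphic differentials for which `‖ω‖_Ω` is defined. -/
abbrev M1 (Q : Poles V) (t : E → ℂ) (NV : MonotonicNorm V) (ε : ℝ) : Type _ :=
  (A.formNorm Q t NV ε).Space

/-- The coefficient `ω / dz` on `S_v` of an element of `M¹(Σ_t, Q)`. -/
def coeff {Q : Poles V} {t : E → ℂ} {NV : MonotonicNorm V} {ε : ℝ} (ω : A.M1 Q t NV ε) (v : V) :
    ℂ → ℂ := ((A.formNorm Q t NV ε).val ω).1 v

/-- The integral of `f(z) dz` along the positively oriented curve `|z_e^+| = s`. -/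
def cycleIntegral (f : ℂ → ℂ) (e : E) (s : ℝ) : ℂ :=
  ∮ ζ in C(0, s), f ((A.z (e, true)).symm ζ) * deriv (A.z (e, true)).symm ζ

end AdmissibleCoordinates

/-- The subspace of `B_E × B_P` given by the residue condition
`∑_{e ∈ E_v⁺} α_e - ∑_{e ∈ E_v⁻} α_e + 2πi ∑_i a_{v,i,1} = 0` for all `v`. -/
def residueSubspace (Γ : MultiGraph V E) (Q : Poles V) (NE : MonotonicNorm E)
    (NV : MonotonicNorm V) : Submodule ℂ (NE.Space × (Q.partNorm NV).Space) where
  carrier := {x | ∀ v, ∑ e ∈ Γ.inEdges v, NE.toESeminorm.val x.1 e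
      - ∑ e ∈ Γ.outEdges v, NE.toESeminorm.val x.1 e
      + 2 * Real.pi * Complex.I *
        ∑ i, (Q.partNorm NV).val x.2 v i ⟨0, Q.m_pos v i⟩ = 0}
  zero_mem' := fun v => by simp
  add_mem' := fun {x y} hx hy v => by
    have h := congrArg₂ (· + ·) (hx v) (hy v)
    simp only [Prod.fst_add, Prod.snd_add, map_add, Pi.add_apply, Finset.sum_add_distrib] at h ⊢
    linear_combination h
  smul_mem' := fun c x hx v => by
    have h := hx v
    simp only [Prod.smul_fst, Prod.smul_snd, map_smul, Pi.smul_apply, smul_eq_mul,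
      ← Finset.mul_sum] at h ⊢
    linear_combination c * h

end OpeningNodes

end

-- In the coordinate `u` at a node, a differential splits into a regular part, holomorphic on the
-- disk, and a singular part. The identification `u w = t` carries the regular part `R(w) dw` at the
-- other end of the edge to `-(t / u ^ 2) R(t / u) du`. So the singular part at one end is `r / u -
-- (t / u ^ 2) R(t / u)`, where the residue `r` is given by the period (`gluedPart`,
-- `HasData.pull_eq`). At a closed node the same formula holds with `t = 0`.
--
-- On a sphere, Liouville's theorem makes a differential the sum of its principal parts at the poles
-- and of its singular parts at the nodes, the latter written as Cauchy transforms over small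
-- circles (`HasData.eq_and_sum_residue`). Comparing the terms of order `1 / x` at infinity gives
-- the residue condition. Splitting off the residues yields an integral equation `ω = base +
-- transfer ω`: `base` is explicit in the periods and principal parts, while `transfer` is linear in
-- `ω`, sees `ω` only through the regular parts at the opposite ends of edges, and carries a factor
-- `t` (`norm_gluedPart_zero_le`). The admissibility conditions (3) and (4), which lead from
-- vertices to edges and back, bound it uniformly in the given norms.
--
-- Existence. For small `t`, `transfer` is a contraction on the Banach space of families of bounded
-- continuous functions on domains `Ω_{v,η}` with `η ≤ ε` (`Radii.exists_solution`). Near a node the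
-- fixed point has the form `S h + gluedPart t r (S (opp h))` with `S` holomorphic on the whole
-- disks. This expression is invariant under `u ↦ t / u`, so it continues through the neck and the
-- pieces glue to a differential on the surface (`Solution.exists_holomorphic`, `nodeCoeff_opp`,
-- `NodeData.hasData_glued`).
--
-- Uniqueness and bounds. The norm controls `ω` on `Ω_{v,ε}` only, whereas the regular parts are
-- read off on circles inside the removed disks. After subtraction of its singular part the
-- differential is holomorphic on `D(p, ε)`, and the maximum principle bounds it on these circles up
-- to an `O(t)` contribution of the other end. Adding the estimates at both ends absorbs that
-- contribution (`HasData.norm_node_le`, `HasData.norm_edge_le`). The integral equation then bounds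
-- the differential by its data (`HasData.form_le`). Finally the residue condition cuts out a closed
-- subspace of a Banach space, and its completeness is transported to the space of differentials.

namespace OpeningNodes

open Complex Metric Set Filter

/-! ### Cauchy transforms -/

/-- The Cauchy transform `(2πi)⁻¹ ∮ M(u) du / (x - X(u))` over the circle `|u| = s`. -/
noncomputable def cauchyTransform (X : ℂ → ℂ) (s : ℝ) (M : ℂ → ℂ) (x : ℂ) : ℂ :=
  (2 * Real.pi * I)⁻¹ * ∮ u in C(0, s), M u / (x - X u)

theorem norm_two_pi_I_inv : ‖(2 * Real.pi * I : ℂ)⁻¹‖ = (2 * Real.pi)⁻¹ := by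
  simp [abs_of_pos Real.pi_pos]

theorem norm_cauchyTransform_le {X M : ℂ → ℂ} {s B d : ℝ} {x : ℂ} (hs : 0 ≤ s) (hd : 0 < d)
    (hM : ∀ u ∈ sphere (0 : ℂ) s, ‖M u‖ ≤ B) (hX : ∀ u ∈ sphere (0 : ℂ) s, d ≤ ‖x - X u‖) :
    ‖cauchyTransform X s M x‖ ≤ s * B / d := by
  have h := circleIntegral.norm_integral_le_of_norm_le_const (f := fun u => M u / (x - X u))
    (c := 0) (C := B / d) hs fun u hu => by
      rw [norm_div]
      exact div_le_div₀ ((norm_nonneg _).trans (hM u hu)) (hM u hu) hd (hX u hu)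
  rw [cauchyTransform, norm_mul, norm_two_pi_I_inv]
  calc (2 * Real.pi)⁻¹ * _ ≤ (2 * Real.pi)⁻¹ * (2 * Real.pi * s * (B / d)) := by gcongr
    _ = s * B / d := by field_simp

theorem cauchyTransform_congr {X M M' : ℂ → ℂ} {s : ℝ} {x : ℂ} (hs : 0 ≤ s)
    (h : EqOn M M' (sphere 0 s)) : cauchyTransform X s M x = cauchyTransform X s M' x := by
  unfold cauchyTransform
  congr 1
  exact circleIntegral.integral_congr hs fun u hu => by simp only [h hu]

theorem continuousOn_cauchy_kernel {X M : ℂ → ℂ} {s : ℝ} {x : ℂ}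
    (hM : ContinuousOn M (sphere 0 s)) (hX : ContinuousOn X (sphere 0 s))
    (hx : ∀ u ∈ sphere (0 : ℂ) s, x ≠ X u) :
    ContinuousOn (fun u => M u / (x - X u)) (sphere 0 s) :=
  hM.div (continuousOn_const.sub hX) fun u hu => sub_ne_zero.2 (hx u hu)

theorem cauchyTransform_add {X M M' : ℂ → ℂ} {s : ℝ} {x : ℂ} (hs : 0 ≤ s)
    (hM : ContinuousOn M (sphere 0 s)) (hM' : ContinuousOn M' (sphere 0 s))
    (hX : ContinuousOn X (sphere 0 s)) (hx : ∀ u ∈ sphere (0 : ℂ) s, x ≠ X u) :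
    cauchyTransform X s (fun u => M u + M' u) x =
      cauchyTransform X s M x + cauchyTransform X s M' x := by
  unfold cauchyTransform
  rw [← mul_add, ← circleIntegral.integral_add
    ((continuousOn_cauchy_kernel hM hX hx).circleIntegrable hs)
    ((continuousOn_cauchy_kernel hM' hX hx).circleIntegrable hs)]
  simp only [add_div]

theorem cauchyTransform_const_mul (X M : ℂ → ℂ) (s : ℝ) (x c : ℂ) :
    cauchyTransform X s (fun u => c * M u) x = c * cauchyTransform X s M x := by
  unfold cauchyTransform
  simp only [mul_div_assoc, circleIntegral.integral_const_mul]
  ring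

/-- Points off a compact curve keep a positive distance from it, locally uniformly. -/
theorem exists_pos_dist_sphere {X : ℂ → ℂ} {s : ℝ} (hX : ContinuousOn X (sphere 0 s)) {x : ℂ}
    (hx : ∀ u ∈ sphere (0 : ℂ) s, x ≠ X u) :
    ∃ d > 0, ∀ y ∈ ball x d, ∀ u ∈ sphere (0 : ℂ) s, d ≤ ‖y - X u‖ := by
  have hK : IsCompact (X '' sphere 0 s) := (isCompact_sphere 0 s).image_of_continuousOn hX
  have hx' : x ∈ (X '' sphere 0 s)ᶜ := fun ⟨u, hu, h⟩ => hx u hu h.symm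
  obtain ⟨d, hd, hd'⟩ := Metric.isOpen_iff.1 hK.isClosed.isOpen_compl x hx'
  refine ⟨d / 2, half_pos hd, fun y hy u hu => ?_⟩
  by_contra! h
  refine hd' (?_ : X u ∈ ball x d) ⟨u, hu, rfl⟩
  rw [mem_ball] at hy ⊢
  calc dist (X u) x ≤ dist (X u) y + dist y x := dist_triangle _ _ _
    _ < d / 2 + d / 2 := by
      rw [dist_comm, dist_eq_norm]; gcongr
    _ = d := by ring

/-- Differentiation under the integral sign: on a ball around `x` that stays at distance `d` from
the curve, the derivative of the kernel is at most `B / d ^ 2`. -/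
theorem differentiableAt_cauchyTransform {X M : ℂ → ℂ} {s : ℝ} {x : ℂ} (hs : 0 ≤ s)
    (hM : ContinuousOn M (sphere 0 s)) (hX : ContinuousOn X (sphere 0 s))
    (hx : ∀ u ∈ sphere (0 : ℂ) s, x ≠ X u) : DifferentiableAt ℂ (cauchyTransform X s M) x := by
  obtain ⟨d, hd, hd'⟩ := exists_pos_dist_sphere hX hx
  obtain ⟨B, hB⟩ := (isCompact_sphere (0 : ℂ) s).exists_bound_of_continuousOn hM
  have hmem : ∀ θ, circleMap 0 s θ ∈ sphere (0 : ℂ) s := circleMap_mem_sphere 0 hs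
  have hcM : Continuous fun θ => M (circleMap 0 s θ) :=
    hM.comp_continuous (continuous_circleMap 0 s) hmem
  have hcX : Continuous fun θ => X (circleMap 0 s θ) :=
    hX.comp_continuous (continuous_circleMap 0 s) hmem
  have hcd : Continuous fun θ => deriv (circleMap 0 s) θ := by
    simp only [deriv_circleMap]; fun_prop
  have hne : ∀ y ∈ ball x d, ∀ θ, y - X (circleMap 0 s θ) ≠ 0 := fun y hy θ h => by
    have := hd' y hy _ (hmem θ)
    rw [h, norm_zero] at this
    linarith
  unfold cauchyTransform circleIntegral
  refine DifferentiableAt.const_mul ?_ _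
  have hcont : ∀ y ∈ ball x d, Continuous fun θ =>
      deriv (circleMap 0 s) θ • (M (circleMap 0 s θ) / (y - X (circleMap 0 s θ))) := fun y hy =>
    hcd.smul (hcM.div (continuous_const.sub hcX) (hne y hy))
  refine (intervalIntegral.hasDerivAt_integral_of_dominated_loc_of_deriv_le
    (F := fun y θ => deriv (circleMap 0 s) θ • (M (circleMap 0 s θ) / (y - X (circleMap 0 s θ))))
    (F' := fun y θ => deriv (circleMap 0 s) θ •
      (-(M (circleMap 0 s θ)) / (y - X (circleMap 0 s θ)) ^ 2))
    (bound := fun _ => s * (B / d ^ 2))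
    (ball_mem_nhds x hd) ?_ ?_ ?_ ?_ ?_ ?_).2.differentiableAt
  · filter_upwards [ball_mem_nhds x hd] with y hy
    exact (hcont y hy).aestronglyMeasurable
  · exact (hcont x (mem_ball_self hd)).intervalIntegrable _ _
  · refine Continuous.aestronglyMeasurable ?_
    exact hcd.smul (hcM.neg.div ((continuous_const.sub hcX).pow 2)
      fun θ => pow_ne_zero 2 (hne x (mem_ball_self hd) θ))
  · refine Eventually.of_forall fun θ _ y hy => ?_
    have h1 : ‖deriv (circleMap 0 s) θ‖ = s := by simp [deriv_circleMap, abs_of_nonneg hs]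
    rw [norm_smul, h1, norm_div, norm_neg, norm_pow]
    have := hB _ (hmem θ)
    have h2 := hd' y hy _ (hmem θ)
    have h0 := (norm_nonneg _).trans this
    gcongr
  · exact continuous_const.intervalIntegrable _ _
  · refine Eventually.of_forall fun θ _ y hy => ?_
    have h1 : HasDerivAt (fun y => y - X (circleMap 0 s θ)) 1 y :=
      (hasDerivAt_id y).sub_const _
    have h2 := ((hasDerivAt_const y (M (circleMap 0 s θ))).div h1 (hne y hy θ)).const_smul
      (deriv (circleMap 0 s) θ)
    refine h2.congr_deriv ?_
    simp

/-- The leading term of a Cauchy transform at infinity. -/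
theorem tendsto_mul_cauchyTransform {X M : ℂ → ℂ} {s : ℝ} (hs : 0 ≤ s)
    (hM : ContinuousOn M (sphere 0 s)) (hX : ContinuousOn X (sphere 0 s)) :
    Tendsto (fun x => x * cauchyTransform X s M x) (cocompact ℂ)
      (𝓝 ((2 * Real.pi * I)⁻¹ * ∮ u in C(0, s), M u)) := by
  obtain ⟨R, hR⟩ := (isCompact_sphere (0 : ℂ) s).exists_bound_of_continuousOn hX
  obtain ⟨B, hB⟩ := (isCompact_sphere (0 : ℂ) s).exists_bound_of_continuousOn (hM.mul hX)
  have hdist : ∀ x : ℂ, ∀ u ∈ sphere (0 : ℂ) s, ‖x‖ - R ≤ ‖x - X u‖ := fun x u hu =>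
    (sub_le_sub_left (hR u hu) _).trans (norm_sub_norm_le _ _)
  have hn : Tendsto (fun x : ℂ => ‖x‖ - R) (cocompact ℂ) atTop :=
    tendsto_atTop_add_const_right _ _ (tendsto_norm_cocompact_atTop)
  have hlim : Tendsto (fun x : ℂ => s * B / (‖x‖ - R)) (cocompact ℂ) (𝓝 0) :=
    hn.const_div_atTop _
  rw [tendsto_iff_norm_sub_tendsto_zero]
  refine squeeze_zero' (Eventually.of_forall fun _ => norm_nonneg _) ?_ hlim
  filter_upwards [hn.eventually_gt_atTop 0] with x hx
  have hne : ∀ u ∈ sphere (0 : ℂ) s, x ≠ X u := fun u hu h => by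
    have := hdist x u hu
    rw [h, sub_self, norm_zero] at this
    rw [h] at hx
    linarith
  -- Since `x M / (x - X) - M = M X / (x - X)`, the error is again a Cauchy transform, with density
  -- `M X`, and so is `O(1 / ‖x‖)`.
  have key : x * cauchyTransform X s M x - (2 * Real.pi * I)⁻¹ * ∮ u in C(0, s), M u =
      cauchyTransform X s (fun u => M u * X u) x := by
    unfold cauchyTransform
    rw [mul_left_comm, ← mul_sub, ← circleIntegral.integral_const_mul,
      ← circleIntegral.integral_sub (f := fun u => x * (M u / (x - X u)))
      (((continuousOn_cauchy_kernel hM hX hne).const_smul x).circleIntegrable hs)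
      (hM.circleIntegrable hs)]
    congr 1
    refine circleIntegral.integral_congr hs fun u hu => ?_
    have := sub_ne_zero.2 (hne u hu)
    field_simp
    ring
  rw [key]
  exact norm_cauchyTransform_le hs hx hB (hdist x)

/-! ### Integrals over circles -/

theorem isOpen_annulus (a b : ℝ) : IsOpen {u : ℂ | a < ‖u‖ ∧ ‖u‖ < b} :=
  (isOpen_lt continuous_const continuous_norm).inter (isOpen_lt continuous_norm continuous_const)

theorem circleIntegral_eq_of_annulus {φ : ℂ → ℂ} {a b s s' : ℝ} (ha : 0 ≤ a)
    (hφ : DifferentiableOn ℂ φ {u | a < ‖u‖ ∧ ‖u‖ < b}) (hs : a < s) (hss' : s ≤ s')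
    (hs' : s' < b) :
    (∮ u in C(0, s'), φ u) = ∮ u in C(0, s), φ u := by
  have hsub : closedBall (0 : ℂ) s' \ ball 0 s ⊆ {u | a < ‖u‖ ∧ ‖u‖ < b} := fun u hu => by
    simp only [Set.mem_sdiff, mem_closedBall, mem_ball, dist_zero_right, not_lt] at hu
    exact ⟨by linarith, by linarith⟩
  refine Complex.circleIntegral_eq_of_differentiable_on_annulus_off_countable (ha.trans_lt hs) hss'
    countable_empty (hφ.continuousOn.mono hsub) fun u hu => ?_
  exact hφ.differentiableAt ((isOpen_annulus a b).mem_nhds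
    (hsub ⟨ball_subset_closedBall hu.1.1, fun h => hu.1.2 (ball_subset_closedBall h)⟩))

theorem circleIntegral_eq_zero_of_ball {φ : ℂ → ℂ} {c : ℂ} {s b : ℝ} (hs : 0 ≤ s) (hb : s < b)
    (hφ : DifferentiableOn ℂ φ (ball c b)) : ∮ u in C(c, s), φ u = 0 :=
  Complex.circleIntegral_eq_zero_of_differentiable_on_off_countable hs countable_empty
    (hφ.continuousOn.mono (closedBall_subset_ball hb)) fun _ hu =>
      hφ.differentiableAt (isOpen_ball.mem_nhds (ball_subset_ball hb.le hu.1))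

/-- If `φ` is holomorphic outside a disk and `ζ φ(ζ) → 0` at infinity, then its integrals over
circles around the disk vanish. -/
theorem circleIntegral_eq_zero_of_decay {φ : ℂ → ℂ} {a s : ℝ} (ha : 0 ≤ a) (hs : a < s)
    (hφ : DifferentiableOn ℂ φ {u | a < ‖u‖})
    (hlim : Tendsto (fun u => u * φ u) (cocompact ℂ) (𝓝 0)) : ∮ u in C(0, s), φ u = 0 := by
  rw [← norm_le_zero_iff]
  refine le_of_forall_gt_imp_ge_of_dense fun κ hκ => ?_
  have hκ' : 0 < κ / (2 * Real.pi) := by positivity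
  have h1 := (Metric.tendsto_nhds.1 hlim) _ hκ'
  rw [← Metric.cobounded_eq_cocompact, (hasBasis_cobounded_norm).eventually_iff] at h1
  obtain ⟨r, -, hr⟩ := h1
  set S := max s r
  have hS : 0 < S := ha.trans_lt (hs.trans_le (le_max_left _ _))
  -- The circle is enlarged until `‖u φ(u)‖ < κ / 2π` on it; its length `2πS` then gives the bound
  -- `κ`.
  rw [← circleIntegral_eq_of_annulus (b := S + 1) ha (hφ.mono fun u hu => hu.1) hs (le_max_left s r)
    (lt_add_one S)]
  calc _ ≤ 2 * Real.pi * S * (κ / (2 * Real.pi) / S) := by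
        refine circleIntegral.norm_integral_le_of_norm_le_const hS.le fun u hu => ?_
        rw [mem_sphere_zero_iff_norm] at hu
        have := hr (x := u) (by simp only [Set.mem_ofPred_eq, hu]; exact le_max_right s r)
        rw [dist_zero_right, norm_mul, hu] at this
        rw [le_div_iff₀ hS]
        linarith
    _ = κ := by field_simp

/-- The substitution `u = t / w` in a circle integral. -/
theorem circleIntegral_inversion (Φ : ℂ → ℂ) {t : ℂ} (ht : t ≠ 0) {s : ℝ} (hs : 0 < s) :
    (∮ u in C(0, ‖t‖ / s), Φ u) = ∮ w in C(0, s), Φ (t / w) * (t / w ^ 2) := by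
  set τ := arg t
  have ht' : t = ‖t‖ * exp (τ * I) := (norm_mul_exp_arg_mul_I t).symm
  -- The substitution sends the angle `θ` to `arg t - θ`. The reversal of orientation cancels the
  -- sign in `du = -(t / w ^ 2) dw`.
  have hinv : ∀ θ : ℝ, circleMap 0 (‖t‖ / s) (τ - θ) = t / circleMap 0 s θ := fun θ => by
    have h0 : (s : ℂ) ≠ 0 := ofReal_ne_zero.2 hs.ne'
    rw [circleMap_zero, circleMap_zero, ofReal_sub, sub_mul, exp_sub]
    conv_rhs => rw [ht']
    have := exp_ne_zero (θ * I)
    push_cast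
    field_simp
  have hper : Function.Periodic (fun θ => deriv (circleMap 0 (‖t‖ / s)) θ •
      Φ (circleMap 0 (‖t‖ / s) θ)) (2 * Real.pi) := fun θ => by
    simp only [deriv_circleMap, periodic_circleMap 0 (‖t‖ / s) θ]
  calc (∮ u in C(0, ‖t‖ / s), Φ u)
      = ∫ θ in (τ - 2 * Real.pi)..(τ - 2 * Real.pi) + 2 * Real.pi,
          deriv (circleMap 0 (‖t‖ / s)) θ • Φ (circleMap 0 (‖t‖ / s) θ) := by
        rw [hper.intervalIntegral_add_eq (τ - 2 * Real.pi) 0, zero_add]; rfl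
    _ = ∫ θ in (0 : ℝ)..2 * Real.pi, deriv (circleMap 0 (‖t‖ / s)) (τ - θ) •
          Φ (circleMap 0 (‖t‖ / s) (τ - θ)) := by
        rw [intervalIntegral.integral_comp_sub_left (fun θ => deriv (circleMap 0 (‖t‖ / s)) θ •
          Φ (circleMap 0 (‖t‖ / s) θ)) τ]
        congr 1
        ring
    _ = _ := by
        unfold circleIntegral
        refine intervalIntegral.integral_congr fun θ _ => ?_
        have h0 : circleMap 0 s θ ≠ 0 := circleMap_ne_center hs.ne'
        simp only [deriv_circleMap, hinv, smul_eq_mul]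
        field_simp

end OpeningNodes

namespace OpeningNodes

open Complex Metric Set Filter

/-! ### Laurent decomposition in a univalent coordinate -/

/-- A univalent parametrization of a domain by the disk `|u| < ρ`. -/
structure Univalent (X : ℂ → ℂ) (ρ : ℝ) : Prop where
  diff : DifferentiableOn ℂ X (ball 0 ρ)
  inj : InjOn X (ball 0 ρ)
  deriv_ne : ∀ u ∈ ball (0 : ℂ) ρ, deriv X u ≠ 0

theorem univalent_id (ρ : ℝ) : Univalent (fun u => u) ρ :=
  ⟨differentiableOn_id, injOn_id _, fun u _ => by simp⟩

namespace Univalent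

variable {X : ℂ → ℂ} {ρ : ℝ}

theorem continuousOn_sphere (hX : Univalent X ρ) {s : ℝ} (hs : s < ρ) :
    ContinuousOn X (sphere 0 s) :=
  hX.diff.continuousOn.mono (sphere_subset_closedBall.trans (closedBall_subset_ball hs))

theorem ne_of_norm_ne (hX : Univalent X ρ) {s : ℝ} (hs : s < ρ) {u : ℂ} (hu : ‖u‖ < ρ)
    (hus : ‖u‖ ≠ s) : ∀ v ∈ sphere (0 : ℂ) s, X u ≠ X v := fun v hv h => hus <| by
  rw [mem_sphere_zero_iff_norm] at hv
  rw [hX.inj (by simpa using hu) (by simpa [hv] using hs) h, hv]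

theorem diff_deriv (hX : Univalent X ρ) : DifferentiableOn ℂ (deriv X) (ball 0 ρ) :=
  hX.diff.deriv isOpen_ball

theorem dslope_ne (hX : Univalent X ρ) {u v : ℂ} (hu : u ∈ ball (0 : ℂ) ρ)
    (hv : v ∈ ball (0 : ℂ) ρ) : dslope X u v ≠ 0 := by
  by_cases h : v = u
  · rw [h, dslope_same]; exact hX.deriv_ne u hu
  · rw [dslope_of_ne _ h, slope_def_field]
    exact div_ne_zero (sub_ne_zero.2 fun h' => h (hX.inj hv hu h')) (sub_ne_zero.2 h)

theorem diff_dslope (hX : Univalent X ρ) {u : ℂ} (hu : u ∈ ball (0 : ℂ) ρ) :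
    DifferentiableOn ℂ (dslope X u) (ball 0 ρ) :=
  (Complex.differentiableOn_dslope (isOpen_ball.mem_nhds hu)).2 hX.diff

/-- The logarithmic derivative of `X - X(u)` has a simple pole at `u` and no other poles. -/
theorem logDeriv_sub (hX : Univalent X ρ) {u v : ℂ} (hu : u ∈ ball (0 : ℂ) ρ)
    (hv : v ∈ ball (0 : ℂ) ρ) (h : v ≠ u) :
    deriv X v / (X v - X u) = (v - u)⁻¹ + deriv (dslope X u) v / dslope X u v := by
  have h1 : HasDerivAt (fun w => X u + (w - u) * dslope X u w)
      (1 * dslope X u v + (v - u) * deriv (dslope X u) v) v :=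
    ((((hasDerivAt_id v).sub_const u)).mul
      ((hX.diff_dslope hu).differentiableAt (isOpen_ball.mem_nhds hv)).hasDerivAt).const_add _
  have h2 : (fun w => X u + (w - u) * dslope X u w) = X := by
    funext w
    have := sub_smul_dslope X u w
    rw [smul_eq_mul] at this
    rw [this]; ring
  rw [h2] at h1
  have h3 : X v - X u = (v - u) * dslope X u v := by
    have := sub_smul_dslope X u v
    rw [smul_eq_mul] at this
    rw [this]
  have h4 := hX.dslope_ne hu hv
  have h5 := sub_ne_zero.2 h
  rw [h1.deriv, h3]
  field_simp

/-- The argument principle for a univalent map: `logDeriv_sub` splits the integrand into `(v - u)⁻¹`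
and a function holomorphic on the disk, because the difference quotient `dslope X u` has no zeros.
-/
theorem circleIntegral_logDeriv (hX : Univalent X ρ) {u : ℂ} (hu : ‖u‖ < ρ) {s : ℝ} (hs0 : 0 < s)
    (hs : s < ρ) (hus : ‖u‖ ≠ s) :
    (∮ v in C(0, s), deriv X v / (X v - X u)) = if ‖u‖ < s then 2 * Real.pi * I else 0 := by
  have hu' : u ∈ ball (0 : ℂ) ρ := by simpa using hu
  have hsub : sphere (0 : ℂ) s ⊆ ball 0 ρ :=
    sphere_subset_closedBall.trans (closedBall_subset_ball hs)
  have hne : ∀ v ∈ sphere (0 : ℂ) s, v ≠ u := fun v hv h => hus <| by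
    rw [mem_sphere_zero_iff_norm] at hv; rw [← h, hv]
  have hk : DifferentiableOn ℂ (fun v => deriv (dslope X u) v / dslope X u v) (ball 0 ρ) :=
    ((hX.diff_dslope hu').deriv isOpen_ball).div (hX.diff_dslope hu')
      fun v hv => hX.dslope_ne hu' hv
  rw [circleIntegral.integral_congr hs0.le (g := fun v => (v - u)⁻¹ +
    deriv (dslope X u) v / dslope X u v) fun v hv => hX.logDeriv_sub hu' (hsub hv) (hne v hv),
    circleIntegral.integral_add, circleIntegral_eq_zero_of_ball hs0.le hs hk, add_zero]
  · split_ifs with h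
    · exact circleIntegral.integral_sub_inv_of_mem_ball (by simpa using h)
    · have hlt : s < ‖u‖ := lt_of_le_of_ne (not_lt.1 h) (Ne.symm hus)
      refine circleIntegral_eq_zero_of_ball hs0.le hlt ?_
      refine (differentiableOn_id.sub_const u).inv fun v hv h => ?_
      rw [id, sub_eq_zero] at h
      simp [h] at hv
  · refine ContinuousOn.circleIntegrable hs0.le ?_
    exact (continuousOn_id.sub continuousOn_const).inv₀ fun v hv => sub_ne_zero.2 (hne v hv)
  · exact (hk.continuousOn.mono hsub).circleIntegrable hs0.le

/-- The Cauchy formula for an annulus in the coordinate `X`. -/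
theorem cauchyTransform_sub (hX : Univalent X ρ) {M : ℂ → ℂ} {a s s' : ℝ} (ha : 0 ≤ a)
    (hM : DifferentiableOn ℂ M {u | a < ‖u‖ ∧ ‖u‖ < ρ}) (hs : a < s) (hs' : s' < ρ) {u : ℂ}
    (hsu : s < ‖u‖) (hus' : ‖u‖ < s') :
    M u = (cauchyTransform X s M (X u) - cauchyTransform X s' M (X u)) * deriv X u := by
  set U := {u : ℂ | a < ‖u‖ ∧ ‖u‖ < ρ}
  have hUo : IsOpen U := isOpen_annulus a ρ
  have huU : u ∈ U := ⟨hs.trans hsu, hus'.trans hs'⟩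
  have hub : u ∈ ball (0 : ℂ) ρ := by simpa using huU.2
  have hUb : U ⊆ ball 0 ρ := fun v hv => by simpa using hv.2
  -- With this constant `n = M - c X'` vanishes at `u`, so `n / (X - X u)` extends holomorphically
  -- over `u` as the quotient `k` of two difference quotients. Its integrals over the two circles
  -- agree, and the `c` terms count the winding around `u`.
  set c := M u / deriv X u
  set n : ℂ → ℂ := fun v => M v - c * deriv X v
  have hd0 := hX.deriv_ne u hub
  have hn0 : n u = 0 := by simp only [n, c]; field_simp; ring
  have hn : DifferentiableOn ℂ n U := hM.sub ((hX.diff_deriv.mono hUb).const_mul c)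
  set k : ℂ → ℂ := fun v => dslope n u v / dslope X u v
  have hk : DifferentiableOn ℂ k U :=
    ((Complex.differentiableOn_dslope (hUo.mem_nhds huU)).2 hn).div ((hX.diff_dslope hub).mono hUb)
      fun v hv => hX.dslope_ne hub (hUb hv)
  have hs0 : 0 < s := ha.trans_lt hs
  have hk_eq := circleIntegral_eq_of_annulus ha hk hs (hsu.trans hus').le hs'
  have hcomp : ∀ σ, a < σ → σ < ρ → ‖u‖ ≠ σ → (∮ v in C(0, σ), k v) =
      -(2 * Real.pi * I) * cauchyTransform X σ M (X u) -
        c * (if ‖u‖ < σ then 2 * Real.pi * I else 0) := by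
    intro σ h1 h2 h3
    have hσ : 0 < σ := ha.trans_lt h1
    have hsub : sphere (0 : ℂ) σ ⊆ U := fun v hv => by
      rw [mem_sphere_zero_iff_norm] at hv; exact ⟨by rwa [hv], by rwa [hv]⟩
    have hXne := hX.ne_of_norm_ne h2 huU.2 h3
    have hXc := hX.continuousOn_sphere h2
    rw [← hX.circleIntegral_logDeriv huU.2 hσ h2 h3, cauchyTransform,
      neg_mul, mul_inv_cancel_left₀ two_pi_I_ne_zero, ← circleIntegral.integral_const_mul c,
      neg_sub_left, ← circleIntegral.integral_add, ← neg_one_mul,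
      ← circleIntegral.integral_const_mul]
    · refine circleIntegral.integral_congr hσ.le fun v hv => ?_
      have hvu : v ≠ u := fun h => h3 (by rw [← h]; simpa using hv)
      have h4 : X v - X u ≠ 0 := sub_ne_zero.2 (hXne v hv).symm
      have h5 : X u - X v ≠ 0 := sub_ne_zero.2 (hXne v hv)
      have h6 : v - u ≠ 0 := sub_ne_zero.2 hvu
      simp only [k, dslope_of_ne _ hvu, slope_def_field, hn0, n]
      rw [← neg_sub (X v) (X u), div_neg]
      field_simp
      ring
    · refine (((hX.diff_deriv.continuousOn.mono (hsub.trans hUb)).div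
        (hXc.sub continuousOn_const) fun v hv => ?_).const_smul c).circleIntegrable hσ.le
      exact sub_ne_zero.2 (hXne v hv).symm
    · exact (continuousOn_cauchy_kernel (hM.continuousOn.mono hsub) hXc hXne).circleIntegrable hσ.le
  rw [hcomp s' (hs.trans (hsu.trans hus')) hs' hus'.ne, hcomp s hs (hsu.trans (hus'.trans hs'))
    hsu.ne', if_pos hus', if_neg hsu.not_gt] at hk_eq
  have h7 : c = cauchyTransform X s M (X u) - cauchyTransform X s' M (X u) := by
    have := two_pi_I_ne_zero
    refine mul_left_cancel₀ this ?_
    linear_combination -hk_eq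
  rw [← h7]
  simp only [c]
  field_simp

/-- A holomorphic function on the annulus `a < |u| < ρ` minus its singular part, a Cauchy transform
in the coordinate `X`, extends to a holomorphic function on the disk. -/
theorem exists_regular_part (hX : Univalent X ρ) {M : ℂ → ℂ} {a s : ℝ} (ha : 0 ≤ a)
    (hM : DifferentiableOn ℂ M {u | a < ‖u‖ ∧ ‖u‖ < ρ}) (hs : a < s) (hsρ : s < ρ) :
    ∃ k : ℂ → ℂ, DifferentiableOn ℂ k (ball 0 ρ) ∧ ∀ u, s < ‖u‖ → ‖u‖ < ρ →
      M u = cauchyTransform X s M (X u) * deriv X u + k u := by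
  classical
  obtain ⟨s', h1, h2⟩ := exists_between hsρ
  have hs0 : 0 < s := ha.trans_lt hs
  have hcont : ∀ σ, a < σ → σ < ρ → ContinuousOn M (sphere 0 σ) := fun σ h3 h4 =>
    hM.continuousOn.mono fun v hv => by
      rw [mem_sphere_zero_iff_norm] at hv; exact ⟨by rwa [hv], by rwa [hv]⟩
  have hdiff : ∀ σ, a < σ → σ < ρ → ∀ u, ‖u‖ < ρ → ‖u‖ ≠ σ →
      DifferentiableAt ℂ (fun u => cauchyTransform X σ M (X u) * deriv X u) u := by
    intro σ h3 h4 u h5 h6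
    have hub : u ∈ ball (0 : ℂ) ρ := by simpa using h5
    refine DifferentiableAt.mul ?_ (hX.diff_deriv.differentiableAt (isOpen_ball.mem_nhds hub))
    exact (differentiableAt_cauchyTransform (ha.trans h3.le) (hcont σ h3 h4)
      (hX.continuousOn_sphere h4) (hX.ne_of_norm_ne h4 h5 h6)).comp u
      (hX.diff.differentiableAt (isOpen_ball.mem_nhds hub))
  -- Inside, the extension is minus the Cauchy transform over a larger circle `s'`. By
  -- `cauchyTransform_sub` the two expressions coincide for `s < ‖u‖ < s'`.
  refine ⟨fun u => if s < ‖u‖ then M u - cauchyTransform X s M (X u) * deriv X u else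
    -(cauchyTransform X s' M (X u) * deriv X u), fun u hu => ?_, fun u h3 h4 => ?_⟩
  · rw [mem_ball_zero_iff] at hu
    refine DifferentiableAt.differentiableWithinAt ?_
    by_cases h3 : s < ‖u‖
    · have : DifferentiableAt ℂ (fun u => M u - cauchyTransform X s M (X u) * deriv X u) u :=
        (hM.differentiableAt ((isOpen_annulus a ρ).mem_nhds ⟨hs.trans h3, hu⟩)).sub
          (hdiff s hs hsρ u hu h3.ne')
      refine this.congr_of_eventuallyEq ?_
      filter_upwards [(isOpen_lt continuous_const continuous_norm).mem_nhds h3] with v hv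
      exact if_pos hv
    · have h4 : ‖u‖ < s' := (not_lt.1 h3).trans_lt h1
      refine (hdiff s' (hs.trans h1) h2 u hu h4.ne).neg.congr_of_eventuallyEq ?_
      filter_upwards [(isOpen_lt continuous_norm continuous_const).mem_nhds h4] with v hv
      split_ifs with h5
      · rw [hX.cauchyTransform_sub ha hM hs h2 h5 hv]
        simp only [Pi.neg_apply]
        ring
      · rfl
  · simp only [if_pos h3]; ring

/-- Cauchy's formula at `u = 0` for `c / (x - X u)`, which has no pole in the disk because `x` is
outside its image. A residue in the coordinate `u` thus becomes the same residue in the coordinate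
of the sphere. -/
theorem cauchyTransform_inv (hX : Univalent X ρ) {s : ℝ} (hs0 : 0 < s) (hs : s < ρ) {x : ℂ}
    (hx : ∀ u, ‖u‖ ≤ s → x ≠ X u) (c : ℂ) :
    cauchyTransform X s (fun u => c / u) x = c / (x - X 0) := by
  have hd : DiffContOnCl ℂ (fun u => c / (x - X u)) (ball 0 s) := by
    refine DifferentiableOn.diffContOnCl ?_
    rw [closure_ball _ hs0.ne']
    refine (differentiableOn_const c).div ((differentiableOn_const x).sub
      (hX.diff.mono (closedBall_subset_ball hs))) fun u hu =>
        sub_ne_zero.2 (hx u (by simpa using hu))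
  have := hd.two_pi_i_inv_smul_circleIntegral_sub_inv_smul (w := 0) (mem_ball_self hs0)
  rw [← this, cauchyTransform, smul_eq_mul]
  congr 1
  refine circleIntegral.integral_congr hs0.le fun u hu => ?_
  simp only [sub_zero, smul_eq_mul]
  ring

end Univalent

/-! ### The regular part of a Laurent expansion -/

/-- The regular part `(2πi)⁻¹ ∮ φ(ζ) dζ / (ζ - u)`, for the circle `|ζ| = s`. -/
noncomputable def regularPart (s : ℝ) (φ : ℂ → ℂ) (u : ℂ) : ℂ :=
  -cauchyTransform (fun ζ => ζ) s φ u

theorem regularPart_eq (s : ℝ) (φ : ℂ → ℂ) (u : ℂ) :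
    regularPart s φ u = (2 * Real.pi * I)⁻¹ * ∮ ζ in C(0, s), φ ζ / (ζ - u) := by
  rw [regularPart, cauchyTransform, ← mul_neg, ← neg_one_mul (circleIntegral _ _ _),
    ← circleIntegral.integral_const_mul]
  congr 2
  funext ζ
  rw [← neg_sub ζ u, div_neg, neg_one_mul, neg_neg]

theorem differentiableOn_regularPart {s : ℝ} (hs : 0 ≤ s) {φ : ℂ → ℂ}
    (hφ : ContinuousOn φ (sphere 0 s)) : DifferentiableOn ℂ (regularPart s φ) (ball 0 s) := by
  refine fun u hu => ((differentiableAt_cauchyTransform hs hφ continuousOn_id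
    fun v hv h => ?_).neg).differentiableWithinAt
  rw [mem_sphere_zero_iff_norm] at hv
  rw [mem_ball_zero_iff, h, id, hv] at hu
  exact lt_irrefl _ hu

theorem norm_regularPart_le {s B : ℝ} (hs : 0 < s) {φ : ℂ → ℂ}
    (hB : ∀ u ∈ sphere (0 : ℂ) s, ‖φ u‖ ≤ B) {u : ℂ} (hu : ‖u‖ ≤ s / 2) :
    ‖regularPart s φ u‖ ≤ 2 * B := by
  rw [regularPart, norm_neg]
  refine (norm_cauchyTransform_le hs.le (half_pos hs) hB fun v hv => ?_).trans_eq ?_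
  · rw [mem_sphere_zero_iff_norm] at hv
    have := norm_sub_norm_le v u
    rw [norm_sub_rev] at this
    linarith
  · field_simp

theorem regularPart_of_diff {s ρ : ℝ} (hs : s < ρ) {φ : ℂ → ℂ}
    (hφ : DifferentiableOn ℂ φ (ball 0 ρ)) {u : ℂ} (hu : ‖u‖ < s) : regularPart s φ u = φ u := by
  have := (hφ.mono (closedBall_subset_ball hs)).circleIntegral_sub_inv_smul (w := u)
    (by simpa using hu)
  rw [regularPart_eq]
  have h2 := two_pi_I_ne_zero
  simp only [smul_eq_mul] at this
  simp only [div_eq_inv_mul, this]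
  field_simp

theorem regularPart_add {s : ℝ} {φ ψ : ℂ → ℂ} (hs : 0 ≤ s) (hφ : ContinuousOn φ (sphere 0 s))
    (hψ : ContinuousOn ψ (sphere 0 s)) {u : ℂ} (hu : ‖u‖ < s) :
    regularPart s (fun v => φ v + ψ v) u = regularPart s φ u + regularPart s ψ u := by
  rw [regularPart, cauchyTransform_add hs hφ hψ (continuousOn_id' _) fun v hv h => ?_, neg_add]
  · rfl
  · rw [mem_sphere_zero_iff_norm] at hv
    rw [h, hv] at hu
    exact lt_irrefl _ hu

/-- The regular part of a function that is holomorphic outside a disk and vanishes at infinity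
is zero. -/
theorem regularPart_eq_zero {s a : ℝ} {φ : ℂ → ℂ} (ha : 0 ≤ a) (hs : a < s)
    (hφ : DifferentiableOn ℂ φ {u | a < ‖u‖}) (hlim : Tendsto φ (cocompact ℂ) (𝓝 0)) {u : ℂ}
    (hu : ‖u‖ < s) : regularPart s φ u = 0 := by
  rw [regularPart_eq]
  -- Taking `b` above `‖u‖` as well as above `a` puts the pole of the kernel at `u` inside the
  -- excluded disk.
  obtain ⟨b, hb1, hb2⟩ := exists_between (max_lt hs hu)
  rw [circleIntegral_eq_zero_of_decay (a := b) (ha.trans ((le_max_left _ _).trans hb1.le)) hb2,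
    mul_zero]
  · refine (hφ.mono fun v hv => ?_).div (differentiableOn_id.sub_const u) fun v hv h => ?_
    · exact (le_max_left _ _).trans_lt (hb1.trans hv)
    · have h : v = u := sub_eq_zero.1 h
      rw [Set.mem_ofPred_eq, h] at hv
      exact lt_irrefl _ (hv.trans_le ((le_max_right _ _).trans hb1.le))
  · have h1 : Tendsto (fun v : ℂ => v / (v - u)) (cocompact ℂ) (𝓝 1) := by
      have h2 : Tendsto (fun v : ℂ => (v - u)⁻¹) (cocompact ℂ) (𝓝 0) := by
        refine (tendsto_inv₀_cobounded).comp ?_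
        rw [← Metric.cobounded_eq_cocompact]
        exact tendsto_sub_const_cobounded u
      have h3 : Tendsto (fun v : ℂ => 1 + u * (v - u)⁻¹) (cocompact ℂ) (𝓝 (1 + u * 0)) :=
        (h2.const_mul u).const_add 1
      rw [mul_zero, add_zero] at h3
      refine h3.congr' ?_
      have : ∀ᶠ v in cocompact ℂ, v ≠ u := (isCompact_singleton (x := u)).compl_mem_cocompact
      filter_upwards [this] with v hv
      have := sub_ne_zero.2 hv
      field_simp
      ring
    have h4 := hlim.mul h1
    rw [zero_mul] at h4
    exact h4.congr fun v => by ring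

/-- The Laurent expansion of a function `G` on an annulus, expressed by the regular parts at the two
ends: `H` is the same differential in the coordinate `w = t / u`. -/
theorem laurent_of_glued {G H : ℂ → ℂ} {t : ℂ} {s ρ : ℝ} (hs : 0 < s) (hsρ : s < ρ) (ht : t ≠ 0)
    (hG : DifferentiableOn ℂ G {u | ‖t‖ / ρ < ‖u‖ ∧ ‖u‖ < ρ})
    (hH : ContinuousOn H (sphere 0 s))
    (hGH : ∀ u, ‖u‖ = s → H u = -(t / u ^ 2) * G (t / u)) {u : ℂ} (hu : ‖t‖ / s < ‖u‖)
    (hus : ‖u‖ < s) :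
    G u = regularPart s G u + (-((2 * Real.pi * I)⁻¹ * ∮ w in C(0, s), H w) / u
      - t / u ^ 2 * regularPart s H (t / u)) := by
  have ht0 : 0 < ‖t‖ := norm_pos_iff.2 ht
  have hρ : 0 < ρ := hs.trans hsρ
  have h1 : ‖t‖ / ρ < ‖t‖ / s := by gcongr
  have hu0 : u ≠ 0 := norm_pos_iff.1 ((by positivity : 0 < ‖t‖ / s).trans hu)
  -- The Cauchy formula between `‖u‖ = ‖t‖ / s` and `‖u‖ = s`. The inversion `u = t / w` maps the
  -- inner circle to `‖w‖ = s`, where `H` lives.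
  have h2 := (univalent_id ρ).cauchyTransform_sub (by positivity) hG h1 hsρ hu hus
  have h3 : cauchyTransform (fun u => u) (‖t‖ / s) G u =
      -((2 * Real.pi * I)⁻¹ * ∮ w in C(0, s), H w) / u - t / u ^ 2 * regularPart s H (t / u) := by
    rw [regularPart_eq, cauchyTransform, circleIntegral_inversion _ ht hs]
    have hne : ∀ w ∈ sphere (0 : ℂ) s, w - t / u ≠ 0 := fun w hw h => by
      rw [mem_sphere_zero_iff_norm] at hw
      rw [sub_eq_zero] at h
      rw [h, norm_div] at hw
      rw [div_lt_iff₀ hs, mul_comm, ← div_lt_iff₀ (norm_pos_iff.2 hu0), hw] at hu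
      exact lt_irrefl _ hu
    -- From `1 / (u - t / w) = 1 / u + (t / u ^ 2) / (w - t / u)`: the first summand gives the
    -- residue, the second the regular part of `H` at `t / u`.
    have h4 : (∮ w in C(0, s), G (t / w) / (u - t / w) * (t / w ^ 2)) =
        ∮ w in C(0, s), ((-1 / u) * H w + (-(t / u ^ 2)) * (H w / (w - t / u))) := by
      refine circleIntegral.integral_congr hs.le fun w hw => ?_
      have hw0 : w ≠ 0 := by
        rintro rfl
        simp [hs.ne] at hw
      have h5 := hne w hw
      rw [mem_sphere_zero_iff_norm] at hw
      have h6 : u - t / w ≠ 0 := fun h => h5 (by field_simp at h ⊢; linear_combination h)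
      have h7 : w * u - t ≠ 0 := fun h => h6 (by field_simp; linear_combination h)
      simp only [hGH w hw]
      have h8 : u * w - t ≠ 0 := by rwa [mul_comm]
      field_simp
      ring
    rw [h4, circleIntegral.integral_add, circleIntegral.integral_const_mul,
      circleIntegral.integral_const_mul]
    · ring
    · exact (hH.const_smul (-1 / u)).circleIntegrable hs.le
    · exact ((hH.div (continuousOn_id.sub continuousOn_const) hne).const_smul
        (-(t / u ^ 2))).circleIntegrable hs.le
  simp only [deriv_id'', mul_one] at h2
  rw [h3] at h2
  have h9 : cauchyTransform (fun u => u) s G u = -regularPart s G u := (neg_neg _).symm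
  rw [h2, h9]
  ring

/-! ### Entire functions -/

/-- If holomorphic functions `σ_i` have the same singularities as `f` in disjoint closed sets `K_i`,
then `f` is their sum up to an entire function. -/
theorem exists_entire {ι : Type*} [Finite ι] {K U : ι → Set ℂ} {f : ℂ → ℂ} {σ g : ι → ℂ → ℂ}
    (s : Finset ι) (hs : ∀ i, i ∈ s)
    (hK : ∀ i, IsClosed (K i)) (hU : ∀ i, IsOpen (U i)) (hKU : ∀ i, K i ⊆ U i)
    (hdisj : ∀ i j, i ≠ j → Disjoint (U i) (K j))
    (hf : ∀ x, (∀ i, x ∉ K i) → DifferentiableAt ℂ f x)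
    (hσ : ∀ i, ∀ x, x ∉ K i → DifferentiableAt ℂ (σ i) x)
    (hg : ∀ i, DifferentiableOn ℂ (g i) (U i))
    (hfg : ∀ i, ∀ x ∈ U i, x ∉ K i → f x - σ i x = g i x) :
    ∃ F : ℂ → ℂ, Differentiable ℂ F ∧
      ∀ x, (∀ i, x ∉ K i) → f x - ∑ i ∈ s, σ i x = F x := by
  classical
  have hsum : ∀ i x, ∑ j ∈ s, σ j x = σ i x + ∑ j ∈ s \ {i}, σ j x := fun i x => by
    rw [Finset.sdiff_singleton_eq_erase, Finset.add_sum_erase s (fun j => σ j x) (hs i)]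
  set F : ℂ → ℂ := fun x => if h : ∃ i, x ∈ K i then g h.choose x - ∑ j ∈ s \ {h.choose}, σ j x
    else f x - ∑ i ∈ s, σ i x
  have hF1 : ∀ x, (∀ i, x ∉ K i) → f x - ∑ i ∈ s, σ i x = F x := fun x hx => by
    simp only [F]
    rw [dif_neg (by push Not; exact hx)]
  -- As `U i` meets no other `K j`, the chosen index is `i` on `K i`; off `K i` the hypothesis `hfg`
  -- gives the same value. So `F` is holomorphic near `K i`.
  have hF2 : ∀ i, ∀ x ∈ U i, F x = g i x - ∑ j ∈ s \ {i}, σ j x := fun i x hx => by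
    by_cases h : ∃ j, x ∈ K j
    · have hj : h.choose = i := by
        by_contra hne
        exact Set.disjoint_left.1 (hdisj i _ (Ne.symm hne)) hx h.choose_spec
      simp only [F]
      rw [dif_pos h]
      rw [hj]
    · push Not at h
      rw [← hF1 x h, hsum i, ← hfg i x hx (h i)]
      ring
  refine ⟨F, fun x => ?_, hF1⟩
  by_cases h : ∃ i, x ∈ K i
  · obtain ⟨i, hi⟩ := h
    have hxU := hKU i hi
    have hd : DifferentiableAt ℂ (fun x => g i x - ∑ j ∈ s \ {i}, σ j x) x := by
      refine ((hg i).differentiableAt ((hU i).mem_nhds hxU)).sub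
        (DifferentiableAt.fun_sum fun j hj => hσ j x fun hxj => ?_)
      have hji : i ≠ j := by
        rintro rfl
        simp at hj
      exact Set.disjoint_left.1 (hdisj i j hji) hxU hxj
    refine hd.congr_of_eventuallyEq ?_
    filter_upwards [(hU i).mem_nhds hxU] with y hy using hF2 i y hy
  · push Not at h
    have hd : DifferentiableAt ℂ (fun x => f x - ∑ i ∈ s, σ i x) x :=
      (hf x h).sub (DifferentiableAt.fun_sum fun j _ => hσ j x (h j))
    refine hd.congr_of_eventuallyEq ?_
    have hopen : IsOpen (⋃ i, K i)ᶜ := (isClosed_iUnion_of_finite hK).isOpen_compl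
    filter_upwards [hopen.mem_nhds (by simpa using h)] with y hy
    exact (hF1 y (by simpa using hy)).symm

end OpeningNodes

namespace OpeningNodes

open Complex Metric Set Filter

/-! ### Principal parts -/

open Classical in
/-- The model `∑_n a_n dz / (z - q)^n` of a principal part at a finite point `q`; at `q = ∞` the
model `-∑_{n ≥ 2} a_n z^{n-2} dz`, which leaves out the residue. -/
noncomputable def principalTerm (q : OnePoint ℂ) {m : ℕ} (a : Fin m → ℂ) (x : ℂ) : ℂ :=
  if q = OnePoint.infty then -∑ k : Fin m, (if k.1 = 0 then 0 else a k * x ^ (k.1 - 1))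
  else ∑ k : Fin m, a k / (x - q.elim 0 id) ^ (k.1 + 1)

/-- The residue `a_1` of a principal part. -/
def residue {m : ℕ} (a : Fin m → ℂ) : ℂ := ∑ k : Fin m, if k.1 = 0 then a k else 0

/-- `residue` is a sum so that it makes sense for `m = 0` too, the case that expresses holomorphy at
infinity. -/
theorem residue_eq {m : ℕ} (hm : 0 < m) (a : Fin m → ℂ) : residue a = a ⟨0, hm⟩ := by
  rw [residue, Finset.sum_eq_single ⟨0, hm⟩]
  · simp
  · intro k _ hk
    rw [if_neg fun h => hk (Fin.ext h)]
  · simp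

theorem principalTerm_coe (q : ℂ) {m : ℕ} (a : Fin m → ℂ) (x : ℂ) :
    principalTerm (q : OnePoint ℂ) a x = ∑ k : Fin m, a k / (x - q) ^ (k.1 + 1) := by
  rw [principalTerm, if_neg (OnePoint.coe_ne_infty q)]; rfl

theorem localCoeff_coe (f : ℂ → ℂ) (q u : ℂ) : localCoeff f (q : OnePoint ℂ) u = f (q + u) := by
  rw [localCoeff, if_neg (OnePoint.coe_ne_infty q)]; rfl

theorem localCoeff_infty (f : ℂ → ℂ) (u : ℂ) :
    localCoeff f OnePoint.infty u = -(f u⁻¹ / u ^ 2) := if_pos rfl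

theorem principalTerm_zero (q : OnePoint ℂ) (m : ℕ) (x : ℂ) :
    principalTerm q (0 : Fin m → ℂ) x = 0 := by
  unfold principalTerm; split_ifs <;> simp

theorem differentiableAt_principalTerm {q : OnePoint ℂ} {m : ℕ} (a : Fin m → ℂ) {x : ℂ}
    (hx : (x : OnePoint ℂ) ≠ q) : DifferentiableAt ℂ (principalTerm q a) x := by
  induction q using OnePoint.rec with
  | infty =>
    have : principalTerm OnePoint.infty a =
        fun x => -∑ k : Fin m, (if k.1 = 0 then 0 else a k * x ^ (k.1 - 1)) := by
      funext x; exact if_pos rfl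
    rw [this]
    refine (DifferentiableAt.fun_sum fun k _ => ?_).neg
    split_ifs <;> fun_prop
  | coe q =>
    have : principalTerm (q : OnePoint ℂ) a = fun x => ∑ k : Fin m, a k / (x - q) ^ (k.1 + 1) := by
      funext x; exact principalTerm_coe q a x
    rw [this]
    have hxq : x - q ≠ 0 := sub_ne_zero.2 fun h => hx (by rw [h])
    refine DifferentiableAt.fun_sum fun k _ => ?_
    exact (differentiableAt_const _).div (by fun_prop) (pow_ne_zero _ hxq)

/-- Off the disk, `max 1 η⁻¹` dominates `‖x - q‖⁻¹` if `q` is finite and `‖x‖` if `q = ∞`; each term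
has at most `m` such factors. -/
theorem norm_principalTerm_le {q : OnePoint ℂ} {m : ℕ} {a : Fin m → ℂ} {B η : ℝ} (hη : 0 < η)
    (ha : ∀ k, ‖a k‖ ≤ B) {x : ℂ} (hx : x ∉ disk q η) :
    ‖principalTerm q a x‖ ≤ m * (max 1 η⁻¹ ^ m * B) := by
  set Λ := max 1 η⁻¹
  have hΛ : 1 ≤ Λ := le_max_left _ _
  have hB : ∀ _k : Fin m, 0 ≤ B := fun k => (norm_nonneg _).trans (ha k)
  have hsum : ∀ F : Fin m → ℂ, (∀ k, ‖F k‖ ≤ Λ ^ m * B) → ‖∑ k, F k‖ ≤ m * (Λ ^ m * B) :=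
    fun F hF => by simpa using norm_sum_le_of_le Finset.univ fun k _ => hF k
  induction q using OnePoint.rec with
  | infty =>
    have hx' : ‖x‖ ≤ Λ := by
      by_contra! h
      exact hx (Or.inr ⟨rfl, (le_max_right _ _).trans h.le⟩)
    rw [principalTerm, if_pos rfl, norm_neg]
    refine hsum _ fun k => ?_
    have := hB k
    split_ifs
    · rw [norm_zero]; positivity
    · rw [norm_mul, norm_pow, mul_comm]
      refine mul_le_mul ?_ (ha k) (norm_nonneg _) (by positivity)
      exact (pow_le_pow_left₀ (norm_nonneg _) hx' _).trans (pow_le_pow_right₀ hΛ (by omega))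
  | coe q =>
    have hx' : η ≤ ‖x - q‖ := by
      by_contra! h
      exact hx (Or.inl ⟨q, rfl, by rwa [mem_ball, dist_eq_norm]⟩)
    rw [principalTerm_coe]
    refine hsum _ fun k => ?_
    have hB' := hB k
    have h0 : 0 < ‖x - q‖ := hη.trans_le hx'
    rw [norm_div, norm_pow, div_eq_inv_mul, ← inv_pow]
    refine mul_le_mul ?_ (ha k) (norm_nonneg _) (by positivity)
    have : ‖x - q‖⁻¹ ≤ Λ := (inv_anti₀ hη hx').trans (le_max_right _ _)
    exact (pow_le_pow_left₀ (by positivity) this _).trans (pow_le_pow_right₀ hΛ (by omega))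

theorem hasPrincipalPart_coe_iff {f : ℂ → ℂ} {q : ℂ} {m : ℕ} {a : Fin m → ℂ} :
    HasPrincipalPart f (q : OnePoint ℂ) a ↔ ∃ g : ℂ → ℂ, AnalyticAt ℂ g q ∧
      ∀ᶠ x in 𝓝[≠] q, f x - principalTerm (q : OnePoint ℂ) a x = g x := by
  have htr : Tendsto (fun x : ℂ => x - q) (𝓝[≠] q) (𝓝[≠] 0) := by
    refine tendsto_nhdsWithin_iff.2 ⟨?_, ?_⟩
    · have : Tendsto (fun x : ℂ => x - q) (𝓝 q) (𝓝 (q - q)) := by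
        exact (continuous_id.sub continuous_const).tendsto q
      rw [sub_self] at this
      exact this.mono_left nhdsWithin_le_nhds
    · filter_upwards [self_mem_nhdsWithin] with x hx
      exact sub_ne_zero.2 hx
  have htr' : Tendsto (fun u : ℂ => q + u) (𝓝[≠] 0) (𝓝[≠] q) := by
    refine tendsto_nhdsWithin_iff.2 ⟨?_, ?_⟩
    · have : Tendsto (fun u : ℂ => q + u) (𝓝 0) (𝓝 (q + 0)) := by
        exact (continuous_const.add continuous_id).tendsto 0
      rw [add_zero] at this
      exact this.mono_left nhdsWithin_le_nhds
    · filter_upwards [self_mem_nhdsWithin] with u hu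
      simpa using hu
  constructor
  · rintro ⟨g, hg, h⟩
    refine ⟨fun x => g (x - q), ?_, ?_⟩
    · have hg' : AnalyticAt ℂ g (q - q) := by rwa [sub_self]
      exact AnalyticAt.comp (f := fun x : ℂ => x - q) hg' (analyticAt_id.sub analyticAt_const)
    · filter_upwards [htr.eventually h] with x hx
      rw [← hx, localCoeff_coe, principalTerm_coe, add_sub_cancel]
  · rintro ⟨g, hg, h⟩
    refine ⟨fun u => g (q + u), ?_, ?_⟩
    · have hg' : AnalyticAt ℂ g (q + 0) := by rwa [add_zero]
      exact AnalyticAt.comp (f := fun u : ℂ => q + u) hg' (analyticAt_const.add analyticAt_id)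
    · filter_upwards [htr'.eventually h] with u hu
      rw [← hu, localCoeff_coe, principalTerm_coe, add_sub_cancel_left]

/-- With `x / (x - q) = 1 + q / (x - q)`, only the simple pole survives in the limit. -/
theorem tendsto_mul_principalTerm (q : ℂ) {m : ℕ} (a : Fin m → ℂ) :
    Tendsto (fun x => x * principalTerm (q : OnePoint ℂ) a x) (cocompact ℂ) (𝓝 (residue a)) := by
  have h0 : Tendsto (fun v : ℂ => (v - q)⁻¹) (cocompact ℂ) (𝓝 0) := by
    refine (tendsto_inv₀_cobounded).comp ?_
    rw [← Metric.cobounded_eq_cocompact]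
    exact tendsto_sub_const_cobounded q
  have h1 : Tendsto (fun x : ℂ => ∑ k : Fin m, a k * ((1 + q * (x - q)⁻¹) * (x - q)⁻¹ ^ k.1))
      (cocompact ℂ) (𝓝 (∑ k : Fin m, a k * ((1 + q * 0) * 0 ^ k.1))) :=
    tendsto_finsetSum _ fun k _ =>
      (((h0.const_mul q).const_add 1).mul (h0.pow k.1)).const_mul (a k)
  have h2 : ∑ k : Fin m, a k * ((1 + q * 0) * 0 ^ k.1) = residue a := by
    refine Finset.sum_congr rfl fun k _ => ?_
    split_ifs with h <;> simp [h]
  rw [h2] at h1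
  refine h1.congr' ?_
  have : ∀ᶠ v in cocompact ℂ, v ≠ q := (isCompact_singleton (x := q)).compl_mem_cocompact
  filter_upwards [this] with x hx
  have := sub_ne_zero.2 hx
  rw [principalTerm_coe, Finset.mul_sum]
  refine Finset.sum_congr rfl fun k _ => ?_
  rw [pow_succ, inv_pow]
  field_simp
  ring

/-- Under `x = 1 / u`, `-x ^ (k - 1) dx` becomes `du / u ^ (k + 1)` for `k ≥ 1`. The term `k = 0` is
missing because `du / u = -dx / x` would create a pole at the finite point `0`. -/
theorem localCoeff_principalTerm_infty {m : ℕ} (a : Fin m → ℂ) {u : ℂ} (hu : u ≠ 0) :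
    localCoeff (principalTerm OnePoint.infty a) OnePoint.infty u =
      ∑ k : Fin m, a k / u ^ (k.1 + 1) - residue a / u := by
  rw [localCoeff_infty, principalTerm, if_pos rfl, neg_div, neg_neg, residue, Finset.sum_div,
    Finset.sum_div, ← Finset.sum_sub_distrib]
  refine Finset.sum_congr rfl fun k _ => ?_
  split_ifs with h
  · simp [h]
  · obtain ⟨j, hj⟩ := Nat.exists_eq_succ_of_ne_zero h
    rw [hj]
    simp only [Nat.succ_eq_add_one, Nat.add_sub_cancel, inv_pow, zero_div, sub_zero]
    field_simp
    ring

theorem tendsto_inv_cocompact : Tendsto (fun x : ℂ => x⁻¹) (cocompact ℂ) (𝓝[≠] 0) := by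
  refine tendsto_nhdsWithin_iff.2 ⟨?_, ?_⟩
  · rw [← Metric.cobounded_eq_cocompact]; exact tendsto_inv₀_cobounded
  · have : ∀ᶠ v in cocompact ℂ, v ≠ 0 := (isCompact_singleton (x := (0 : ℂ))).compl_mem_cocompact
    filter_upwards [this] with x hx using inv_ne_zero hx

theorem tendsto_inv_punctured : Tendsto (fun u : ℂ => u⁻¹) (𝓝[≠] 0) (cocompact ℂ) := by
  rw [← Metric.cobounded_eq_cocompact]; exact tendsto_inv₀_nhdsNE_zero

/-- The behaviour at infinity of a differential with a given principal part there. -/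
theorem HasPrincipalPart.tendsto_infty {f : ℂ → ℂ} {m : ℕ} {a : Fin m → ℂ}
    (h : HasPrincipalPart f OnePoint.infty a) :
    Tendsto (fun x => x * (f x - principalTerm OnePoint.infty a x)) (cocompact ℂ)
      (𝓝 (-residue a)) := by
  obtain ⟨g, hg, hfg⟩ := h
  -- This is the quantity in question in the variable `u = 1 / x`; the residue has a minus sign
  -- because `du / u = -dx / x`.
  have h1 : Tendsto (fun u => -(u * g u) - residue a) (𝓝[≠] 0) (𝓝 (-(0 * g 0) - residue a)) := by
    refine Tendsto.mono_left ?_ nhdsWithin_le_nhds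
    exact ((continuousAt_id.mul hg.continuousAt).neg.sub continuousAt_const).tendsto
  rw [zero_mul, neg_zero, zero_sub] at h1
  refine (h1.comp tendsto_inv_cocompact).congr' ?_
  have hne : ∀ᶠ v in cocompact ℂ, v ≠ 0 := (isCompact_singleton (x := (0 : ℂ))).compl_mem_cocompact
  filter_upwards [tendsto_inv_cocompact.eventually hfg, hne] with x hx hx0
  have h2 := localCoeff_principalTerm_infty a (inv_ne_zero hx0)
  rw [localCoeff_infty] at h2 hx
  rw [inv_inv] at h2 hx
  simp only [Function.comp_apply]
  rw [← hx]
  field_simp at h2 ⊢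
  linear_combination -h2

/-- A differential whose model at infinity is right has the given principal part there. -/
theorem hasPrincipalPart_infty_of_tendsto {f : ℂ → ℂ} {m : ℕ} {a : Fin m → ℂ}
    (hf : ∀ᶠ x in cocompact ℂ, DifferentiableAt ℂ f x)
    (h : Tendsto (fun x => x * (f x - principalTerm OnePoint.infty a x)) (cocompact ℂ)
      (𝓝 (-residue a))) : HasPrincipalPart f OnePoint.infty a := by
  set P : ℂ → ℂ := principalTerm OnePoint.infty a
  -- The limit hypothesis makes `0` a removable singularity with value `residue a`; the difference
  -- quotient of `H` at `0` is then the required holomorphic remainder.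
  set H : ℂ → ℂ := Function.update (fun u => -(u⁻¹ * (f u⁻¹ - P u⁻¹))) 0 (residue a)
  have hd : ∀ᶠ u in 𝓝[≠] (0 : ℂ), DifferentiableAt ℂ H u := by
    filter_upwards [tendsto_inv_punctured.eventually hf, self_mem_nhdsWithin] with u hu hu0
    have hu0 : u ≠ 0 := hu0
    have hi : DifferentiableAt ℂ (fun u : ℂ => u⁻¹) u := differentiableAt_inv hu0
    have hP : DifferentiableAt ℂ P u⁻¹ :=
      differentiableAt_principalTerm a (OnePoint.coe_ne_infty _)
    have : DifferentiableAt ℂ (fun u => -(u⁻¹ * (f u⁻¹ - P u⁻¹))) u :=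
      (hi.mul ((hu.comp u hi).sub (hP.comp u hi))).neg
    refine this.congr_of_eventuallyEq ?_
    filter_upwards [isOpen_ne.mem_nhds hu0] with v hv
    exact Function.update_of_ne hv _ _
  have hc : ContinuousAt H 0 := by
    rw [continuousAt_update_same]
    simpa using (h.comp tendsto_inv_punctured).neg
  have hH : AnalyticAt ℂ H 0 :=
    Complex.analyticAt_of_differentiable_on_punctured_nhds_of_continuousAt hd hc
  refine ⟨dslope H 0, ?_, ?_⟩
  · rw [Complex.analyticAt_iff_eventually_differentiableAt] at hH ⊢
    obtain ⟨U, hU, hUo, h0⟩ := _root_.eventually_nhds_iff.1 hH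
    have := (Complex.differentiableOn_dslope (hUo.mem_nhds h0)).2
      fun x hx => (hU x hx).differentiableWithinAt
    exact _root_.eventually_nhds_iff.2
      ⟨U, fun x hx => this.differentiableAt (hUo.mem_nhds hx), hUo, h0⟩
  · filter_upwards [self_mem_nhdsWithin] with u hu0
    have hu0 : u ≠ 0 := hu0
    have h2 := localCoeff_principalTerm_infty a hu0
    rw [dslope_of_ne _ hu0, slope_def_field]
    simp only [H, Function.update_self, Function.update_of_ne hu0]
    rw [localCoeff_infty] at h2 ⊢
    rw [sub_zero]
    have h3 : ∑ k : Fin m, a k / u ^ (k.1 + 1) = -(P u⁻¹ / u ^ 2) + residue a / u := by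
      rw [h2]; ring
    rw [h3]
    field_simp
    ring

/-- The coefficients of a principal part are bounded by the differential on a circle. -/
theorem HasPrincipalPart.norm_le {f : ℂ → ℂ} {q : OnePoint ℂ} {m : ℕ} {a : Fin m → ℂ}
    (h : HasPrincipalPart f q a) {σ r B : ℝ} (hσ : 0 < σ) (hσr : σ < r)
    (hd : DifferentiableOn ℂ (localCoeff f q) {u | 0 < ‖u‖ ∧ ‖u‖ < r})
    (hB : ∀ u, ‖u‖ = σ → ‖localCoeff f q u‖ ≤ B) (k : Fin m) : ‖a k‖ ≤ σ ^ (k.1 + 1) * B := by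
  obtain ⟨g, hg, hfg⟩ := h
  set G := localCoeff f q
  set S : ℂ → ℂ := fun u => ∑ n : Fin m, a n / u ^ (n.1 + 1)
  have hS : ∀ u : ℂ, u ≠ 0 → DifferentiableAt ℂ S u := fun u hu =>
    DifferentiableAt.fun_sum fun n _ =>
      (differentiableAt_const _).div (by fun_prop) (pow_ne_zero _ hu)
  set H : ℂ → ℂ := Function.update (fun u => G u - S u) 0 (g 0)
  have hHne : ∀ u, u ≠ 0 → H u = G u - S u := fun u hu => Function.update_of_ne hu _ _
  have hH0 : H =ᶠ[𝓝 0] g := by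
    have : ∀ᶠ u in 𝓝 (0 : ℂ), u ≠ 0 → G u - S u = g u := eventually_nhdsWithin_iff.1 hfg
    filter_upwards [this] with u hu
    by_cases h0 : u = 0
    · rw [h0]; exact Function.update_self _ _ _
    · rw [hHne u h0, hu h0]
  have hHd : DifferentiableOn ℂ H (ball 0 r) := fun u hu => by
    refine DifferentiableAt.differentiableWithinAt ?_
    by_cases h0 : u = 0
    · rw [h0]; exact hg.differentiableAt.congr_of_eventuallyEq hH0
    · have h1 : DifferentiableAt ℂ (fun u => G u - S u) u :=
        (hd.differentiableAt ((isOpen_annulus 0 r).mem_nhds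
          ⟨norm_pos_iff.2 h0, by simpa using hu⟩)).sub (hS u h0)
      refine h1.congr_of_eventuallyEq ?_
      filter_upwards [isOpen_ne.mem_nhds h0] with v hv using hHne v hv
  have hne : ∀ u ∈ sphere (0 : ℂ) σ, u ≠ 0 := fun u hu h0 => by
    rw [h0] at hu; simp [hσ.ne] at hu
  have hsph : sphere (0 : ℂ) σ ⊆ {u | 0 < ‖u‖ ∧ ‖u‖ < r} := fun u hu => by
    rw [mem_sphere_zero_iff_norm] at hu
    exact ⟨by rw [hu]; exact hσ, by rw [hu]; exact hσr⟩
  have h1 : (∮ u in C(0, σ), H u * u ^ k.1) = 0 :=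
    circleIntegral_eq_zero_of_ball hσ.le hσr (hHd.mul (by fun_prop))
  have h2 : (∮ u in C(0, σ), S u * u ^ k.1) = 2 * Real.pi * I * a k := by
    -- Multiplication by `u ^ k` moves the term `n` to the exponent `k - n - 1`, which is `-1`
    -- exactly for `n = k`.
    have h3 : ∀ n : Fin m, (∮ u in C(0, σ), a n * (u - 0) ^ ((k.1 : ℤ) - n.1 - 1)) =
        if n = k then 2 * Real.pi * I * a k else 0 := fun n => by
      rw [circleIntegral.integral_const_mul]
      split_ifs with hnk
      · rw [hnk, sub_self, zero_sub]
        simp only [zpow_neg_one]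
        rw [circleIntegral.integral_sub_center_inv _ hσ.ne']
        ring
      · rw [circleIntegral.integral_sub_zpow_of_ne, mul_zero]
        intro h
        exact hnk (Fin.ext (by omega))
    rw [circleIntegral.integral_congr hσ.le (g := fun u => ∑ n : Fin m,
      a n * (u - 0) ^ ((k.1 : ℤ) - n.1 - 1)) fun u hu => ?_, circleIntegral.integral_fun_sum]
    · simp only [h3, Finset.sum_ite_eq', Finset.mem_univ, if_true]
    · intro n _
      refine ContinuousOn.circleIntegrable hσ.le ((continuousOn_const (c := a n)).mul ?_)
      exact ((continuousOn_id' _).sub (continuousOn_const (c := (0 : ℂ)))).zpow₀ _ fun u hu =>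
        Or.inl (by simpa using hne u hu)
    · simp only [S, Finset.sum_mul, sub_zero]
      refine Finset.sum_congr rfl fun n _ => ?_
      have := hne u hu
      rw [sub_sub, zpow_sub₀ this, div_mul_eq_mul_div, mul_div_assoc, zpow_natCast]
      norm_cast
  have h4 : (∮ u in C(0, σ), G u * u ^ k.1) = 2 * Real.pi * I * a k := by
    rw [← h2, ← sub_eq_zero, ← circleIntegral.integral_sub]
    · refine (circleIntegral.integral_congr hσ.le fun u hu => ?_).trans h1
      simp only [hHne u (hne u hu)]
      ring
    · exact ((hd.continuousOn.mono hsph).mul (by fun_prop)).circleIntegrable hσ.le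
    · refine ContinuousOn.circleIntegrable hσ.le (ContinuousOn.mul (fun u hu => ?_) (by fun_prop))
      exact (hS u (hne u hu)).continuousAt.continuousWithinAt
  have h5 : a k = (2 * Real.pi * I)⁻¹ * ∮ u in C(0, σ), G u * u ^ k.1 := by
    rw [h4, inv_mul_cancel_left₀ two_pi_I_ne_zero]
  have h6 := circleIntegral.norm_integral_le_of_norm_le_const (f := fun u => G u * u ^ k.1)
    (c := 0) (C := B * σ ^ k.1) hσ.le fun u hu => by
      rw [mem_sphere_zero_iff_norm] at hu
      rw [norm_mul, norm_pow, hu]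
      gcongr
      exact hB u hu
  rw [h5, norm_mul, norm_two_pi_I_inv]
  calc (2 * Real.pi)⁻¹ * _ ≤ (2 * Real.pi)⁻¹ * (2 * Real.pi * σ * (B * σ ^ k.1)) := by gcongr
    _ = σ ^ (k.1 + 1) * B := by field_simp; ring

end OpeningNodes

namespace OpeningNodes

open Set Filter

/-! ### Monotonic norms -/

namespace ESeminorm

variable {X : Type*} [AddCommGroup X] [Module ℂ X]

theorem val_injective (p : ESeminorm X) : Function.Injective p.val := Subtype.val_injective

/-- A vector of finite norm as an element of the space. -/
def lift (p : ESeminorm X) (x : X) (hx : p x < ∞) : p.Space := ⟨x, hx⟩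

theorem val_lift (p : ESeminorm X) (x : X) (hx : p x < ∞) : p.val (p.lift x hx) = x := rfl

theorem norm_le_of_le (p : ESeminorm X) {x : p.Space} {c : ℝ≥0∞} (hc : c ≠ ∞)
    (h : p (p.val x) ≤ c) : ‖x‖ ≤ c.toReal := ENNReal.toReal_mono hc h

theorem enorm_eq (p : ESeminorm X) (x : p.Space) : p (p.val x) = ENNReal.ofReal ‖x‖ := by
  rw [norm_def, ENNReal.ofReal_toReal (p.val_lt_top x).ne]

end ESeminorm

namespace MonotonicNorm

variable {ι : Type*} (N : MonotonicNorm ι)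

theorem apply_norm (α : ι → ℂ) : N (fun i => ((‖α i‖ : ℝ) : ℂ)) = N α :=
  le_antisymm (N.mono' _ _ fun i => by simp) (N.mono' _ _ fun i => by simp)

theorem mono_real {u w : ι → ℝ} (hu : ∀ i, 0 ≤ u i) (h : ∀ i, u i ≤ w i) :
    N (fun i => (u i : ℂ)) ≤ N (fun i => (w i : ℂ)) :=
  N.mono' _ _ fun i => by
    rw [Complex.norm_of_nonneg (hu i), Complex.norm_of_nonneg ((hu i).trans (h i))]
    exact h i

theorem add_real_le (u w : ι → ℝ) : N (fun i => ((u i + w i : ℝ) : ℂ)) ≤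
    N (fun i => (u i : ℂ)) + N (fun i => (w i : ℂ)) := by
  refine le_trans (le_of_eq ?_) (N.add_le' _ _)
  congr 1
  funext i
  simp

theorem mul_real {c : ℝ} (hc : 0 ≤ c) (u : ι → ℝ) : N (fun i => ((c * u i : ℝ) : ℂ)) =
    ENNReal.ofReal c * N (fun i => (u i : ℂ)) := by
  rw [← enorm_of_nonneg_real hc, ← N.smul']
  congr 1
  funext i
  simp
where
  enorm_of_nonneg_real {c : ℝ} (hc : 0 ≤ c) : ‖(c : ℂ)‖ₑ = ENNReal.ofReal c := by
    rw [← ofReal_norm, Complex.norm_of_nonneg hc]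

theorem enorm_apply_mul_le [DecidableEq ι] (α : ι → ℂ) (i : ι) :
    ‖α i‖ₑ * N (Pi.single i 1) ≤ N α := by
  rw [← N.smul']
  refine N.mono' _ _ fun j => ?_
  by_cases h : j = i
  · subst h; simp
  · simp [Pi.single_eq_of_ne h]

/-- Monotonicity compares a vector with its single coordinate `i`, so convergence in the norm
implies coordinatewise convergence. -/
theorem exists_eval_bound (i : ι) : ∃ C : ℝ, ∀ x : N.Space,
    ‖N.toESeminorm.val x i‖ ≤ C * ‖x‖ := by
  classical
  set D := N (Pi.single i 1)
  have hD : D ≠ 0 := fun h => by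
    have := congrFun (N.eq_zero' _ h) i
    simp at this
  refine ⟨D.toReal⁻¹, fun x => ?_⟩
  have h := N.enorm_apply_mul_le (N.toESeminorm.val x) i
  have hx := N.toESeminorm.val_lt_top x
  -- If the unit vector has infinite norm, the coordinate vanishes on the whole space, and the
  -- constant is `0⁻¹ = 0`.
  by_cases hD' : D = ∞
  · have h0 : N.toESeminorm.val x i = 0 := by
      by_contra hne
      rw [show N (Pi.single i 1) = ∞ from hD', ENNReal.mul_top (by simpa using hne)] at h
      exact absurd hx (not_lt.2 h)
    rw [h0, norm_zero, hD']
    simp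
  · have hpos : 0 < D.toReal := ENNReal.toReal_pos hD hD'
    have h2 := ENNReal.toReal_mono hx.ne h
    rw [ENNReal.toReal_mul, toReal_enorm] at h2
    rw [inv_mul_eq_div, le_div_iff₀ hpos]
    exact h2

theorem continuous_eval (i : ι) : Continuous fun x : N.Space => N.toESeminorm.val x i := by
  obtain ⟨C, hC⟩ := N.exists_eval_bound i
  exact AddMonoidHomClass.continuous_of_bound (LinearMap.proj i ∘ₗ N.toESeminorm.val) C hC

variable {X : Type*} [AddCommGroup X] [Module ℂ X] (s : ι → ESeminorm X)

theorem comp_le {x : X} {u : ι → ℝ} (hu : ∀ i, 0 ≤ u i) (h : ∀ i, s i x ≤ ENNReal.ofReal (u i)) :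
    N.comp s x ≤ N (fun i => (u i : ℂ)) := by
  have hne : ∀ i, s i x ≠ ∞ := fun i => ne_top_of_le_ne_top ENNReal.ofReal_ne_top (h i)
  refine (N.ext_of_ne_top hne).trans_le (N.mono_real (fun i => ENNReal.toReal_nonneg) fun i => ?_)
  exact ENNReal.toReal_le_of_le_ofReal (hu i) (h i)

theorem ne_top_of_comp {x : X} (h : N.comp s x < ∞) (i : ι) : s i x ≠ ∞ := by
  by_contra hi
  exact h.ne (N.ext_of_not fun h' => h' i hi)

theorem comp_eq {x : X} (h : N.comp s x < ∞) :
    N.comp s x = N (fun i => (((s i x).toReal : ℝ) : ℂ)) :=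
  N.ext_of_ne_top (N.ne_top_of_comp s h)

theorem eq_zero_of_comp {x : X} (h : N.comp s x = 0) (i : ι) : s i x = 0 := by
  have hlt : N.comp s x < ∞ := by rw [h]; exact ENNReal.zero_lt_top
  have h1 := congrFun (N.eq_zero' _ ((N.comp_eq s hlt).symm.trans h)) i
  have h2 : (s i x).toReal = 0 := by simpa using h1
  exact ((ENNReal.toReal_eq_zero_iff _).1 h2).resolve_right (N.ne_top_of_comp s hlt i)

/-- A space of families of vectors of Banach spaces is complete if the norm of a family is computed
by a complete monotonic norm. -/
theorem completeSpace_comp [CompleteSpace N.Space] {Y : ι → Type*}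
    [∀ i, NormedAddCommGroup (Y i)] [∀ i, NormedSpace ℂ (Y i)] [∀ i, CompleteSpace (Y i)]
    (s : ι → ESeminorm (∀ i, Y i)) (hs : ∀ i x, s i x = ‖x i‖ₑ) :
    CompleteSpace (N.comp s).Space := by
  refine Metric.complete_of_convergent_controlled_sequences (fun n => (1 / 2) ^ n)
    (fun n => by positivity) fun x hx => ?_
  set a : ℕ → ∀ i, Y i := fun n => (N.comp s).val (x n)
  set w : ℕ → ι → ℝ := fun n i => ‖a (n + 1) i - a n i‖
  have hsr : ∀ i y, (s i y).toReal = ‖y i‖ := fun i y => by rw [hs, toReal_enorm]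
  have hw : ∀ n, N (fun i => (w n i : ℂ)) = ENNReal.ofReal ‖x (n + 1) - x n‖ := fun n => by
    rw [← ESeminorm.enorm_eq, N.comp_eq s ((N.comp s).val_lt_top _)]
    simp only [hsr, map_sub, Pi.sub_apply, w, a]
  -- The norms of the successive increments form vectors `W n` with an absolutely convergent series.
  -- Evaluation being continuous, the increments are summable in each fibre, and the limit exists
  -- fibre by fibre.
  set W : ℕ → N.Space := fun n => N.toESeminorm.lift (fun i => (w n i : ℂ)) (by
    rw [hw]; exact ENNReal.ofReal_lt_top)
  have hWn : ∀ n, ‖W n‖ ≤ (1 / 2) ^ n := fun n => by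
    have : ‖W n‖ = ‖x (n + 1) - x n‖ := by
      rw [ESeminorm.norm_def, ESeminorm.val_lift, hw, ENNReal.toReal_ofReal (norm_nonneg _)]
    rw [this, ← dist_eq_norm]
    exact (hx n _ _ (Nat.le_succ n) le_rfl).le
  have hWs : Summable W := Summable.of_norm_bounded summable_geometric_two hWn
  obtain ⟨S, hS⟩ := hWs
  have hval : ∀ i, HasSum (fun n => (w n i : ℂ)) (N.toESeminorm.val S i) := fun i =>
    hS.map (LinearMap.proj i ∘ₗ N.toESeminorm.val) (N.continuous_eval i)
  have hsum : ∀ i, Summable fun n => w n i := fun i => Complex.summable_ofReal.1 (hval i).summable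
  have hdist : ∀ i n, dist (a n i) (a (n + 1) i) ≤ w n i := fun i n => by
    rw [dist_comm, dist_eq_norm]
  have hlim : ∀ i, ∃ b, Tendsto (fun n => a n i) atTop (𝓝 b) := fun i =>
    cauchySeq_tendsto_of_complete (cauchySeq_of_dist_le_of_summable _ (hdist i) (hsum i))
  choose b hb using hlim
  set T : ℕ → N.Space := fun n => S - ∑ k ∈ Finset.range n, W k
  have hT : Tendsto (fun n => ‖T n‖) atTop (𝓝 0) := by
    have := (tendsto_const_nhds (x := S)).sub hS.tendsto_sum_nat
    rw [sub_self] at this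
    simpa using this.norm
  have htail : ∀ n i, N.toESeminorm.val (T n) i = ((∑' k, w (n + k) i : ℝ) : ℂ) := fun n i => by
    have h1 : N.toESeminorm.val (T n) i =
        N.toESeminorm.val S i - ∑ k ∈ Finset.range n, (w k i : ℂ) := by
      simp only [T, map_sub, map_sum, Pi.sub_apply, Finset.sum_apply]
      rfl
    rw [h1, ← (hval i).tsum_eq, ← Complex.ofReal_tsum, ← (hsum i).sum_add_tsum_nat_add n]
    simp only [add_comm n]
    push_cast
    ring
  -- The distance to the limit is dominated, index by index, by the tail of the series; monotonicity
  -- passes this to the norm.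
  have hbn : ∀ n, N.comp s (b - a n) ≤ ENNReal.ofReal ‖T n‖ := fun n => by
    rw [← N.toESeminorm.enorm_eq]
    refine (N.comp_le s (u := fun i => ∑' k, w (n + k) i)
      (fun i => tsum_nonneg fun k => norm_nonneg _) fun i => ?_).trans_eq ?_
    · rw [hs, ← ofReal_norm]
      refine ENNReal.ofReal_le_ofReal ?_
      rw [Pi.sub_apply, ← dist_eq_norm, dist_comm]
      exact dist_le_tsum_of_dist_le_of_tendsto _ (hdist i) (hsum i) (hb i) n
    · congr 1
      funext i
      exact (htail n i).symm
  have hfin : N.comp s b < ∞ := by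
    have h1 : b = (b - a 0) + a 0 := by abel
    rw [h1]
    exact ((N.comp s).add_le' _ _).trans_lt (ENNReal.add_lt_top.2
      ⟨(hbn 0).trans_lt ENNReal.ofReal_lt_top, (N.comp s).val_lt_top _⟩)
  refine ⟨(N.comp s).lift b hfin, ?_⟩
  rw [tendsto_iff_norm_sub_tendsto_zero]
  refine squeeze_zero (fun _ => norm_nonneg _) (fun n => ?_) hT
  rw [norm_sub_rev]
  refine ((N.comp s).norm_le_of_le ENNReal.ofReal_ne_top (hbn n)).trans_eq ?_
  rw [ENNReal.toReal_ofReal (norm_nonneg _)]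

end MonotonicNorm

/-- Over each vertex the supremum of the coefficients is the sup norm of a finite-dimensional space,
so `completeSpace_comp` applies. -/
theorem Poles.completeSpace_parts {V : Type*} (Q : Poles V) (NV : MonotonicNorm V)
    [CompleteSpace NV.Space] : CompleteSpace (Q.partNorm NV).Space := by
  refine NV.completeSpace_comp (Y := fun v => ∀ i : Fin (Q.n v), Fin (Q.m v i) → ℂ) _
    fun v a => ?_
  refine le_antisymm (iSup_le fun k => ?_) ?_
  · rw [← ofReal_norm, ← ofReal_norm]
    exact ENNReal.ofReal_le_ofReal
      ((norm_le_pi_norm (a v k.1) k.2).trans (norm_le_pi_norm (a v) k.1))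
  · by_cases h : (⨆ k : (Σ i : Fin (Q.n v), Fin (Q.m v i)), ‖a v k.1 k.2‖ₑ) = ∞
    · exact le_top.trans_eq h.symm
    · rw [← ofReal_norm]
      refine ENNReal.ofReal_le_of_le_toReal ?_
      refine (pi_norm_le_iff_of_nonneg ENNReal.toReal_nonneg).2 fun i =>
        (pi_norm_le_iff_of_nonneg ENNReal.toReal_nonneg).2 fun j => ?_
      rw [← toReal_enorm]
      exact ENNReal.toReal_mono h (le_iSup
        (fun k : (Σ i : Fin (Q.n v), Fin (Q.m v i)) => ‖a v k.1 k.2‖ₑ) ⟨i, j⟩)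

/-- The fixed point equation `y = F + T y` for a linear map of norm at most `1 / 2`. -/
theorem exists_norm_sub_add_eq_zero {Z : Type*} [SeminormedAddCommGroup Z] [NormedSpace ℂ Z]
    [CompleteSpace Z] (T : Z →ₗ[ℂ] Z) (hT : ∀ y, ‖T y‖ ≤ 1 / 2 * ‖y‖) (F : Z) :
    ∃ y, ‖y - (F + T y)‖ = 0 := by
  have hTc : Continuous T := AddMonoidHomClass.continuous_of_bound T _ hT
  -- Picard iteration. The space is only seminormed, so the limit satisfies the equation up to a
  -- vector of norm zero.
  set x : ℕ → Z := fun n => (fun y => F + T y)^[n] 0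
  have hx : ∀ n, x (n + 1) = F + T (x n) := fun n => Function.iterate_succ_apply' _ _ _
  have hd : ∀ n, dist (x n) (x (n + 1)) ≤ ‖F‖ * (1 / 2) ^ n := fun n => by
    induction n with
    | zero =>
      rw [hx 0, dist_eq_norm]
      simp [x]
    | succ n ih =>
      rw [hx n, hx (n + 1), dist_eq_norm, add_sub_add_left_eq_sub, ← map_sub]
      rw [dist_eq_norm] at ih
      calc _ ≤ 1 / 2 * ‖x n - x (n + 1)‖ := hT _
        _ ≤ 1 / 2 * (‖F‖ * (1 / 2) ^ n) := by gcongr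
        _ = _ := by ring
  obtain ⟨y, hy⟩ := cauchySeq_tendsto_of_complete
    (cauchySeq_of_le_geometric (1 / 2) ‖F‖ (by norm_num) hd)
  refine ⟨y, ?_⟩
  have h1 : Tendsto (fun n => x (n + 1)) atTop (𝓝 (F + T y)) := by
    simp only [hx]
    exact ((hTc.tendsto y).comp hy).const_add F
  have h2 := (hy.comp (tendsto_add_atTop_nat 1)).sub h1
  have h3 : Tendsto (fun n => ‖x (n + 1) - x (n + 1)‖) atTop (𝓝 ‖y - (F + T y)‖) := h2.norm
  simp only [sub_self, norm_zero] at h3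
  exact (tendsto_nhds_unique tendsto_const_nhds h3).symm

end OpeningNodes

namespace OpeningNodes

open Complex Metric Set Filter

variable {V E : Type*} {Γ : MultiGraph V E}

/-! ### Half-edges -/

namespace MultiGraph

/-- The other end of an edge. -/
def opp (h : E × Bool) : E × Bool := (h.1, !h.2)

@[simp] theorem opp_opp (h : E × Bool) : opp (opp h) = h := by simp [opp]

variable (Γ : MultiGraph V E)

open Classical in
/-- The ends of edges that sit at a vertex. -/
noncomputable def halfEdges (v : V) : Finset (E × Bool) :=
  Γ.inEdges v ×ˢ {true} ∪ Γ.outEdges v ×ˢ {false}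

theorem mem_halfEdges {v : V} {h : E × Bool} : h ∈ Γ.halfEdges v ↔ Γ.vert h = v := by
  obtain ⟨e, b⟩ := h
  cases b <;> simp [halfEdges, inEdges, outEdges, vert]

theorem sum_halfEdges {M : Type*} [AddCommMonoid M] (v : V) (f : E × Bool → M) :
    ∑ h ∈ Γ.halfEdges v, f h =
      ∑ e ∈ Γ.inEdges v, f (e, true) + ∑ e ∈ Γ.outEdges v, f (e, false) := by
  classical
  rw [halfEdges, Finset.sum_union, Finset.sum_product, Finset.sum_product]
  · simp
  · rw [Finset.disjoint_left]
    rintro ⟨e, b⟩ h1 h2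
    simp only [Finset.mem_product, Finset.mem_singleton] at h1 h2
    simp [h1.2] at h2

theorem inEdges_subset (v : V) : Γ.inEdges v ⊆ Γ.edges v := fun e he => by
  simp only [inEdges, edges, Set.Finite.mem_toFinset] at he ⊢
  exact Or.inr he

theorem outEdges_subset (v : V) : Γ.outEdges v ⊆ Γ.edges v := fun e he => by
  simp only [outEdges, edges, Set.Finite.mem_toFinset] at he ⊢
  exact Or.inl he

/-- An incoming edge contributes its source and an outgoing edge its target. This also covers a
loop, which has two ends at `v` but is one element of `edges v`. -/
theorem sum_halfEdges_opp_le {B : V → ℝ} (hB : ∀ v, 0 ≤ B v) (v : V) :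
    ∑ h ∈ Γ.halfEdges v, B (Γ.vert (opp h)) ≤ ∑ e ∈ Γ.edges v, (B (Γ.src e) + B (Γ.tgt e)) := by
  rw [sum_halfEdges, Finset.sum_add_distrib]
  exact add_le_add
    (Finset.sum_le_sum_of_subset_of_nonneg (Γ.inEdges_subset v) fun e _ _ => hB (Γ.src e))
    (Finset.sum_le_sum_of_subset_of_nonneg (Γ.outEdges_subset v) fun e _ _ => hB (Γ.tgt e))

/-- The factor `2` accounts for loops, both ends of which sit at `v`. -/
theorem sum_halfEdges_fst_le {A : E → ℝ} (hA : ∀ e, 0 ≤ A e) (v : V) :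
    ∑ h ∈ Γ.halfEdges v, A h.1 ≤ 2 * ∑ e ∈ Γ.edges v, A e := by
  rw [sum_halfEdges, two_mul]
  exact add_le_add
    (Finset.sum_le_sum_of_subset_of_nonneg (Γ.inEdges_subset v) fun e _ _ => hA e)
    (Finset.sum_le_sum_of_subset_of_nonneg (Γ.outEdges_subset v) fun e _ _ => hA e)

end MultiGraph

open MultiGraph

/-- The residue at the node `p_e^±` of a differential with period `α_e`. -/
noncomputable def nodeResidue (α : E → ℂ) (h : E × Bool) : ℂ :=
  (2 * Real.pi * I)⁻¹ * cond h.2 (α h.1) (-α h.1)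

theorem nodeResidue_opp (α : E → ℂ) (h : E × Bool) :
    nodeResidue α (opp h) = -nodeResidue α h := by
  obtain ⟨e, b⟩ := h
  cases b <;> simp [nodeResidue, opp]

theorem norm_nodeResidue (α : E → ℂ) (h : E × Bool) :
    ‖nodeResidue α h‖ = (2 * Real.pi)⁻¹ * ‖α h.1‖ := by
  obtain ⟨e, b⟩ := h
  rw [nodeResidue, norm_mul, norm_two_pi_I_inv]
  cases b <;> simp

theorem sum_nodeResidue (Γ : MultiGraph V E) (α : E → ℂ) (v : V) :
    ∑ h ∈ Γ.halfEdges v, nodeResidue α h = (2 * Real.pi * I)⁻¹ *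
      (∑ e ∈ Γ.inEdges v, α e - ∑ e ∈ Γ.outEdges v, α e) := by
  rw [sum_halfEdges]
  simp only [nodeResidue, cond_true, cond_false, ← Finset.mul_sum, Finset.sum_neg_distrib]
  ring

/-! ### Charts -/

/-- The inverse of a holomorphic chart is univalent. -/
theorem univalent_symm (z : OpenPartialHomeomorph ℂ ℂ) {ρ : ℝ}
    (hz : DifferentiableOn ℂ z z.source) (ht : z.target = ball 0 ρ) : Univalent z.symm ρ := by
  have hinj : InjOn z.symm (ball 0 ρ) := by rw [← ht]; exact z.symm.injOn
  have hd : ∀ u ∈ ball (0 : ℂ) ρ, DifferentiableAt ℂ z.symm u := fun u hu => by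
    rw [← ht] at hu
    set x := z.symm u
    have hx : x ∈ z.source := z.map_target hu
    have han : AnalyticAt ℂ (deriv z) x := (hz.deriv z.open_source).analyticAt
      (z.open_source.mem_nhds hx)
    -- Zeros of the derivative are isolated, since otherwise `z` would be locally constant and not
    -- injective. Hence the inverse is holomorphic on a punctured neighbourhood and continuous, and
    -- the singularity is removable.
    have hne : ∀ᶠ y in 𝓝[≠] x, deriv z y ≠ 0 := by
      refine han.eventually_eq_zero_or_eventually_ne_zero.resolve_left fun h0 => ?_
      obtain ⟨d, hd, hball⟩ := Metric.eventually_nhds_iff_ball.1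
        (h0.and (z.open_source.mem_nhds hx))
      have hc : ∀ y ∈ ball x d, z y = z x := fun y hy =>
        isOpen_ball.is_const_of_deriv_eq_zero (convex_ball x d).isPreconnected
          (hz.mono fun y hy => (hball y hy).2) (fun y hy => (hball y hy).1) hy (mem_ball_self hd)
      have hy : x + (d / 2 : ℝ) ∈ ball x d := by
        rw [mem_ball, dist_eq_norm, add_sub_cancel_left, Complex.norm_of_nonneg (by positivity)]
        linarith
      have := z.injOn (hball _ hy).2 hx (hc _ hy)
      have h2 : ((d / 2 : ℝ) : ℂ) = 0 := by simpa using this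
      rw [ofReal_eq_zero] at h2
      linarith
    refine (Complex.analyticAt_of_differentiable_on_punctured_nhds_of_continuousAt ?_
      (z.symm.continuousAt hu)).differentiableAt
    have htend : Tendsto z.symm (𝓝[≠] u) (𝓝[≠] x) := by
      refine tendsto_nhdsWithin_iff.2
        ⟨(z.symm.continuousAt hu).tendsto.mono_left nhdsWithin_le_nhds, ?_⟩
      filter_upwards [self_mem_nhdsWithin,
        nhdsWithin_le_nhds (z.open_target.mem_nhds hu)] with w hw hwt h
      exact hw (z.symm.injOn hwt hu h)
    filter_upwards [htend.eventually hne, nhdsWithin_le_nhds (z.open_target.mem_nhds hu)]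
      with w hw hwt
    have hw' := (hz.differentiableAt (z.open_source.mem_nhds (z.map_target hwt))).hasDerivAt
    exact (z.hasDerivAt_symm hwt hw hw').differentiableAt
  refine ⟨fun u hu => (hd u hu).differentiableWithinAt, hinj, fun u hu h0 => ?_⟩
  have h1 : HasDerivAt (fun w => z (z.symm w)) (deriv z (z.symm u) * deriv z.symm u) u := by
    rw [← ht] at hu
    refine HasDerivAt.comp u ?_ (hd u (by rwa [← ht])).hasDerivAt
    exact (hz.differentiableAt (z.open_source.mem_nhds (z.map_target hu))).hasDerivAt
  have h2 : (fun w => z (z.symm w)) =ᶠ[𝓝 u] id := by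
    rw [← ht] at hu
    filter_upwards [z.open_target.mem_nhds hu] with w hw using z.right_inv hw
  have h3 := (h1.congr_of_eventuallyEq h2.symm).unique (hasDerivAt_id u)
  rw [h0, mul_zero] at h3
  exact zero_ne_one h3

namespace AdmissibleCoordinates

variable (A : AdmissibleCoordinates Γ)

/-- The parametrization of the disk `D_e^±` that is inverse to the coordinate. -/
noncomputable def X (h : E × Bool) : ℂ → ℂ := (A.z h).symm

theorem univalent (h : E × Bool) : Univalent (A.X h) A.ρ :=
  univalent_symm (A.z h) (A.holo h) (A.target_eq h)

theorem mem_target {h : E × Bool} {u : ℂ} : u ∈ (A.z h).target ↔ ‖u‖ < A.ρ := by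
  rw [A.target_eq, mem_ball_zero_iff]

theorem X_mem {h : E × Bool} {u : ℂ} (hu : ‖u‖ < A.ρ) : A.X h u ∈ (A.z h).source :=
  (A.z h).map_target (A.mem_target.2 hu)

theorem z_X {h : E × Bool} {u : ℂ} (hu : ‖u‖ < A.ρ) : A.z h (A.X h u) = u :=
  (A.z h).right_inv (A.mem_target.2 hu)

theorem X_z {h : E × Bool} {x : ℂ} (hx : x ∈ (A.z h).source) : A.X h (A.z h x) = x :=
  (A.z h).left_inv hx

theorem norm_z_lt {h : E × Bool} {x : ℂ} (hx : x ∈ (A.z h).source) : ‖A.z h x‖ < A.ρ :=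
  A.mem_target.1 ((A.z h).map_source hx)

theorem X_zero (h : E × Bool) : A.X h 0 = A.p h := by
  rw [← A.z_p h, A.X_z (A.p_mem h)]

theorem lower_X {h : E × Bool} {u : ℂ} (hu : ‖u‖ < A.ρ) : A.c₁ * ‖u‖ ≤ ‖A.X h u - A.p h‖ := by
  simpa only [A.z_X hu] using A.lower h _ (A.X_mem hu)

theorem upper_X {h : E × Bool} {u : ℂ} (hu : ‖u‖ < A.ρ) : ‖A.X h u - A.p h‖ ≤ A.c₂ * ‖u‖ := by
  simpa only [A.z_X hu] using A.upper h _ (A.X_mem hu)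

theorem differentiableAt_z {h : E × Bool} {x : ℂ} (hx : x ∈ (A.z h).source) :
    DifferentiableAt ℂ (A.z h) x :=
  (A.holo h).differentiableAt ((A.z h).open_source.mem_nhds hx)

theorem differentiableAt_X {h : E × Bool} {u : ℂ} (hu : ‖u‖ < A.ρ) :
    DifferentiableAt ℂ (A.X h) u :=
  (A.univalent h).diff.differentiableAt (isOpen_ball.mem_nhds (mem_ball_zero_iff.2 hu))

theorem deriv_X_mul_deriv_z {h : E × Bool} {x : ℂ} (hx : x ∈ (A.z h).source) :
    deriv (A.X h) (A.z h x) * deriv (A.z h) x = 1 := by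
  have h1 : HasDerivAt (fun y => A.X h (A.z h y)) (deriv (A.X h) (A.z h x) * deriv (A.z h) x) x :=
    HasDerivAt.comp x (A.differentiableAt_X (A.norm_z_lt hx)).hasDerivAt
      (A.differentiableAt_z hx).hasDerivAt
  have h2 : (fun y => A.X h (A.z h y)) =ᶠ[𝓝 x] id := by
    filter_upwards [(A.z h).open_source.mem_nhds hx] with y hy using A.X_z hy
  exact (h1.congr_of_eventuallyEq h2.symm).unique (hasDerivAt_id x)

/-- Cauchy's estimate on a circle of radius `ρ / 4`, where `‖X - p‖ ≤ c₂ ρ`. -/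
theorem norm_deriv_X_le {h : E × Bool} {u : ℂ} (hu : ‖u‖ ≤ A.ρ / 2) :
    ‖deriv (A.X h) u‖ ≤ 4 * A.c₂ := by
  have hρ := A.ρ_pos
  have hsub : closedBall u (A.ρ / 4) ⊆ ball 0 A.ρ := fun w hw => by
    rw [mem_closedBall, dist_eq_norm] at hw
    rw [mem_ball_zero_iff]
    have := norm_le_norm_add_norm_sub' w u
    linarith
  have h1 : DiffContOnCl ℂ (fun w => A.X h w - A.p h) (ball u (A.ρ / 4)) := by
    refine DifferentiableOn.diffContOnCl ?_
    rw [closure_ball _ (by positivity)]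
    exact ((A.univalent h).diff.mono hsub).sub_const _
  have h2 := Complex.norm_deriv_le_of_forall_mem_sphere_norm_le (C := A.c₂ * A.ρ)
    (by positivity : 0 < A.ρ / 4) h1 fun w hw => by
      have hw' : ‖w‖ < A.ρ := mem_ball_zero_iff.1 (hsub (sphere_subset_closedBall hw))
      exact (A.upper_X hw').trans (mul_le_mul_of_nonneg_left hw'.le A.c₂_pos.le)
  rw [deriv_sub_const] at h2
  refine h2.trans_eq ?_
  field_simp

/-- The closed disk `|z_e^±| ≤ a`. -/
def core (a : ℝ) (h : E × Bool) : Set ℂ := {x | x ∈ (A.z h).source ∧ ‖A.z h x‖ ≤ a}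

theorem core_eq {a : ℝ} (ha : a < A.ρ) (h : E × Bool) : A.core a h = A.X h '' closedBall 0 a := by
  ext x
  constructor
  · rintro ⟨hx, hxa⟩
    exact ⟨A.z h x, by simpa using hxa, A.X_z hx⟩
  · rintro ⟨u, hu, rfl⟩
    rw [mem_closedBall_zero_iff] at hu
    have hu' := hu.trans_lt ha
    exact ⟨A.X_mem hu', by rwa [A.z_X hu']⟩

theorem isClosed_core {a : ℝ} (ha : a < A.ρ) (h : E × Bool) : IsClosed (A.core a h) := by
  rw [A.core_eq ha]
  refine ((isCompact_closedBall 0 a).image_of_continuousOn ?_).isClosed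
  exact (A.univalent h).diff.continuousOn.mono (closedBall_subset_ball ha)

/-- In a slightly smaller ball of radius `d`, the lower bound confines the chart domain to the
compact set `‖z‖ ≤ d / c₁`. The domain is therefore open and relatively closed in that ball, which
is connected. -/
theorem ball_subset_source (h : E × Bool) : ball (A.p h) (A.ρ * A.c₁) ⊆ (A.z h).source := by
  intro x hx
  rw [mem_ball, dist_eq_norm] at hx
  have hc := A.c₁_pos
  obtain ⟨d, hd1, hd2⟩ := exists_between hx
  have hd0 : 0 < d := (norm_nonneg _).trans_lt hd1
  have ha : d / A.c₁ < A.ρ := by rwa [div_lt_iff₀ hc]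
  have hsub : ball (A.p h) d ⊆ (A.z h).source := by
    have h1 : ball (A.p h) d ∩ (A.z h).source = ball (A.p h) d ∩ A.core (d / A.c₁) h := by
      ext y
      refine ⟨fun hy => ⟨hy.1, hy.2, ?_⟩, fun hy => ⟨hy.1, hy.2.1⟩⟩
      have := A.lower h y hy.2
      have h2 := hy.1
      rw [mem_ball, dist_eq_norm] at h2
      rw [le_div_iff₀ hc]
      linarith
    have h3 : (closure (A.z h).source ∩ ball (A.p h) d) ⊆ (A.z h).source := by
      intro y hy
      have : y ∈ closure ((A.z h).source ∩ ball (A.p h) d) :=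
        by
        rw [inter_comm] at hy ⊢
        exact isOpen_ball.inter_closure hy
      rw [inter_comm, h1] at this
      have h4 := closure_mono inter_subset_right this
      rw [(A.isClosed_core ha h).closure_eq] at h4
      exact h4.1
    exact (convex_ball (A.p h) d).isPreconnected.subset_of_closure_inter_subset (A.z h).open_source
      ⟨A.p h, mem_ball_self hd0, A.p_mem h⟩ h3
  exact hsub (by rwa [mem_ball, dist_eq_norm])

end AdmissibleCoordinates

end OpeningNodes

namespace OpeningNodes

open Complex Metric Set Filter MultiGraph

variable {V E : Type*} {Γ : MultiGraph V E}

/-! ### Radii -/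

theorem disk_mono (q : OnePoint ℂ) {a b : ℝ} (ha : 0 < a) (hab : a ≤ b) : disk q a ⊆ disk q b := by
  rintro x (⟨c, hc, hx⟩ | ⟨hq, hx⟩)
  · exact Or.inl ⟨c, hc, ball_subset_ball hab hx⟩
  · exact Or.inr ⟨hq, (inv_anti₀ ha hab).trans hx⟩

theorem ne_of_notMem_disk {q : OnePoint ℂ} {a : ℝ} (ha : 0 < a) {x : ℂ} (hx : x ∉ disk q a) :
    (x : OnePoint ℂ) ≠ q := fun h =>
  hx (Or.inl ⟨x, h.symm, mem_ball_self ha⟩)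

/-- The domain of `Cauchy` data: radii of a system of circles that separates the nodes and the
poles. -/
structure Radii (A : AdmissibleCoordinates Γ) (Q : Poles V) (r ε s η σ : ℝ) : Prop where
  sep : Q.Separated A r
  ε_pos : 0 < ε
  ε_le : ε ≤ A.ρ * A.c₁
  ε_lt : ε < r
  s_pos : 0 < s
  s_le : s ≤ A.ρ / 2
  s_le' : A.c₂ * s ≤ ε / 2
  η_pos : 0 < η
  η_le : η ≤ ε
  η_le' : η ≤ A.c₁ * s
  σ_pos : 0 < σ
  σ_le : σ ≤ s / 2
  σ_le' : A.c₂ * σ ≤ η / 2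

/-- Regular parts are read off on the circle `‖u‖ = s`, singular parts are represented by Cauchy
transforms over the smaller circle `‖u‖ = σ`. The choice of `s` puts the first circle inside `D(p, ε
/ 2)`; `η ≤ c₁ s` puts it outside `D(p, η)`; `c₂ σ ≤ η / 2` keeps the second circle at distance `η /
2` from `Ω_{v,η}`. -/
theorem exists_radii {A : AdmissibleCoordinates Γ} {Q : Poles V} {r ε : ℝ} (sep : Q.Separated A r)
    (hε : 0 < ε) (hεc : ε ≤ A.ρ * A.c₁) (hεr : ε < r) : ∃ s η σ, Radii A Q r ε s η σ := by
  have h1 := A.ρ_pos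
  have h2 := A.c₁_pos
  have h3 := A.c₂_pos
  have hmul : ∀ a b : ℝ, A.c₂ * min a (b / A.c₂) ≤ b := fun a b =>
    (mul_le_mul_of_nonneg_left (min_le_right _ _) h3.le).trans_eq (mul_div_cancel₀ _ h3.ne')
  set s := min (A.ρ / 2) ((ε / 2) / A.c₂)
  have hs : 0 < s := lt_min (by positivity) (by positivity)
  set η := min ε (A.c₁ * s)
  have hη : 0 < η := lt_min hε (by positivity)
  exact ⟨s, η, min (s / 2) ((η / 2) / A.c₂), sep, hε, hεc, hεr, hs, min_le_left _ _, hmul _ _, hη,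
    min_le_left _ _, min_le_right _ _, lt_min (by positivity) (by positivity), min_le_left _ _,
    hmul _ _⟩

namespace Radii

variable {A : AdmissibleCoordinates Γ} {Q : Poles V} {r ε s η σ : ℝ}

theorem s_lt (R : Radii A Q r ε s η σ) : s < A.ρ := by linarith [R.s_le, A.ρ_pos]

theorem σ_lt_s (R : Radii A Q r ε s η σ) : σ < s := by linarith [R.σ_le, R.s_pos]

theorem σ_lt (R : Radii A Q r ε s η σ) : σ < A.ρ := R.σ_lt_s.trans R.s_lt

theorem η_lt (R : Radii A Q r ε s η σ) : η < r := R.η_le.trans_lt R.ε_lt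

theorem ball_subset (R : Radii A Q r ε s η σ) (h : E × Bool) : ball (A.p h) ε ⊆ (A.z h).source :=
  (ball_subset_ball R.ε_le).trans (A.ball_subset_source h)

theorem notMem_source_of_ne (R : Radii A Q r ε s η σ)
    {h h' : E × Bool} (hne : h ≠ h') (hv : Γ.vert h = Γ.vert h') {x : ℂ}
    (hx : x ∈ closedBall (A.p h) ε) : x ∉ (A.z h').source := by
  have hd : Disjoint (ball (A.p h) ε) (A.z h').source :=
    (A.disjoint h h' hne hv).mono_left (R.ball_subset h)
  have := hd.closure_left (A.z h').open_source
  rw [closure_ball _ R.ε_pos.ne'] at this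
  exact Set.disjoint_left.1 this hx

theorem notMem_disk_of_source (R : Radii A Q r ε s η σ)
    {h : E × Bool} (i : Fin (Q.n (Γ.vert h))) {x : ℂ}
    (hx : x ∈ (A.z h).source) : x ∉ disk (Q.q (Γ.vert h) i) r :=
  Set.disjoint_left.1 (R.sep.1 _ i h rfl) hx

/-- Disjointness from the disk of radius `r` passes to the closed ball at the cost of shrinking to
radius `ε < r`. For a pole at infinity the closed ball lies in `‖y‖ ≤ r⁻¹ < ε⁻¹`. -/
theorem notMem_disk_of_closedBall (R : Radii A Q r ε s η σ)
    {h : E × Bool} (i : Fin (Q.n (Γ.vert h))) {x : ℂ}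
    (hx : x ∈ closedBall (A.p h) ε) : x ∉ disk (Q.q (Γ.vert h) i) ε := by
  have hd : Disjoint (ball (A.p h) ε) (disk (Q.q (Γ.vert h) i) r) :=
    (R.sep.1 _ i h rfl).mono_left (R.ball_subset h)
  have hr : 0 < r := R.ε_pos.trans R.ε_lt
  rintro (⟨c, hc, hxc⟩ | ⟨hq, hxq⟩)
  · have h1 : Disjoint (ball (A.p h) ε) (ball c r) :=
      hd.mono_right fun y hy => Or.inl ⟨c, hc, hy⟩
    have h2 := h1.closure_left isOpen_ball
    rw [closure_ball _ R.ε_pos.ne'] at h2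
    exact Set.disjoint_left.1 h2 hx (ball_subset_ball R.ε_lt.le hxc)
  · have h1 : ball (A.p h) ε ⊆ {y | ‖y‖ ≤ r⁻¹} := fun y hy => by
      by_contra! hlt
      exact Set.disjoint_left.1 hd hy (Or.inr ⟨hq, le_of_lt (by simpa using hlt)⟩)
    have h2 := closure_minimal h1 (isClosed_le continuous_norm continuous_const)
    rw [closure_ball _ R.ε_pos.ne'] at h2
    have h3 : ‖x‖ ≤ r⁻¹ := h2 hx
    have h4 : r⁻¹ < ε⁻¹ := inv_strictAnti₀ R.ε_pos R.ε_lt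
    linarith

/-- So the regular parts, and with them the integral equation, involve only values on `Ω_{v,η}`. The
condition `η ≤ c₁ s` handles the node itself, disjointness of the disks everything else. -/
theorem circle_mem_Omega (R : Radii A Q r ε s η σ) {h : E × Bool} {u : ℂ} (hu : ‖u‖ = s) :
    A.X h u ∈ A.Omega Q η (Γ.vert h) := by
  have hu' : ‖u‖ < A.ρ := hu.trans_lt R.s_lt
  refine ⟨fun h' hv hx => ?_, fun i hx => ?_⟩
  · by_cases hne : h' = h
    · subst hne
      have h1 := A.lower_X (h := h') hu'
      rw [hu] at h1
      rw [mem_ball, dist_eq_norm] at hx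
      linarith [R.η_le']
    · exact R.notMem_source_of_ne hne hv
        (ball_subset_closedBall (ball_subset_ball R.η_le hx)) (A.X_mem hu')
  · exact R.notMem_disk_of_source i (A.X_mem hu') (disk_mono _ R.η_pos R.η_lt.le hx)

/-- This is where the norm on `Ω_{v,ε}` provides the boundary values for the maximum principle on
`D(p, ε)`. -/
theorem sphere_subset_Omega (R : Radii A Q r ε s η σ)
    (h : E × Bool) : sphere (A.p h) ε ⊆ A.Omega Q ε (Γ.vert h) := by
  intro x hx
  refine ⟨fun h' hv hx' => ?_, fun i => R.notMem_disk_of_closedBall i (sphere_subset_closedBall hx)⟩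
  by_cases hne : h = h'
  · subst hne
    rw [mem_sphere] at hx
    rw [mem_ball, hx] at hx'
    exact lt_irrefl _ hx'
  · exact R.notMem_source_of_ne hne hv.symm (sphere_subset_closedBall hx) (R.ball_subset h' hx')

theorem Omega_subset (R : Radii A Q r ε s η σ)
    (v : V) : A.Omega Q ε v ⊆ A.Omega Q η v := fun _ hx =>
  ⟨fun h hv hx' => hx.1 h hv (ball_subset_ball R.η_le hx'),
    fun i hx' => hx.2 i (disk_mono _ R.η_pos R.η_le hx')⟩

theorem half_le_dist (R : Radii A Q r ε s η σ)
    {h : E × Bool} {x : ℂ} (hx : η ≤ ‖x - A.p h‖) {u : ℂ} (hu : ‖u‖ ≤ σ) :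
    η / 2 ≤ ‖x - A.X h u‖ := by
  have h1 := A.upper_X (h := h) (hu.trans_lt R.σ_lt)
  have h2 : A.c₂ * ‖u‖ ≤ η / 2 := (mul_le_mul_of_nonneg_left hu A.c₂_pos.le).trans R.σ_le'
  have h3 := norm_sub_le_norm_sub_add_norm_sub x (A.X h u) (A.p h)
  linarith

theorem ne_X_of_notMem_core (R : Radii A Q r ε s η σ)
    {h : E × Bool} {x : ℂ} (hx : x ∉ A.core σ h) {u : ℂ} (hu : ‖u‖ ≤ σ) :
    x ≠ A.X h u := by
  rintro rfl
  rw [A.core_eq R.σ_lt] at hx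
  exact hx ⟨u, by simpa using hu, rfl⟩

theorem notMem_core_of_le (R : Radii A Q r ε s η σ)
    {h : E × Bool} {x : ℂ} (hx : η ≤ ‖x - A.p h‖) : x ∉ A.core σ h := by
  rw [A.core_eq R.σ_lt]
  rintro ⟨u, hu, rfl⟩
  rw [mem_closedBall_zero_iff] at hu
  have := R.half_le_dist hx hu
  rw [sub_self, norm_zero] at this
  linarith [R.η_pos]

theorem ne_pole_of_Omega (R : Radii A Q r ε s η σ)
    {v : V} {x : ℂ} (hx : x ∈ A.Omega Q η v) (i : Fin (Q.n v)) :
    (x : OnePoint ℂ) ≠ Q.q v i := ne_of_notMem_disk R.η_pos (hx.2 i)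

theorem ne_pole_of_source (R : Radii A Q r ε s η σ) {h : E × Bool} {x : ℂ} (hx : x ∈ (A.z h).source)
    (i : Fin (Q.n (Γ.vert h))) : (x : OnePoint ℂ) ≠ Q.q (Γ.vert h) i :=
  ne_of_notMem_disk (R.ε_pos.trans R.ε_lt) (R.notMem_disk_of_source i hx)

end Radii

namespace AdmissibleCoordinates

variable (A : AdmissibleCoordinates Γ)

theorem le_dist_of_Omega {Q : Poles V} {η : ℝ} {h : E × Bool} {x : ℂ}
    (hx : x ∈ A.Omega Q η (Γ.vert h)) :
    η ≤ ‖x - A.p h‖ := by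
  have := hx.1 h rfl
  rwa [mem_ball, dist_eq_norm, not_lt] at this

theorem notMem_core_of_source {h h' : E × Bool} (hne : h' ≠ h) (hv : Γ.vert h' = Γ.vert h) {x : ℂ}
    (hx : x ∈ (A.z h).source) (a : ℝ) : x ∉ A.core a h' := fun hx' =>
  Set.disjoint_left.1 (A.disjoint h' h hne hv) hx'.1 hx

theorem isOpen_piece (Q : Poles V) {t : E → ℂ} (ht : ∀ e, ‖t e‖ < A.ρ ^ 2) (v : V) :
    IsOpen (A.piece Q t v) := by
  have h1 : A.piece Q t v = (⋃ h ∈ Γ.halfEdges v, A.core (‖t h.1‖ / A.ρ) h)ᶜ ∩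
      (⋃ i : Fin (Q.n v), {x : ℂ | (x : OnePoint ℂ) = Q.q v i})ᶜ := by
    ext x
    simp [piece, removed, core, mem_halfEdges]
  rw [h1]
  refine IsOpen.inter (isOpen_compl_iff.2 ?_) (isOpen_compl_iff.2 ?_)
  · refine isClosed_biUnion_finset fun h _ => A.isClosed_core ?_ h
    rw [div_lt_iff₀ A.ρ_pos, ← sq]
    exact ht h.1
  · refine isClosed_iUnion_of_finite fun i => ?_
    refine Set.Subsingleton.isClosed fun x hx y hy => ?_
    exact OnePoint.coe_injective ((show (x : OnePoint ℂ) = _ from hx).trans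
      (show (y : OnePoint ℂ) = _ from hy).symm)

end AdmissibleCoordinates

end OpeningNodes

namespace OpeningNodes

open Complex Metric Set Filter MultiGraph

/-! ### The singular part at a node -/

/-- The singular part at a node, in terms of the residue `r` and of the regular part `R` at the
other end of the edge. -/
noncomputable def gluedPart (t r : ℂ) (R : ℂ → ℂ) (u : ℂ) : ℂ := r / u - t / u ^ 2 * R (t / u)

section gluedPart

variable {t r : ℂ} {R : ℂ → ℂ} {b : ℝ}

theorem norm_div_lt_of_lt (hb : 0 < b) {u : ℂ} (hu : ‖t‖ / b < ‖u‖) : ‖t / u‖ < b := by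
  have hu0 : 0 < ‖u‖ := (by positivity : 0 ≤ ‖t‖ / b).trans_lt hu
  rw [norm_div, div_lt_iff₀ hu0]
  rwa [div_lt_iff₀ hb, mul_comm] at hu

theorem differentiableOn_gluedPart (hb : 0 < b) (hR : DifferentiableOn ℂ R (ball 0 b)) :
    DifferentiableOn ℂ (gluedPart t r R) {u | ‖t‖ / b < ‖u‖} := fun u hu => by
  have hu0 : u ≠ 0 := norm_pos_iff.1 ((by positivity : 0 ≤ ‖t‖ / b).trans_lt hu)
  have h1 : DifferentiableAt ℂ (fun u => t / u) u :=
    (differentiableAt_const t).div differentiableAt_id hu0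
  have h2 : DifferentiableAt ℂ R (t / u) := hR.differentiableAt
    (isOpen_ball.mem_nhds (mem_ball_zero_iff.2 (norm_div_lt_of_lt hb hu)))
  have h3 : DifferentiableAt ℂ (fun u => R (t / u)) u := h2.comp u h1
  have h4 : DifferentiableAt ℂ (fun u => t / u ^ 2) u :=
    (differentiableAt_const t).div (differentiableAt_fun_id.fun_pow 2) (pow_ne_zero 2 hu0)
  refine DifferentiableAt.differentiableWithinAt ?_
  unfold gluedPart
  exact ((differentiableAt_const r).div differentiableAt_id hu0).sub
    (h4.mul h3)

theorem tendsto_mul_gluedPart (hb : 0 < b) (hR : DifferentiableOn ℂ R (ball 0 b)) :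
    Tendsto (fun u => u * gluedPart t r R u) (cocompact ℂ) (𝓝 r) := by
  have h1 : Tendsto (fun u : ℂ => t * u⁻¹) (cocompact ℂ) (𝓝 (t * 0)) :=
    (tendsto_inv_cocompact.mono_right nhdsWithin_le_nhds).const_mul t
  rw [mul_zero] at h1
  have h2 : ContinuousAt R 0 :=
    (hR.differentiableAt (isOpen_ball.mem_nhds (mem_ball_self hb))).continuousAt
  have h3 : Tendsto (fun u : ℂ => r - t * u⁻¹ * R (t * u⁻¹)) (cocompact ℂ) (𝓝 (r - 0 * R 0)) :=
    (h1.mul (h2.tendsto.comp h1)).const_sub r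
  rw [zero_mul, sub_zero] at h3
  refine h3.congr' ?_
  have hne : ∀ᶠ v in cocompact ℂ, v ≠ 0 := (isCompact_singleton (x := (0 : ℂ))).compl_mem_cocompact
  filter_upwards [hne] with u hu
  simp only [gluedPart, ← div_eq_mul_inv]
  field_simp

theorem tendsto_zero_of_mul {f : ℂ → ℂ} {c : ℂ}
    (h : Tendsto (fun u => u * f u) (cocompact ℂ) (𝓝 c)) : Tendsto f (cocompact ℂ) (𝓝 0) := by
  have h1 := (tendsto_inv_cocompact.mono_right nhdsWithin_le_nhds).mul h
  rw [zero_mul] at h1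
  refine h1.congr' ?_
  have hne : ∀ᶠ v in cocompact ℂ, v ≠ 0 := (isCompact_singleton (x := (0 : ℂ))).compl_mem_cocompact
  filter_upwards [hne] with u hu
  field_simp

theorem sphere_subset_of_lt {a s : ℝ} (h : a < s) : sphere (0 : ℂ) s ⊆ {u | a < ‖u‖} :=
    fun u hu => by
  rw [mem_sphere_zero_iff_norm] at hu
  rwa [Set.mem_ofPred_eq, hu]

/-- Apart from `r / u`, the singular part decays like `u⁻²`, so its integral vanishes. -/
theorem circleIntegral_gluedPart (hb : 0 < b) (hR : DifferentiableOn ℂ R (ball 0 b)) {a : ℝ}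
    (ha : ‖t‖ / b < a) : (∮ u in C(0, a), gluedPart t r R u) = 2 * Real.pi * I * r := by
  have ha0 : 0 < a := (by positivity : 0 ≤ ‖t‖ / b).trans_lt ha
  have h1 : (∮ u in C(0, a), gluedPart t 0 R u) = 0 :=
    circleIntegral_eq_zero_of_decay (by positivity) ha (differentiableOn_gluedPart hb hR)
      (tendsto_mul_gluedPart hb hR)
  have hne : ∀ u ∈ sphere (0 : ℂ) a, u ≠ 0 := fun u hu h0 => by
    rw [h0] at hu; simp [ha0.ne] at hu
  have h2 : (∮ u in C(0, a), r * (u - 0)⁻¹) = 2 * Real.pi * I * r := by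
    rw [circleIntegral.integral_const_mul, circleIntegral.integral_sub_center_inv _ ha0.ne',
      mul_comm]
  have h3 := congrArg₂ (· + ·) h2 h1
  simp only [add_zero] at h3
  rw [← h3, ← circleIntegral.integral_add]
  · refine circleIntegral.integral_congr ha0.le fun u _ => ?_
    simp only [gluedPart, sub_zero, zero_div]
    ring
  · refine ContinuousOn.circleIntegrable ha0.le ((continuousOn_const (c := r)).mul ?_)
    exact ((continuousOn_id' _).sub (continuousOn_const (c := (0 : ℂ)))).inv₀ fun u hu => by
      simpa using hne u hu
  · exact ((differentiableOn_gluedPart hb hR).continuousOn.mono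
      (sphere_subset_of_lt ha)).circleIntegrable ha0.le

/-- `gluedPart` is purely singular: it is holomorphic outside `‖u‖ = ‖t‖ / b` and vanishes at
infinity. -/
theorem regularPart_gluedPart (hb : 0 < b) (hR : DifferentiableOn ℂ R (ball 0 b)) {s : ℝ}
    (hs : ‖t‖ / b < s) {u : ℂ} (hu : ‖u‖ < s) : regularPart s (gluedPart t r R) u = 0 :=
  regularPart_eq_zero (by positivity) hs (differentiableOn_gluedPart hb hR)
    (tendsto_zero_of_mul (tendsto_mul_gluedPart hb hR)) hu

/-- This separates the data from the unknown: the residues go into `base`, the rest into `transfer`.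
-/
theorem cauchyTransform_gluedPart {X : ℂ → ℂ} {ρ : ℝ} (hX : Univalent X ρ) (hb : 0 < b)
    (hR : DifferentiableOn ℂ R (ball 0 b)) {σ : ℝ} (hσ : ‖t‖ / b < σ) (hσρ : σ < ρ) {x : ℂ}
    (hx : ∀ u, ‖u‖ ≤ σ → x ≠ X u) : cauchyTransform X σ (gluedPart t r R) x =
      r / (x - X 0) + cauchyTransform X σ (gluedPart t 0 R) x := by
  have hσ0 : 0 < σ := (by positivity : 0 ≤ ‖t‖ / b).trans_lt hσ
  have hne : ∀ u ∈ sphere (0 : ℂ) σ, u ≠ 0 := fun u hu h0 => by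
    rw [h0] at hu; simp [hσ0.ne] at hu
  rw [← hX.cauchyTransform_inv hσ0 hσρ hx, ← cauchyTransform_add (M := fun u => r / u)
    hσ0.le (continuousOn_const.div (continuousOn_id' _) hne)
    ((differentiableOn_gluedPart hb hR).continuousOn.mono (sphere_subset_of_lt hσ))
    (hX.continuousOn_sphere hσρ) fun u hu => hx u (mem_sphere_zero_iff_norm.1 hu).le]
  refine cauchyTransform_congr hσ0.le fun u _ => ?_
  simp only [gluedPart, zero_div]
  ring

/-- The factor `‖t‖` gained here is what makes the integral equation a contraction. -/
theorem norm_gluedPart_zero_le {σ B c : ℝ} (hσ : 0 < σ) (hc : ‖t‖ / σ ≤ c)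
    (hB : ∀ w, ‖w‖ ≤ c → ‖R w‖ ≤ B) {u : ℂ} (hu : ‖u‖ = σ) :
    ‖gluedPart t 0 R u‖ ≤ ‖t‖ / σ ^ 2 * B := by
  have h1 : ‖R (t / u)‖ ≤ B := hB _ (by rwa [norm_div, hu])
  rw [gluedPart, zero_div, zero_sub, norm_neg, norm_mul, norm_div, norm_pow, hu]
  gcongr

end gluedPart

/-! ### The integral equation -/

variable {V E : Type*} {Γ : MultiGraph V E}

namespace AdmissibleCoordinates

variable (A : AdmissibleCoordinates Γ)

/-- The coefficient, in the coordinate at a node, of the differential `(f_v dz)_v`. -/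
noncomputable def pull (f : V → ℂ → ℂ) (h : E × Bool) (u : ℂ) : ℂ :=
  f (Γ.vert h) (A.X h u) * deriv (A.X h) u

/-- The regular part of a differential at a node. -/
noncomputable def regular (s : ℝ) (f : V → ℂ → ℂ) (h : E × Bool) : ℂ → ℂ :=
  regularPart s (A.pull f h)

/-- The singular parts, without residues, that are carried over from the other ends of the edges. -/
noncomputable def transfer (s σ : ℝ) (t : E → ℂ) (f : V → ℂ → ℂ) (v : V) (x : ℂ) : ℂ :=
  ∑ h ∈ Γ.halfEdges v,
    cauchyTransform (A.X h) σ (gluedPart (t h.1) 0 (A.regular s f (opp h))) x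

/-- The differential on the spheres with given residues at the nodes and given principal parts. -/
noncomputable def base (Q : Poles V) (α : E → ℂ) (a : Q.Parts) (v : V) (x : ℂ) : ℂ :=
  ∑ h ∈ Γ.halfEdges v, nodeResidue α h / (x - A.p h) + ∑ i, principalTerm (Q.q v i) (a v i) x

end AdmissibleCoordinates

namespace Radii

variable {A : AdmissibleCoordinates Γ} {Q : Poles V} {r ε s η σ : ℝ}

theorem sphere_subset_ball (R : Radii A Q r ε s η σ) : sphere (0 : ℂ) s ⊆ ball 0 A.ρ :=
  sphere_subset_closedBall.trans (closedBall_subset_ball R.s_lt)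

theorem continuousOn_pull (R : Radii A Q r ε s η σ) {f : V → ℂ → ℂ}
    (hf : ∀ v, ContinuousOn (f v) (A.Omega Q η v)) (h : E × Bool) :
    ContinuousOn (A.pull f h) (sphere 0 s) :=
  ((hf _).comp ((A.univalent h).continuousOn_sphere R.s_lt)
    fun _ hu => R.circle_mem_Omega (mem_sphere_zero_iff_norm.1 hu)).mul
    ((A.univalent h).diff_deriv.continuousOn.mono R.sphere_subset_ball)

theorem differentiableOn_regular (R : Radii A Q r ε s η σ) {f : V → ℂ → ℂ} {h : E × Bool}
    (hf : ContinuousOn (A.pull f h) (sphere 0 s)) :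
    DifferentiableOn ℂ (A.regular s f h) (ball 0 s) :=
  differentiableOn_regularPart R.s_pos.le hf

theorem div_s_lt (R : Radii A Q r ε s η σ) {t : ℂ} (ht : ‖t‖ ≤ σ * s / 2) : ‖t‖ / s < σ := by
  rw [div_lt_iff₀ R.s_pos]
  have := mul_pos R.σ_pos R.s_pos
  linarith

theorem div_σ_le (R : Radii A Q r ε s η σ) {t : ℂ} (ht : ‖t‖ ≤ σ * s / 2) : ‖t‖ / σ ≤ s / 2 := by
  rw [div_le_iff₀ R.σ_pos]
  linarith

theorem norm_lt_sq (R : Radii A Q r ε s η σ) {t : ℂ} (ht : ‖t‖ ≤ σ * s / 2) : ‖t‖ < A.ρ ^ 2 := by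
  have h1 : σ * s ≤ A.ρ * A.ρ :=
    mul_le_mul R.σ_lt.le R.s_lt.le R.s_pos.le A.ρ_pos.le
  have := mul_pos R.σ_pos R.s_pos
  nlinarith

theorem norm_pull_le (R : Radii A Q r ε s η σ) {f : V → ℂ → ℂ} {h : E × Bool} {B : ℝ} {u : ℂ}
    (hu : ‖u‖ = s) (hB : ‖f (Γ.vert h) (A.X h u)‖ ≤ B) : ‖A.pull f h u‖ ≤ 4 * A.c₂ * B := by
  rw [AdmissibleCoordinates.pull, norm_mul, mul_comm]
  have := A.norm_deriv_X_le (h := h) (u := u) (hu.le.trans R.s_le)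
  have := A.c₂_pos
  gcongr

/-- The estimate for a singular part carried over from the other end of an edge. -/
theorem norm_cauchyTransform_le (R : Radii A Q r ε s η σ) {t : ℂ} (ht : ‖t‖ ≤ σ * s / 2)
    {f : V → ℂ → ℂ} {h : E × Bool} {B : ℝ}
    (hB : ∀ u ∈ sphere (0 : ℂ) s, ‖A.pull f (opp h) u‖ ≤ B) {x : ℂ} (hx : η ≤ ‖x - A.p h‖) :
    ‖cauchyTransform (A.X h) σ (gluedPart t 0 (A.regular s f (opp h))) x‖ ≤
      4 / (σ * η) * (‖t‖ * B) := by
  have h1 : ∀ w : ℂ, ‖w‖ ≤ s / 2 → ‖A.regular s f (opp h) w‖ ≤ 2 * B := fun w hw =>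
    norm_regularPart_le R.s_pos hB hw
  -- Radius `σ`, density at most `(‖t‖ / σ ^ 2) (2B)`, distance at least `η / 2`: the constant is `4
  -- / (σ η)`.
  refine (OpeningNodes.norm_cauchyTransform_le R.σ_pos.le (half_pos R.η_pos)
    (fun u hu => norm_gluedPart_zero_le R.σ_pos (R.div_σ_le ht) h1 (mem_sphere_zero_iff_norm.1 hu))
    fun u hu => R.half_le_dist hx (mem_sphere_zero_iff_norm.1 hu).le).trans_eq ?_
  have := R.σ_pos
  have := R.η_pos
  field_simp
  ring

end Radii

end OpeningNodes

-- Laurent expansion of a differential at a node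

namespace OpeningNodes

open Complex Metric Set Filter MultiGraph

variable {V E : Type*} {Γ : MultiGraph V E}

/-- The meromorphic differential `ω` on `Σ_t` has the periods `α` and the principal parts `a`. -/
structure HasData (A : AdmissibleCoordinates Γ) (Q : Poles V) (t : E → ℂ) (ω : V → ℂ → ℂ)
    (α : E → ℂ) (a : Q.Parts) : Prop where
  mero : A.IsMeromorphic Q t ω
  period : ∀ e, ∀ s : ℝ, ‖t e‖ / A.ρ < s → s < A.ρ → α e = A.cycleIntegral (ω (Γ.tgt e)) e s
  part : ∀ v i, HasPrincipalPart (ω v) (Q.q v i) (a v i)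

/-- A differential with a simple pole at a node, in the coordinate at the node. -/
theorem AdmissibleCoordinates.exists_pull_simple_pole (A : AdmissibleCoordinates Γ) {h : E × Bool}
    {f : ℂ → ℂ} {c : ℂ} (hf : ∀ x ∈ (A.z h).source, x ≠ A.p h → DifferentiableAt ℂ f x)
    (hc : HasPrincipalPart f (A.p h) (fun _ : Fin 1 => c)) :
    ∃ k : ℂ → ℂ, DifferentiableOn ℂ k (ball 0 A.ρ) ∧ ∀ u, 0 < ‖u‖ → ‖u‖ < A.ρ →
      f (A.X h u) * deriv (A.X h) u = c / u + k u := by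
  obtain ⟨g, hg, hfg⟩ := hasPrincipalPart_coe_iff.1 hc
  have hP : ∀ x, principalTerm (A.p h : OnePoint ℂ) (fun _ : Fin 1 => c) x = c / (x - A.p h) :=
    fun x => by simp [principalTerm_coe]
  simp only [hP] at hfg
  set G : ℂ → ℂ := Function.update (fun x => f x - c / (x - A.p h)) (A.p h) (g (A.p h))
  have hG : ∀ x, x ≠ A.p h → G x = f x - c / (x - A.p h) := fun x hx => Function.update_of_ne hx _ _
  have hGd : DifferentiableOn ℂ G (A.z h).source := fun x hx => by
    refine DifferentiableAt.differentiableWithinAt ?_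
    by_cases hxp : x = A.p h
    · subst hxp
      refine hg.differentiableAt.congr_of_eventuallyEq ?_
      filter_upwards [eventually_nhdsWithin_iff.1 hfg] with y hy
      by_cases hyp : y = A.p h
      · rw [hyp]; exact Function.update_self _ _ _
      · rw [hG y hyp, hy hyp]
    · have h1 : DifferentiableAt ℂ (fun x => f x - c / (x - A.p h)) x :=
        (hf x hx hxp).sub ((differentiableAt_const c).div (differentiableAt_id.sub_const _)
          (sub_ne_zero.2 hxp))
      refine h1.congr_of_eventuallyEq ?_
      filter_upwards [isOpen_ne.mem_nhds hxp] with y hy using hG y hy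
  have hX := A.univalent h
  have h0 : (0 : ℂ) ∈ ball (0 : ℂ) A.ρ := mem_ball_self A.ρ_pos
  -- By `logDeriv_sub`, the pulled-back pole `c X' / (X - p)` is `c / u` plus a holomorphic
  -- correction, the logarithmic derivative of the difference quotient.
  refine ⟨fun u => G (A.X h u) * deriv (A.X h) u +
    c * (deriv (dslope (A.X h) 0) u / dslope (A.X h) 0 u), ?_, fun u hu hu' => ?_⟩
  · refine DifferentiableOn.add (DifferentiableOn.mul ?_ hX.diff_deriv)
      (DifferentiableOn.const_mul ?_ c)
    · exact hGd.comp hX.diff fun u hu => A.X_mem (mem_ball_zero_iff.1 hu)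
    · exact ((hX.diff_dslope h0).deriv isOpen_ball).div (hX.diff_dslope h0)
        fun v hv => hX.dslope_ne h0 hv
  · have hub := mem_ball_zero_iff.2 hu'
    have hu0 : u ≠ 0 := norm_pos_iff.1 hu
    have hne : A.X h u ≠ A.p h := fun h' => hu0 (hX.inj hub h0 (by rw [h', A.X_zero]))
    have h1 := hX.logDeriv_sub h0 hub hu0
    rw [sub_zero, A.X_zero] at h1
    simp only [hG _ hne]
    have h2 := sub_ne_zero.2 hne
    linear_combination c * h1

/-- The derivative of the gluing map. -/
theorem AdmissibleCoordinates.hasDerivAt_glue (A : AdmissibleCoordinates Γ) (t : E → ℂ) {e : E}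
    {x : ℂ} (hx : x ∈ (A.z (e, false)).source) (hu : A.z (e, false) x ≠ 0)
    (htu : ‖t e / A.z (e, false) x‖ < A.ρ) :
    HasDerivAt (A.glue t e) (deriv (A.X (e, true)) (t e / A.z (e, false) x) *
      (-(t e * deriv (A.z (e, false)) x) / A.z (e, false) x ^ 2)) x := by
  have h1 := (hasDerivAt_const x (t e)).div (A.differentiableAt_z hx).hasDerivAt hu
  rw [zero_mul, zero_sub] at h1
  exact HasDerivAt.comp (h₂ := A.X (e, true)) x (A.differentiableAt_X htu).hasDerivAt h1

namespace HasData

variable {A : AdmissibleCoordinates Γ} {Q : Poles V} {t : E → ℂ} {ω : V → ℂ → ℂ} {α : E → ℂ}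
  {a : Q.Parts} {r ε s η σ : ℝ}

theorem X_mem_piece (R : Radii A Q r ε s η σ) (t : E → ℂ) {h : E × Bool} {u : ℂ}
    (h1 : ‖t h.1‖ / A.ρ < ‖u‖) (h2 : ‖u‖ < A.ρ) : A.X h u ∈ A.piece Q t (Γ.vert h) := by
  refine ⟨fun h' hv hx => ?_, fun i => R.ne_pole_of_source (A.X_mem h2) i⟩
  by_cases hne : h' = h
  · subst hne
    have := hx.2
    rw [A.z_X h2] at this
    linarith
  · exact A.notMem_core_of_source hne hv (A.X_mem h2) _ hx

theorem differentiableAt (D : HasData A Q t ω α a) (ht : ∀ e, ‖t e‖ < A.ρ ^ 2) {v : V} {x : ℂ}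
    (hx : x ∈ A.piece Q t v) : DifferentiableAt ℂ (ω v) x :=
  (D.mero.holo v).differentiableAt ((A.isOpen_piece Q ht v).mem_nhds hx)

theorem _root_.OpeningNodes.AdmissibleCoordinates.IsMeromorphic.differentiableOn_pull
    (hω : A.IsMeromorphic Q t ω) (R : Radii A Q r ε s η σ) (ht : ∀ e, ‖t e‖ < A.ρ ^ 2)
    (h : E × Bool) :
    DifferentiableOn ℂ (A.pull ω h) {u | ‖t h.1‖ / A.ρ < ‖u‖ ∧ ‖u‖ < A.ρ} := fun u hu => by
  refine DifferentiableAt.differentiableWithinAt (DifferentiableAt.mul ?_ ?_)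
  · exact ((hω.holo _).differentiableAt ((A.isOpen_piece Q ht _).mem_nhds
      (X_mem_piece R t hu.1 hu.2))).comp u (A.differentiableAt_X hu.2)
  · exact (A.univalent h).diff_deriv.differentiableAt
      (isOpen_ball.mem_nhds (mem_ball_zero_iff.2 hu.2))

/-- The gluing condition in the coordinates at the node, where gluing is `w = t / u`. It is assumed
from the `-` end only; since `u ↦ t / u` is an involution, the `+` end follows by evaluating at `t /
u`. -/
theorem pull_glue (D : HasData A Q t ω α a) {h : E × Bool} (ht : t h.1 ≠ 0) {u : ℂ}
    (h1 : ‖t h.1‖ / A.ρ < ‖u‖) (h2 : ‖u‖ < A.ρ) :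
    A.pull ω h u = -(t h.1 / u ^ 2) * A.pull ω (opp h) (t h.1 / u) := by
  obtain ⟨e, b⟩ := h
  simp only at ht h1
  have key : ∀ u : ℂ, ‖t e‖ / A.ρ < ‖u‖ → ‖u‖ < A.ρ →
      A.pull ω (e, false) u = -(t e / u ^ 2) * A.pull ω (e, true) (t e / u) := by
    intro u h1 h2
    have hu0 : u ≠ 0 := norm_pos_iff.1
      ((div_nonneg (norm_nonneg _) A.ρ_pos.le : 0 ≤ ‖t e‖ / A.ρ).trans_lt h1)
    have htu : ‖t e / u‖ < A.ρ := norm_div_lt_of_lt A.ρ_pos h1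
    set x := A.X (e, false) u
    have hx : x ∈ (A.z (e, false)).source := A.X_mem h2
    have hzx : A.z (e, false) x = u := A.z_X h2
    have hneck := D.mero.neck e ht x hx (by rwa [hzx])
    have hd := A.hasDerivAt_glue t hx (by rwa [hzx]) (by rwa [hzx])
    rw [hzx] at hd
    have hg : A.glue t e x = A.X (e, true) (t e / u) := by
      rw [AdmissibleCoordinates.glue, hzx]; rfl
    have h4 := A.deriv_X_mul_deriv_z hx
    rw [hzx] at h4
    rw [hd.deriv, hg] at hneck
    simp only [AdmissibleCoordinates.pull, MultiGraph.vert, cond_true, cond_false]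
    change ω (Γ.src e) x * _ = _
    rw [← hneck]
    field_simp
    linear_combination (-(ω (Γ.tgt e) (A.X (e, true) (t e / u)) *
      deriv (A.X (e, true)) (t e / u))) * h4
  cases b
  · exact key u h1 h2
  · have hu0 : u ≠ 0 := norm_pos_iff.1
      ((div_nonneg (norm_nonneg _) A.ρ_pos.le : 0 ≤ ‖t e‖ / A.ρ).trans_lt h1)
    have htu : ‖t e / u‖ < A.ρ := norm_div_lt_of_lt A.ρ_pos h1
    have h3 : ‖t e‖ / A.ρ < ‖t e / u‖ := by
      rw [norm_div]
      have := norm_pos_iff.2 hu0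
      have := norm_pos_iff.2 ht
      gcongr
    have h4 := key (t e / u) h3 htu
    rw [div_div_cancel₀ ht] at h4
    simp only [opp, Bool.not_true]
    rw [h4]
    field_simp

/-- The Laurent expansion at a node. -/
theorem pull_eq (D : HasData A Q t ω α a) (R : Radii A Q r ε s η σ)
    (ht : ∀ e, ‖t e‖ ≤ σ * s / 2) (h : E × Bool) :
    (∮ u in C(0, s), A.pull ω h u) = 2 * Real.pi * I * nodeResidue α h ∧
    ∀ u, ‖t h.1‖ / s < ‖u‖ → ‖u‖ < s → A.pull ω h u = A.regular s ω h u +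
      gluedPart (t h.1) (nodeResidue α h) (A.regular s ω (opp h)) u := by
  have htρ := fun e => R.norm_lt_sq (ht e)
  have hdiff := D.mero.differentiableOn_pull R htρ
  have hρ := A.ρ_pos
  have hts : ∀ e, ‖t e‖ / A.ρ < s := fun e =>
    (div_le_div_of_nonneg_left (norm_nonneg _) R.s_pos R.s_lt.le).trans_lt
      ((R.div_s_lt (ht e)).trans R.σ_lt_s)
  have hplus : ∀ e, (∮ u in C(0, s), A.pull ω (e, true) u) =
      2 * Real.pi * I * nodeResidue α (e, true) := fun e => by
    rw [nodeResidue, mul_inv_cancel_left₀ two_pi_I_ne_zero]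
    exact (D.period e s (hts e) R.s_lt).symm
  -- At a closed node the singular part is `c / u`, and it only remains to identify `c` with the
  -- residue prescribed by the period.
  by_cases ht0 : t h.1 = 0
  · have hnode : ∃ c : ℂ, ∀ b, HasPrincipalPart (ω (Γ.vert (h.1, b))) (A.p (h.1, b))
        (fun _ : Fin 1 => cond b c (-c)) := by
      obtain ⟨c, h1, h2⟩ := D.mero.node h.1 ht0
      refine ⟨c, fun b => ?_⟩
      cases b
      · exact h2
      · exact h1
    obtain ⟨c, hc⟩ := hnode
    have hd : ∀ b, ∀ x ∈ (A.z (h.1, b)).source, x ≠ A.p (h.1, b) →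
        DifferentiableAt ℂ (ω (Γ.vert (h.1, b))) x := fun b x hx hxp => by
      have h3 := A.norm_z_lt hx
      have h4 : A.z (h.1, b) x ≠ 0 := fun h5 => hxp (by rw [← A.X_z hx, h5, A.X_zero])
      have h6 := X_mem_piece R t (h := (h.1, b)) (u := A.z (h.1, b) x)
        (by simpa [ht0] using h4) h3
      rw [A.X_z hx] at h6
      exact D.differentiableAt htρ h6
    have hk := fun b => A.exists_pull_simple_pole (hd b) (hc b)
    choose k hk1 hk2 using hk
    have hsub : sphere (0 : ℂ) s ⊆ ball 0 A.ρ := R.sphere_subset_ball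
    have hint : ∀ b, (∮ u in C(0, s), A.pull ω (h.1, b) u) =
        2 * Real.pi * I * cond b c (-c) := fun b => by
      rw [← circleIntegral_gluedPart (t := 0) (R := 0) one_pos (differentiableOn_const 0)
          (by simpa using R.s_pos : ‖(0 : ℂ)‖ / 1 < s),
        ← add_zero (circleIntegral (gluedPart _ _ _) _ _)]
      have h3 := circleIntegral_eq_zero_of_ball R.s_pos.le R.s_lt (hk1 b)
      refine (circleIntegral.integral_congr R.s_pos.le fun u hu => ?_).trans
        ((circleIntegral.integral_add (f := gluedPart 0 (cond b c (-c)) 0) (g := k b) ?_ ?_).trans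
          (by rw [h3]))
      · rw [mem_sphere_zero_iff_norm] at hu
        rw [AdmissibleCoordinates.pull, hk2 b u (hu ▸ R.s_pos) (hu ▸ R.s_lt)]
        simp [gluedPart]
      · exact ((differentiableOn_gluedPart (t := 0) one_pos
          (differentiableOn_const 0)).continuousOn.mono
          (sphere_subset_of_lt (by simpa using R.s_pos))).circleIntegrable R.s_pos.le
      · exact ((hk1 b).continuousOn.mono hsub).circleIntegrable R.s_pos.le
    -- The period is taken at the `+` end; opposite residues settle the `-` end.
    have hc' : nodeResidue α (h.1, true) = c :=
      mul_left_cancel₀ two_pi_I_ne_zero ((hplus h.1).symm.trans (hint true))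
    have hres : ∀ b, nodeResidue α (h.1, b) = cond b c (-c) := fun b => by
      cases b
      · have := nodeResidue_opp α (h.1, true)
        rw [hc'] at this
        exact this
      · exact hc'
    have hres' : nodeResidue α h = cond h.2 c (-c) := hres h.2
    refine ⟨by rw [hres']; exact hint h.2, fun u hu hus => ?_⟩
    have hu0 : 0 < ‖u‖ := by simpa [ht0] using hu
    have hpull : ∀ w : ℂ, 0 < ‖w‖ → ‖w‖ < A.ρ →
        A.pull ω h w = gluedPart 0 (nodeResidue α h) 0 w + k h.2 w := fun w h3 h4 => by
      rw [hres']
      refine (hk2 h.2 w h3 h4).trans ?_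
      simp [gluedPart]
    have hreg : A.regular s ω h u = k h.2 u := by
      have h3 : ∀ w ∈ sphere (0 : ℂ) s,
          A.pull ω h w = gluedPart 0 (nodeResidue α h) 0 w + k h.2 w := fun w hw => by
        rw [mem_sphere_zero_iff_norm] at hw
        exact hpull w (hw ▸ R.s_pos) (hw ▸ R.s_lt)
      rw [AdmissibleCoordinates.regular, regularPart, cauchyTransform_congr R.s_pos.le h3]
      refine (regularPart_add R.s_pos.le ((differentiableOn_gluedPart (t := 0) one_pos
          (differentiableOn_const 0)).continuousOn.mono
          (sphere_subset_of_lt (by simpa using R.s_pos))) ((hk1 h.2).continuousOn.mono hsub)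
          hus).trans ?_
      rw [regularPart_gluedPart one_pos (differentiableOn_const 0) (by simpa using R.s_pos) hus,
        zero_add, regularPart_of_diff R.s_lt (hk1 h.2) hus]
    rw [hreg, hpull u hu0 (hus.trans R.s_lt), ht0]
    simp [gluedPart, add_comm]
  · have hcont : ∀ h : E × Bool, ContinuousOn (A.pull ω h) (sphere 0 s) := fun h =>
      (hdiff h).continuousOn.mono fun u hu => by
        rw [mem_sphere_zero_iff_norm] at hu
        exact ⟨by rw [hu]; exact hts h.1, by rw [hu]; exact R.s_lt⟩
    have hglue : ∀ h' : E × Bool, h'.1 = h.1 → ∀ u, ‖u‖ = s → A.pull ω h' u =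
        -(t h.1 / u ^ 2) * A.pull ω (opp h') (t h.1 / u) := fun h' hh u hu => by
      rw [← hh]
      exact D.pull_glue (by rwa [hh]) (by rw [hu]; exact hts _) (by rw [hu]; exact R.s_lt)
    -- The circle at the `+` end is deformed to `‖u‖ = ‖t‖ / s`, which the gluing identifies with
    -- the circle `‖w‖ = s` at the `-` end, with the opposite orientation.
    have hminus : (∮ u in C(0, s), A.pull ω (h.1, false) u) =
        -∮ u in C(0, s), A.pull ω (h.1, true) u := by
      have h3 : ‖t h.1‖ / A.ρ < ‖t h.1‖ / s := by
        have := norm_pos_iff.2 ht0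
        have := R.s_pos
        have := R.s_lt
        gcongr
      rw [circleIntegral_eq_of_annulus (by positivity) (hdiff (h.1, true)) h3
        ((R.div_s_lt (ht h.1)).trans R.σ_lt_s).le R.s_lt,
        circleIntegral_inversion _ ht0 R.s_pos, ← neg_one_mul,
        ← circleIntegral.integral_const_mul]
      refine circleIntegral.integral_congr R.s_pos.le fun w hw => ?_
      have := hglue (h.1, false) rfl w (mem_sphere_zero_iff_norm.1 hw)
      simp only [opp, Bool.not_false] at this
      simp only [this]
      ring
    have hint : ∀ h' : E × Bool, h'.1 = h.1 →
        (∮ u in C(0, s), A.pull ω h' u) = 2 * Real.pi * I * nodeResidue α h' := by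
      rintro ⟨e, b⟩ rfl
      cases b
      · have h3 := nodeResidue_opp α (h.1, true)
        simp only [opp, Bool.not_true] at h3
        rw [hminus, hplus, h3, mul_neg]
      · exact hplus _
    refine ⟨hint h rfl, fun u hu hus => ?_⟩
    have h3 := laurent_of_glued R.s_pos R.s_lt ht0 (hdiff h) (hcont (opp h))
      (fun u hu => by simpa using hglue (opp h) rfl u hu) hu hus
    rw [hint (opp h) rfl, inv_mul_cancel_left₀ two_pi_I_ne_zero, nodeResidue_opp, neg_neg] at h3
    exact h3

end HasData

end OpeningNodes

-- The integral equation satisfied by a differential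

namespace OpeningNodes

open Complex Metric Set Filter MultiGraph

variable {V E : Type*} {Γ : MultiGraph V E}

theorem AdmissibleCoordinates.core_mono (A : AdmissibleCoordinates Γ) {a b : ℝ} (hab : a ≤ b)
    (h : E × Bool) : A.core a h ⊆ A.core b h := fun _ hx => ⟨hx.1, hx.2.trans hab⟩

theorem Radii.r_pos {A : AdmissibleCoordinates Γ} {Q : Poles V} {r ε s η σ : ℝ}
    (R : Radii A Q r ε s η σ) : 0 < r := R.ε_pos.trans R.ε_lt

theorem Radii.removed_subset {A : AdmissibleCoordinates Γ} {Q : Poles V} {r ε s η σ : ℝ}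
    (R : Radii A Q r ε s η σ) {t : E → ℂ} {h : E × Bool} (ht : ‖t h.1‖ ≤ σ * s / 2) :
    A.removed t h ⊆ A.core σ h :=
  A.core_mono ((div_le_div_of_nonneg_left (norm_nonneg _) R.s_pos R.s_lt.le).trans
    (R.div_s_lt ht).le) h

theorem mem_disk_self {x : ℂ} {q : OnePoint ℂ} (h : (x : OnePoint ℂ) = q) {r : ℝ} (hr : 0 < r) :
    x ∈ disk q r := Or.inl ⟨x, h.symm, mem_ball_self hr⟩

theorem ne_of_cocompact (q : OnePoint ℂ) : ∀ᶠ x : ℂ in cocompact ℂ, (x : OnePoint ℂ) ≠ q := by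
  have h : {x : ℂ | (x : OnePoint ℂ) = q}.Subsingleton := fun x hx y hy =>
    OnePoint.coe_injective ((show (x : OnePoint ℂ) = q from hx).trans
      (show (y : OnePoint ℂ) = q from hy).symm)
  exact h.finite.isCompact.compl_mem_cocompact

theorem AdmissibleCoordinates.core_cocompact (A : AdmissibleCoordinates Γ) {a : ℝ} (ha : a < A.ρ)
    (h : E × Bool) : ∀ᶠ x : ℂ in cocompact ℂ, x ∉ A.core a h := by
  have h1 : IsCompact (A.core a h) := by
    rw [A.core_eq ha]
    exact (isCompact_closedBall 0 a).image_of_continuousOn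
      ((A.univalent h).diff.continuousOn.mono (closedBall_subset_ball ha))
  exact h1.compl_mem_cocompact

theorem Radii.cauchyTransform_eq {A : AdmissibleCoordinates Γ} {Q : Poles V} {r ε s η σ : ℝ}
    (R : Radii A Q r ε s η σ) {t c : ℂ} (ht : ‖t‖ ≤ σ * s / 2) {h : E × Bool} {k : ℂ → ℂ}
    (hk : DifferentiableOn ℂ k (ball 0 s)) {x : ℂ} (hx : x ∉ A.core σ h) :
    cauchyTransform (A.X h) σ (gluedPart t c k) x =
      c / (x - A.p h) + cauchyTransform (A.X h) σ (gluedPart t 0 k) x := by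
  rw [cauchyTransform_gluedPart (A.univalent h) R.s_pos hk (R.div_s_lt ht) R.σ_lt
    fun u hu => R.ne_X_of_notMem_core hx hu, A.X_zero]

theorem Radii.differentiableAt_cauchyTransform {A : AdmissibleCoordinates Γ} {Q : Poles V}
    {r ε s η σ : ℝ} (R : Radii A Q r ε s η σ) {t c : ℂ} (ht : ‖t‖ ≤ σ * s / 2) {h : E × Bool}
    {k : ℂ → ℂ} (hk : DifferentiableOn ℂ k (ball 0 s)) {x : ℂ} (hx : x ∉ A.core σ h) :
    DifferentiableAt ℂ (cauchyTransform (A.X h) σ (gluedPart t c k)) x :=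
  OpeningNodes.differentiableAt_cauchyTransform R.σ_pos.le
    ((differentiableOn_gluedPart R.s_pos hk).continuousOn.mono
      (sphere_subset_of_lt (R.div_s_lt ht)))
    ((A.univalent h).continuousOn_sphere R.σ_lt)
    fun _ hu => R.ne_X_of_notMem_core hx (mem_sphere_zero_iff_norm.1 hu).le

theorem Radii.tendsto_mul_cauchyTransform {A : AdmissibleCoordinates Γ} {Q : Poles V}
    {r ε s η σ : ℝ} (R : Radii A Q r ε s η σ) {t c : ℂ} (ht : ‖t‖ ≤ σ * s / 2) {h : E × Bool}
    {k : ℂ → ℂ} (hk : DifferentiableOn ℂ k (ball 0 s)) :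
    Tendsto (fun x => x * cauchyTransform (A.X h) σ (gluedPart t c k) x) (cocompact ℂ) (𝓝 c) := by
  have := OpeningNodes.tendsto_mul_cauchyTransform (X := A.X h) (M := gluedPart t c k) R.σ_pos.le
    ((differentiableOn_gluedPart R.s_pos hk).continuousOn.mono
      (sphere_subset_of_lt (R.div_s_lt ht)))
    ((A.univalent h).continuousOn_sphere R.σ_lt)
  rwa [circleIntegral_gluedPart R.s_pos hk (R.div_s_lt ht),
    inv_mul_cancel_left₀ two_pi_I_ne_zero] at this

namespace HasData

variable {A : AdmissibleCoordinates Γ} {Q : Poles V} {t : E → ℂ} {ω : V → ℂ → ℂ} {α : E → ℂ}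
  {a : Q.Parts} {r ε s η σ : ℝ}

/-- Each finite pole contributes minus its residue through the subtracted term. A pole at infinity
does so through `ω` itself, since its model omits the residue. If infinity is not a pole, `x ω(x)`
tends to zero. -/
theorem tendsto_mul_sub (D : HasData A Q t ω α a) (v : V) :
    Tendsto (fun x => x * (ω v x - ∑ i, principalTerm (Q.q v i) (a v i) x)) (cocompact ℂ)
      (𝓝 (-∑ i, residue (a v i))) := by
  have hfin : ∀ i, Q.q v i ≠ OnePoint.infty →
      Tendsto (fun x => x * principalTerm (Q.q v i) (a v i) x) (cocompact ℂ)
        (𝓝 (residue (a v i))) := fun i hi => by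
    obtain ⟨c, hc⟩ := OnePoint.ne_infty_iff_exists.1 hi
    rw [← hc]
    exact tendsto_mul_principalTerm c _
  by_cases hinf : ∃ i, Q.q v i = OnePoint.infty
  · obtain ⟨i₀, hi₀⟩ := hinf
    have h1 := (hi₀ ▸ D.part v i₀).tendsto_infty
    have h2 := tendsto_finsetSum (Finset.univ.erase i₀) fun i hi => hfin i fun h =>
      (Finset.mem_erase.1 hi).1 (Q.q_inj v (h.trans hi₀.symm))
    have h3 := h1.sub h2
    rw [← Finset.add_sum_erase _ _ (Finset.mem_univ i₀), neg_add, ← sub_eq_add_neg]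
    refine h3.congr fun x => ?_
    rw [← Finset.add_sum_erase _ _ (Finset.mem_univ i₀), hi₀, ← Finset.mul_sum]
    ring
  · push Not at hinf
    have h1 := (D.mero.infty v hinf).tendsto_infty
    have h2 := tendsto_finsetSum Finset.univ fun i _ => hfin i (hinf i)
    have h3 := h1.sub h2
    have h0 : residue (0 : Fin 0 → ℂ) = 0 := by simp [residue]
    rw [h0, neg_zero, zero_sub] at h3
    refine h3.congr fun x => ?_
    rw [principalTerm_zero, ← Finset.mul_sum]
    ring

theorem mem_piece_of_notMem_core (R : Radii A Q r ε s η σ) (ht : ∀ e, ‖t e‖ ≤ σ * s / 2) {v : V}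
    {x : ℂ} (hx : ∀ h ∈ Γ.halfEdges v, x ∉ A.core σ h) (hxq : ∀ i, (x : OnePoint ℂ) ≠ Q.q v i) :
    x ∈ A.piece Q t v :=
  ⟨fun h hv hx' => hx h (Γ.mem_halfEdges.2 hv) (R.removed_subset (ht h.1) hx'), hxq⟩

theorem continuousOn_pull (D : HasData A Q t ω α a) (R : Radii A Q r ε s η σ)
    (ht : ∀ e, ‖t e‖ ≤ σ * s / 2) (h : E × Bool) : ContinuousOn (A.pull ω h) (sphere 0 s) :=
  (D.mero.differentiableOn_pull R (fun e => R.norm_lt_sq (ht e)) h).continuousOn.mono fun u hu => by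
    rw [mem_sphere_zero_iff_norm] at hu
    rw [Set.mem_ofPred_eq, hu]
    exact ⟨(div_le_div_of_nonneg_left (norm_nonneg _) R.s_pos R.s_lt.le).trans_lt
      ((R.div_s_lt (ht _)).trans R.σ_lt_s), R.s_lt⟩

/-- Near a node, the differential differs from its singular part by a holomorphic one. -/
theorem exists_sub_node (D : HasData A Q t ω α a) (R : Radii A Q r ε s η σ)
    (ht : ∀ e, ‖t e‖ ≤ σ * s / 2) (h : E × Bool) :
    ∃ g : ℂ → ℂ, DifferentiableOn ℂ g {x | x ∈ (A.z h).source ∧ ‖A.z h x‖ < s} ∧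
      ∀ x ∈ {x | x ∈ (A.z h).source ∧ ‖A.z h x‖ < s}, x ∉ A.core σ h →
        ω (Γ.vert h) x - cauchyTransform (A.X h) σ
          (gluedPart (t h.1) (nodeResidue α h) (A.regular s ω (opp h))) x = g x := by
  have hreg := fun h => R.differentiableOn_regular (D.continuousOn_pull R ht h)
  obtain ⟨k, hk, hk'⟩ := (A.univalent h).exists_regular_part
    (M := gluedPart (t h.1) (nodeResidue α h) (A.regular s ω (opp h)))
    (a := ‖t h.1‖ / s) (div_nonneg (norm_nonneg _) R.s_pos.le)
    ((differentiableOn_gluedPart R.s_pos (hreg (opp h))).mono fun u hu => hu.1)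
    (R.div_s_lt (ht h.1)) R.σ_lt
  -- The remainder has two sources: the regular part of the Laurent expansion, and the difference
  -- `k` between the singular part and its Cauchy transform.
  refine ⟨fun x => (A.regular s ω h (A.z h x) + k (A.z h x)) * deriv (A.z h) x, ?_,
    fun x hx hxσ => ?_⟩
  · have hz : DifferentiableOn ℂ (A.z h) {x | x ∈ (A.z h).source ∧ ‖A.z h x‖ < s} :=
      (A.holo h).mono fun x hx => hx.1
    refine DifferentiableOn.mul (DifferentiableOn.add ((hreg h).comp hz fun x hx =>
      mem_ball_zero_iff.2 hx.2) (hk.comp hz fun x hx => mem_ball_zero_iff.2 (A.norm_z_lt hx.1))) ?_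
    exact ((A.holo h).deriv (A.z h).open_source).mono fun x hx => hx.1
  · have hσ : σ < ‖A.z h x‖ := by
      by_contra! hle
      exact hxσ ⟨hx.1, hle⟩
    have h1 := (D.pull_eq R ht h).2 (A.z h x) ((R.div_s_lt (ht h.1)).trans hσ) hx.2
    rw [hk' _ hσ (A.norm_z_lt hx.1), AdmissibleCoordinates.pull, A.X_z hx.1] at h1
    have h2 := A.deriv_X_mul_deriv_z hx.1
    set W := ω (Γ.vert h) x
    set c := cauchyTransform (A.X h) σ
      (gluedPart (t h.1) (nodeResidue α h) (A.regular s ω (opp h))) x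
    linear_combination deriv (A.z h) x * h1 - (W - c) * h2

/-- The local data at a pole for `exists_entire`. A pole at infinity has no finite point, so the
empty set serves there. -/
theorem exists_sub_pole (D : HasData A Q t ω α a) (hr : 0 < r) (v : V) (i : Fin (Q.n v)) :
    ∃ (U : Set ℂ) (g : ℂ → ℂ), IsOpen U ∧ {x : ℂ | (x : OnePoint ℂ) = Q.q v i} ⊆ U ∧
      U ⊆ disk (Q.q v i) r ∧ DifferentiableOn ℂ g U ∧
      ∀ x ∈ U, x ∉ {x : ℂ | (x : OnePoint ℂ) = Q.q v i} →
        ω v x - principalTerm (Q.q v i) (a v i) x = g x := by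
  have hp := D.part v i
  generalize a v i = b at hp ⊢
  generalize Q.m v i = m at b hp ⊢
  generalize Q.q v i = q at hp ⊢
  induction q using OnePoint.rec with
  | infty => exact ⟨∅, 0, isOpen_empty, fun x hx => absurd hx (OnePoint.coe_ne_infty x),
      empty_subset _, differentiableOn_empty, fun x hx => absurd hx (notMem_empty x)⟩
  | coe c =>
    obtain ⟨g, hg, hfg⟩ := hasPrincipalPart_coe_iff.1 hp
    obtain ⟨d, hd, hball⟩ := Metric.eventually_nhds_iff_ball.1
      (hg.eventually_analyticAt.and (eventually_nhdsWithin_iff.1 hfg))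
    refine ⟨ball c (min d r), g, isOpen_ball, fun x hx => ?_, fun x hx => ?_, fun x hx => ?_,
      fun x hx hxc => ?_⟩
    · rw [OnePoint.coe_injective hx]
      exact mem_ball_self (lt_min hd hr)
    · exact Or.inl ⟨c, rfl, ball_subset_ball (min_le_right _ _) hx⟩
    · exact
        (hball x (ball_subset_ball (min_le_left _ _) hx)).1.differentiableAt.differentiableWithinAt
    · exact (hball x (ball_subset_ball (min_le_left _ _) hx)).2 fun h => hxc (by rw [h]; rfl)

/-- The differential is the sum of its principal parts and of its singular parts at the nodes, and
the sum of the residues vanishes. -/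
theorem eq_and_sum_residue (D : HasData A Q t ω α a) (R : Radii A Q r ε s η σ)
    (ht : ∀ e, ‖t e‖ ≤ σ * s / 2) (v : V) :
    (∀ x, (∀ h ∈ Γ.halfEdges v, x ∉ A.core σ h) → (∀ i, (x : OnePoint ℂ) ≠ Q.q v i) →
      ω v x = A.base Q α a v x + A.transfer s σ t ω v x) ∧
    ∑ h ∈ Γ.halfEdges v, nodeResidue α h + ∑ i, residue (a v i) = 0 := by
  have hreg := fun h => R.differentiableOn_regular (D.continuousOn_pull R ht h)
  set S : E × Bool → ℂ → ℂ := fun h => cauchyTransform (A.X h) σ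
    (gluedPart (t h.1) (nodeResidue α h) (A.regular s ω (opp h))) with hS
  have hvert : ∀ h : {h // h ∈ Γ.halfEdges v}, Γ.vert h.1 = v := fun h => Γ.mem_halfEdges.1 h.2
  choose g hg hg' using fun h => D.exists_sub_node R ht h
  choose U k hU hKU hUr hk hk' using fun i => D.exists_sub_pole R.r_pos v i
  -- The singularities are indexed by the ends of edges at `v` and by the poles; removing all of
  -- them leaves an entire function.
  obtain ⟨F, hF, hFeq⟩ : ∃ F : ℂ → ℂ, Differentiable ℂ F ∧
      ∀ x, (∀ i, x ∉ Sum.elim (fun h : {h // h ∈ Γ.halfEdges v} => A.core σ h.1)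
        (fun i => {x : ℂ | (x : OnePoint ℂ) = Q.q v i}) i) →
      ω v x - ∑ i, Sum.elim (fun h : {h // h ∈ Γ.halfEdges v} => S h.1)
        (fun i => principalTerm (Q.q v i) (a v i)) i x = F x := by
    refine exists_entire (ι := {h // h ∈ Γ.halfEdges v} ⊕ Fin (Q.n v))
      (K := Sum.elim (fun h => A.core σ h.1) fun i => {x : ℂ | (x : OnePoint ℂ) = Q.q v i})
      (U := Sum.elim (fun h => {x | x ∈ (A.z h.1).source ∧ ‖A.z h.1 x‖ < s}) U)
      (f := ω v) (σ := Sum.elim (fun h => S h.1) fun i => principalTerm (Q.q v i) (a v i))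
      (g := Sum.elim (fun h => g h.1) k) Finset.univ (fun i => Finset.mem_univ i) ?_ ?_ ?_ ?_ ?_ ?_
      ?_ ?_
    · rintro (h | i)
      · exact A.isClosed_core R.σ_lt h.1
      · refine Set.Subsingleton.isClosed fun x hx y hy => ?_
        exact OnePoint.coe_injective ((show (x : OnePoint ℂ) = _ from hx).trans
          (show (y : OnePoint ℂ) = _ from hy).symm)
    · rintro (h | i)
      · have := (A.z h.1).isOpen_inter_preimage (isOpen_ball (x := (0 : ℂ)) (ε := s))
        convert this using 1
        ext x
        simp
      · exact hU i
    · rintro (h | i)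
      · exact fun x hx => ⟨hx.1, hx.2.trans_lt R.σ_lt_s⟩
      · exact hKU i
    · rintro (h | i) (h' | j) hne
      · exact (A.disjoint h.1 h'.1 (fun h0 => hne (by rw [Subtype.ext h0]))
          ((hvert h).trans (hvert h').symm)).mono (fun x hx => hx.1) fun x hx => hx.1
      · exact (R.sep.1 v j h.1 (hvert h)).mono (fun x hx => hx.1) fun x hx =>
          mem_disk_self hx R.r_pos
      · exact (R.sep.1 v i h'.1 (hvert h')).symm.mono (hUr i) fun x hx => hx.1
      · exact (R.sep.2 v i j fun h0 => hne (by rw [h0])).mono (hUr i) fun x hx =>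
          mem_disk_self hx R.r_pos
    · intro x hx
      exact D.differentiableAt (fun e => R.norm_lt_sq (ht e)) (mem_piece_of_notMem_core R ht
        (fun h hh => hx (Sum.inl ⟨h, hh⟩)) fun i => hx (Sum.inr i))
    · rintro (h | i) x hx
      · exact R.differentiableAt_cauchyTransform (ht _) (hreg _) hx
      · exact differentiableAt_principalTerm _ hx
    · rintro (h | i)
      · exact hg h.1
      · exact hk i
    · rintro (h | i) x hx hxK
      · have := hg' h.1 x hx hxK
        rw [hvert h] at this
        exact this
      · exact hk' i x hx hxK
  have hsum : ∀ x, ∑ i, Sum.elim (fun h : {h // h ∈ Γ.halfEdges v} => S h.1)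
      (fun i => principalTerm (Q.q v i) (a v i)) i x =
      ∑ h ∈ Γ.halfEdges v, S h x + ∑ i, principalTerm (Q.q v i) (a v i) x := fun x => by
    rw [Fintype.sum_sum_type]
    simp only [Sum.elim_inl, Sum.elim_inr]
    rw [Finset.sum_coe_sort (Γ.halfEdges v) fun h => S h x]
  have hev : ∀ᶠ x in cocompact ℂ, (∀ h ∈ Γ.halfEdges v, x ∉ A.core σ h) ∧
      ∀ i, (x : OnePoint ℂ) ≠ Q.q v i :=
    ((Finset.eventually_all _).2 fun h _ => A.core_cocompact R.σ_lt h).and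
      (eventually_all.2 fun i => ne_of_cocompact _)
  have hFeq' : ∀ x, (∀ h ∈ Γ.halfEdges v, x ∉ A.core σ h) → (∀ i, (x : OnePoint ℂ) ≠ Q.q v i) →
      ω v x - (∑ h ∈ Γ.halfEdges v, S h x + ∑ i, principalTerm (Q.q v i) (a v i) x) = F x := by
    intro x hx hxq
    rw [← hsum]
    refine hFeq x ?_
    rintro (h | i)
    · exact hx h.1 h.2
    · exact hxq i
  have hlim : Tendsto (fun x => x * F x) (cocompact ℂ)
      (𝓝 (-∑ i, residue (a v i) - ∑ h ∈ Γ.halfEdges v, nodeResidue α h)) := by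
    refine ((D.tendsto_mul_sub v).sub (tendsto_finsetSum (Γ.halfEdges v) fun h _ =>
      R.tendsto_mul_cauchyTransform (h := h) (c := nodeResidue α h) (ht h.1)
        (hreg (opp h)))).congr' ?_
    filter_upwards [hev] with x hx
    rw [← hFeq' x hx.1 hx.2, ← Finset.mul_sum]
    ring
  -- `x F(x)` has a finite limit, so `F` tends to zero at infinity and vanishes by Liouville's
  -- theorem. The limit of `x F(x)`, computed before, is then zero as well: this is the residue
  -- theorem on the sphere.
  have hF0 : ∀ x, F x = 0 := fun x => by
    have h1 := tendsto_zero_of_mul hlim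
    exact hF.apply_eq_of_tendsto_cocompact x h1
  refine ⟨fun x hx hxq => ?_, ?_⟩
  · have h1 := hFeq' x hx hxq
    rw [hF0, sub_eq_zero] at h1
    rw [h1, AdmissibleCoordinates.base, AdmissibleCoordinates.transfer, add_right_comm,
      ← Finset.sum_add_distrib]
    congr 1
    refine Finset.sum_congr rfl fun h hh => ?_
    exact R.cauchyTransform_eq (ht h.1) (hreg (opp h)) (hx h hh)
  · simp only [hF0, mul_zero] at hlim
    have h1 := tendsto_nhds_unique hlim tendsto_const_nhds
    linear_combination -h1

end HasData

end OpeningNodes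

-- A priori estimates

namespace OpeningNodes

open Complex Metric Set Filter MultiGraph

variable {V E : Type*} {Γ : MultiGraph V E}

namespace Radii

variable {A : AdmissibleCoordinates Γ} {Q : Poles V} {r ε s η σ : ℝ}

/-- The estimate for the singular parts carried over from the other ends of the edges. -/
theorem norm_transfer_le (R : Radii A Q r ε s η σ) {t : E → ℂ} (ht : ∀ e, ‖t e‖ ≤ σ * s / 2)
    {f : V → ℂ → ℂ} {b : E × Bool → ℝ} (hb : ∀ h, ∀ u ∈ sphere (0 : ℂ) s, ‖A.pull f h u‖ ≤ b h)
    {v : V} {x : ℂ} (hx : x ∈ A.Omega Q η v) :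
    ‖A.transfer s σ t f v x‖ ≤
      4 / (σ * η) * ∑ h ∈ Γ.halfEdges v, ‖t h.1‖ * b (opp h) := by
  rw [Finset.mul_sum]
  refine norm_sum_le_of_le _ fun h hh => R.norm_cauchyTransform_le (ht h.1) (hb (opp h)) ?_
  obtain rfl := Γ.mem_halfEdges.1 hh
  exact A.le_dist_of_Omega hx

theorem norm_base_le (R : Radii A Q r ε s η σ) {K : ℕ} (hn : ∀ v, Q.n v ≤ K)
    (hm : ∀ v i, Q.m v i ≤ K) {α : E → ℂ} {a : Q.Parts} {P : V → ℝ} (hP : ∀ v, 0 ≤ P v)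
    (ha : ∀ v i k, ‖a v i k‖ ≤ P v) {v : V} {x : ℂ} (hx : x ∈ A.Omega Q η v) :
    ‖A.base Q α a v x‖ ≤
      η⁻¹ * ∑ e ∈ Γ.edges v, ‖α e‖ + K * (K * max 1 η⁻¹ ^ K) * P v := by
  have hη := R.η_pos
  refine (norm_add_le _ _).trans (add_le_add ?_ ?_)
  · have h1 : ∀ h ∈ Γ.halfEdges v, ‖nodeResidue α h / (x - A.p h)‖ ≤ η⁻¹ * (‖α h.1‖ / 2) := by
      intro h hh
      obtain rfl := Γ.mem_halfEdges.1 hh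
      have h2 := A.le_dist_of_Omega hx
      -- The factor `1 / 2` compensates the `2` from counting both ends of a loop.
      have h3 : (2 * Real.pi)⁻¹ * ‖α h.1‖ ≤ ‖α h.1‖ / 2 := by
        rw [div_eq_inv_mul]
        have := Real.pi_gt_three
        gcongr
        linarith
      rw [norm_div, norm_nodeResidue, div_eq_inv_mul]
      gcongr
    refine (norm_sum_le_of_le _ h1).trans ?_
    rw [← Finset.mul_sum, ← Finset.sum_div]
    have := Γ.sum_halfEdges_fst_le (A := fun e => ‖α e‖) (fun e => norm_nonneg _) v
    gcongr
    linarith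
  · have h1 : ∀ i ∈ Finset.univ, ‖principalTerm (Q.q v i) (a v i) x‖ ≤
        K * max 1 η⁻¹ ^ K * P v := by
      intro i _
      refine (norm_principalTerm_le hη (ha v i) (hx.2 i)).trans ?_
      rw [mul_assoc]
      have h2 := hm v i
      have h3 := hP v
      have h4 : max 1 η⁻¹ ^ Q.m v i ≤ max 1 η⁻¹ ^ K := pow_le_pow_right₀ (le_max_left _ _) h2
      gcongr
    refine (norm_sum_le_of_le _ h1).trans ?_
    rw [Finset.sum_const, nsmul_eq_mul, Finset.card_univ, Fintype.card_fin]
    have := hP v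
    exact (mul_le_mul_of_nonneg_right (Nat.cast_le.2 (hn v)) (by positivity)).trans_eq (by ring)

theorem mem_piece_of_disk (R : Radii A Q r ε s η σ) (t : E → ℂ) {v : V} {i : Fin (Q.n v)} {x : ℂ}
    (hx : x ∈ disk (Q.q v i) r) (hxi : (x : OnePoint ℂ) ≠ Q.q v i) : x ∈ A.piece Q t v := by
  refine ⟨fun h hv hx' => Set.disjoint_left.1 (R.sep.1 v i h hv) hx'.1 hx, fun j hj => ?_⟩
  by_cases hij : i = j
  · exact hxi (hij ▸ hj)
  · exact Set.disjoint_left.1 (R.sep.2 v i j hij) hx (mem_disk_self hj R.r_pos)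

theorem mem_Omega_of_disk (R : Radii A Q r ε s η σ) {v : V} {i : Fin (Q.n v)} {x : ℂ}
    (hx : x ∈ disk (Q.q v i) r) (hxi : x ∉ disk (Q.q v i) ε) : x ∈ A.Omega Q ε v := by
  refine ⟨fun h hv hx' => Set.disjoint_left.1 (R.sep.1 v i h hv) (R.ball_subset h hx') hx,
    fun j hj => ?_⟩
  by_cases hij : i = j
  · subst hij; exact hxi hj
  · exact Set.disjoint_left.1 (R.sep.2 v i j hij) hx (disk_mono _ R.ε_pos R.ε_lt.le hj)

end Radii

namespace HasData

variable {A : AdmissibleCoordinates Γ} {Q : Poles V} {t : E → ℂ} {ω : V → ℂ → ℂ} {α : E → ℂ}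
  {a : Q.Parts} {r ε s η σ : ℝ}

/-- The estimate for the coefficients of the principal parts. -/
theorem norm_part_le (D : HasData A Q t ω α a) (R : Radii A Q r ε s η σ)
    (ht : ∀ e, ‖t e‖ < A.ρ ^ 2) {K : ℕ} (hm : ∀ v i, Q.m v i ≤ K) {v : V} {B : ℝ}
    (hB : ∀ x ∈ A.Omega Q ε v, ‖ω v x‖ ≤ B) (hB0 : 0 ≤ B) (i : Fin (Q.n v)) (k : Fin (Q.m v i)) :
    ‖a v i k‖ ≤ max 1 ((ε + r) / 2) ^ K * (max 1 (((ε + r) / 2) ^ 2)⁻¹ * B) := by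
  have hε := R.ε_pos
  have hεr := R.ε_lt
  -- The circle of radius `d`, strictly between `ε` and `r`, lies in `Ω_{v,ε}` and encloses no other
  -- singularity.
  set d := (ε + r) / 2 with hd
  have hd0 : 0 < d := by linarith [R.r_pos]
  have hεd : ε < d := by linarith
  have hdr : d < r := by linarith
  have hdiff : ∀ x ∈ disk (Q.q v i) r, (x : OnePoint ℂ) ≠ Q.q v i → DifferentiableAt ℂ (ω v) x :=
    fun x hx hxi => D.differentiableAt ht (R.mem_piece_of_disk t hx hxi)
  have hbound : ∀ x ∈ disk (Q.q v i) r, x ∉ disk (Q.q v i) ε → ‖ω v x‖ ≤ B :=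
    fun x hx hxi => hB x (R.mem_Omega_of_disk hx hxi)
  -- The factor `(d ^ 2)⁻¹` is `|dz / du|` for a pole at infinity; for a finite pole the factor is
  -- `1`.
  have hkey : DifferentiableOn ℂ (localCoeff (ω v) (Q.q v i)) {u | 0 < ‖u‖ ∧ ‖u‖ < r} ∧
      ∀ u : ℂ, ‖u‖ = d → ‖localCoeff (ω v) (Q.q v i) u‖ ≤ max 1 (d ^ 2)⁻¹ * B := by
    generalize Q.q v i = q at hdiff hbound
    induction q using OnePoint.rec with
    | infty =>
      refine ⟨fun u hu => ?_, fun u hu => ?_⟩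
      · have hu0 : u ≠ 0 := norm_pos_iff.1 hu.1
        have h1 : DifferentiableAt ℂ (ω v) u⁻¹ := hdiff _
          (Or.inr ⟨rfl, by rw [norm_inv]; exact inv_anti₀ hu.1 hu.2.le⟩) (OnePoint.coe_ne_infty _)
        have h2 : DifferentiableAt ℂ (fun u => ω v u⁻¹) u :=
          h1.comp u (differentiableAt_id.inv hu0)
        refine DifferentiableAt.differentiableWithinAt ?_
        rw [show localCoeff (ω v) OnePoint.infty = fun u => -(ω v u⁻¹ / u ^ 2) from
          funext fun u => localCoeff_infty _ u]
        exact (h2.div (differentiableAt_fun_id.fun_pow 2) (pow_ne_zero 2 hu0)).neg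
      · have h1 : ‖ω v u⁻¹‖ ≤ B := by
          refine hbound _ (Or.inr ⟨rfl, ?_⟩) ?_
          · rw [norm_inv, hu]; exact inv_anti₀ hd0 hdr.le
          · rintro (⟨c, hc, -⟩ | ⟨-, h2⟩)
            · exact OnePoint.infty_ne_coe c hc
            · rw [norm_inv, hu] at h2
              exact absurd h2 (not_le.2 (inv_strictAnti₀ hε hεd))
        rw [localCoeff_infty, norm_neg, norm_div, norm_pow, hu, div_eq_inv_mul]
        gcongr
        exact le_max_right _ _
    | coe c =>
      refine ⟨fun u hu => ?_, fun u hu => ?_⟩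
      · have h1 : DifferentiableAt ℂ (ω v) (c + u) := hdiff _
          (Or.inl ⟨c, rfl, by simpa using hu.2⟩) fun h0 => by
            have := OnePoint.coe_injective h0
            have hu0 : u = 0 := by simpa using this
            simp [hu0] at hu
        refine DifferentiableAt.differentiableWithinAt ?_
        rw [show localCoeff (ω v) (c : OnePoint ℂ) = fun u => ω v (c + u) from
          funext fun u => localCoeff_coe _ c u]
        exact h1.comp u (differentiableAt_id.const_add c)
      · have h1 : ‖ω v (c + u)‖ ≤ B := by
          refine hbound _ (Or.inl ⟨c, rfl, by simpa [hu] using hdr⟩) ?_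
          rintro (⟨c', hc, h2⟩ | ⟨h2, -⟩)
          · rw [← OnePoint.coe_injective hc, mem_ball, dist_eq_norm, add_sub_cancel_left, hu] at h2
            linarith
          · exact OnePoint.coe_ne_infty c h2
        rw [localCoeff_coe]
        exact h1.trans (le_mul_of_one_le_left hB0 (le_max_left _ _))
  refine ((D.part v i).norm_le hd0 hdr hkey.1 hkey.2 k).trans ?_
  have h1 : d ^ (k.1 + 1) ≤ max 1 d ^ K :=
    (pow_le_pow_left₀ hd0.le (le_max_right 1 d) _).trans
      (pow_le_pow_right₀ (le_max_left _ _) (k.2.trans_le (hm v i)))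
  gcongr

/-- The differential minus its singular part at a node extends to the disk of radius `ε`. -/
theorem exists_sub_ball (D : HasData A Q t ω α a) (R : Radii A Q r ε s η σ)
    (ht : ∀ e, ‖t e‖ ≤ σ * s / 2) (h : E × Bool) :
    ∃ G : ℂ → ℂ, (∀ x ∈ closedBall (A.p h) ε, DifferentiableAt ℂ G x) ∧ ∀ x, x ∉ A.core σ h →
      ω (Γ.vert h) x = G x + cauchyTransform (A.X h) σ
        (gluedPart (t h.1) (nodeResidue α h) (A.regular s ω (opp h))) x := by
  classical
  have hreg := R.differentiableOn_regular (D.continuousOn_pull R ht (opp h))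
  obtain ⟨g, hg, hg'⟩ := D.exists_sub_node R ht h
  set S := cauchyTransform (A.X h) σ
    (gluedPart (t h.1) (nodeResidue α h) (A.regular s ω (opp h)))
  set G : ℂ → ℂ := fun x => if x ∈ A.core σ h then g x else ω (Γ.vert h) x - S x
  have hGn : ∀ x, x ∉ A.core σ h → G x = ω (Γ.vert h) x - S x := fun x hx => if_neg hx
  have hU : IsOpen {x | x ∈ (A.z h).source ∧ ‖A.z h x‖ < s} := by
    have := (A.z h).isOpen_inter_preimage (isOpen_ball (x := (0 : ℂ)) (ε := s))
    convert this using 1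
    ext x
    simp
  refine ⟨G, fun x hx => ?_, fun x hx => by rw [hGn x hx, sub_add_cancel]⟩
  by_cases hxc : x ∈ A.core σ h
  · have hxU : x ∈ {x | x ∈ (A.z h).source ∧ ‖A.z h x‖ < s} := ⟨hxc.1, hxc.2.trans_lt R.σ_lt_s⟩
    refine (hg.differentiableAt (hU.mem_nhds hxU)).congr_of_eventuallyEq ?_
    filter_upwards [hU.mem_nhds hxU] with y hy
    by_cases hyc : y ∈ A.core σ h
    · exact if_pos hyc
    · rw [hGn y hyc]; exact hg' y hy hyc
  · have h1 : x ∈ A.piece Q t (Γ.vert h) := by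
      refine mem_piece_of_notMem_core R ht (fun h' hh' hx' => ?_) fun i =>
        ne_of_notMem_disk R.ε_pos (R.notMem_disk_of_closedBall i hx)
      by_cases hne : h = h'
      · exact hxc (hne ▸ hx')
      · exact R.notMem_source_of_ne hne (Γ.mem_halfEdges.1 hh').symm hx hx'.1
    refine ((D.differentiableAt (fun e => R.norm_lt_sq (ht e)) h1).sub
      (R.differentiableAt_cauchyTransform (c := nodeResidue α h) (ht h.1) hreg
        hxc)).congr_of_eventuallyEq ?_
    filter_upwards [(A.isClosed_core R.σ_lt h).isOpen_compl.mem_nhds hxc] with y hy using hGn y hy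

/-- The maximum principle. -/
theorem _root_.OpeningNodes.norm_le_of_closedBall {G : ℂ → ℂ} {p : ℂ} {ε B : ℝ} (hε : 0 < ε)
    (hG : ∀ x ∈ closedBall p ε, DifferentiableAt ℂ G x) (hB : ∀ x ∈ sphere p ε, ‖G x‖ ≤ B) :
    ∀ x ∈ closedBall p ε, ‖G x‖ ≤ B := fun x hx => by
  refine Complex.norm_le_of_forall_mem_frontier_norm_le (U := ball p ε) isBounded_ball ?_ ?_ ?_
  · refine DifferentiableOn.diffContOnCl fun y hy => ?_
    rw [closure_ball _ hε.ne'] at hy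
    exact (hG y hy).differentiableWithinAt
  · rw [frontier_ball _ hε.ne']; exact hB
  · rwa [closure_ball _ hε.ne']

/-- The estimates for the residue and for the coefficient of the differential at a node. -/
theorem norm_node_le (D : HasData A Q t ω α a) (R : Radii A Q r ε s η σ)
    (ht : ∀ e, ‖t e‖ ≤ σ * s / 2) {h : E × Bool} {B b : ℝ}
    (hB : ∀ x ∈ A.Omega Q ε (Γ.vert h), ‖ω (Γ.vert h) x‖ ≤ B)
    (hb : ∀ u ∈ sphere (0 : ℂ) s, ‖A.pull ω (opp h) u‖ ≤ b) :
    ‖nodeResidue α h‖ ≤ ε * (B + 4 / (σ * η) * (‖t h.1‖ * b)) ∧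
    ∀ u ∈ sphere (0 : ℂ) s, ‖A.pull ω h u‖ ≤
      4 * A.c₂ * ((3 + ε / η) * (B + 4 / (σ * η) * (‖t h.1‖ * b))) := by
  have hε := R.ε_pos
  have hη := R.η_pos
  have hreg := R.differentiableOn_regular (D.continuousOn_pull R ht (opp h))
  obtain ⟨G, hG, hωG⟩ := D.exists_sub_ball R ht h
  set S₀ := cauchyTransform (A.X h) σ (gluedPart (t h.1) 0 (A.regular s ω (opp h)))
  set c := 4 / (σ * η) * (‖t h.1‖ * b)
  set ρ₀ := nodeResidue α h
  have hS₀ : ∀ x, η ≤ ‖x - A.p h‖ → ‖S₀ x‖ ≤ c := fun x hx =>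
    R.norm_cauchyTransform_le (ht h.1) hb hx
  have hω : ∀ x, η ≤ ‖x - A.p h‖ → ω (Γ.vert h) x = G x + (ρ₀ / (x - A.p h) + S₀ x) := by
    intro x hx
    have hxc := R.notMem_core_of_le hx
    rw [hωG x hxc, R.cauchyTransform_eq (ht h.1) hreg hxc]
  have hsph : ∀ x ∈ sphere (A.p h) ε, ‖x - A.p h‖ = ε := fun x hx => by
    rwa [mem_sphere, dist_eq_norm] at hx
  have hres : ‖ρ₀‖ ≤ ε * (B + c) := by
    -- This function takes the value `ρ₀` at the node and equals `(x - p) (ω - S₀)` on the boundary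
    -- circle, so the maximum principle bounds the residue.
    have h1 := norm_le_of_closedBall (G := fun x => (x - A.p h) * G x + ρ₀) (B := ε * (B + c)) hε
      (fun x hx => ((differentiableAt_id.sub_const _).mul (hG x hx)).add_const _)
      (fun x hx => by
        have hx' := hsph x hx
        have hx0 : x - A.p h ≠ 0 := norm_pos_iff.1 (hx' ▸ hε)
        have h2 := hω x (hx'.symm ▸ R.η_le)
        have h3 : (x - A.p h) * G x + ρ₀ = (x - A.p h) * (ω (Γ.vert h) x - S₀ x) := by
          rw [h2]; field_simp; ring
        rw [h3, norm_mul, hx']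
        have h4 := hB x (R.sphere_subset_Omega h hx)
        have h5 := hS₀ x (hx'.symm ▸ R.η_le)
        have h6 := norm_sub_le (ω (Γ.vert h) x) (S₀ x)
        gcongr
        linarith) (A.p h) (mem_closedBall_self hε.le)
    simpa using h1
  refine ⟨hres, fun u hu => ?_⟩
  -- On the boundary `ω - S₀` contributes `B + c`, and `ρ₀ / (x - p)` another `B + c`.
  have hGb := norm_le_of_closedBall (B := 2 * (B + c)) hε hG fun x hx => by
    have hx' := hsph x hx
    have h2 := hω x (hx'.symm ▸ R.η_le)
    have h3 : G x = ω (Γ.vert h) x - S₀ x - ρ₀ / (x - A.p h) := by rw [h2]; ring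
    have h4 := hB x (R.sphere_subset_Omega h hx)
    have h5 := hS₀ x (hx'.symm ▸ R.η_le)
    have h6 : ‖ρ₀ / (x - A.p h)‖ ≤ B + c := by
      rw [norm_div, hx', div_le_iff₀ hε]; linarith
    rw [h3]
    have h7 := norm_sub_le (ω (Γ.vert h) x - S₀ x) (ρ₀ / (x - A.p h))
    have h8 := norm_sub_le (ω (Γ.vert h) x) (S₀ x)
    linarith
  rw [mem_sphere_zero_iff_norm] at hu
  refine R.norm_pull_le hu ?_
  set x := A.X h u
  have hx1 : η ≤ ‖x - A.p h‖ := A.le_dist_of_Omega (R.circle_mem_Omega hu)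
  have hx2 : ‖x - A.p h‖ ≤ ε := by
    have h1 := A.upper_X (h := h) (hu.trans_lt R.s_lt)
    rw [hu] at h1
    linarith [R.s_le']
  have h3 := hGb x (by rwa [mem_closedBall, dist_eq_norm])
  have h4 : ‖ρ₀ / (x - A.p h)‖ ≤ ε / η * (B + c) := by
    rw [norm_div, div_le_iff₀ (hη.trans_le hx1)]
    refine hres.trans ?_
    have h0 : 0 ≤ ε / η * (B + c) := by
      have : 0 ≤ B + c := nonneg_of_mul_nonneg_right ((norm_nonneg _).trans hres) hε
      positivity
    calc ε * (B + c) = ε / η * (B + c) * η := by field_simp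
      _ ≤ _ := by gcongr
  have h5 := hS₀ x hx1
  have h6 := norm_add_le (ρ₀ / (x - A.p h)) (S₀ x)
  have h7 := norm_add_le (G x) (ρ₀ / (x - A.p h) + S₀ x)
  rw [hω x hx1]
  -- Nonnegativity of `B` gives `c ≤ B + c`; the three bounds then add up to the factor `3 + ε / η`.
  have h8 : 0 ≤ B := (norm_nonneg _).trans (hB _ (R.sphere_subset_Omega h
    (show A.p h + ε ∈ sphere (A.p h) ε by simp [abs_of_pos hε])))
  linarith

/-- The estimates at both ends of an edge, when the parameters are small. -/
theorem norm_edge_le (D : HasData A Q t ω α a) (R : Radii A Q r ε s η σ)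
    (ht : ∀ e, ‖t e‖ ≤ σ * s / 2)
    (ht' : ∀ e, 4 * A.c₂ * (3 + ε / η) * (4 / (σ * η)) * ‖t e‖ ≤ 1 / 2) {B : V → ℝ}
    (hB : ∀ v, ∀ x ∈ A.Omega Q ε v, ‖ω v x‖ ≤ B v) (h : E × Bool) :
    (∀ u ∈ sphere (0 : ℂ) s, ‖A.pull ω h u‖ ≤
      2 * (4 * A.c₂ * (3 + ε / η)) * (B (Γ.src h.1) + B (Γ.tgt h.1))) ∧
    ‖nodeResidue α h‖ ≤ ε * (2 * (B (Γ.src h.1) + B (Γ.tgt h.1)) ) := by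
  have hε := R.ε_pos
  have hη := R.η_pos
  have hσ := R.σ_pos
  have hc := A.c₂_pos
  -- The actual maxima are used: they are finite and satisfy the estimate at each end themselves, so
  -- they can be absorbed.
  have hmax : ∀ h : E × Bool, ∃ b, (∀ u ∈ sphere (0 : ℂ) s, ‖A.pull ω h u‖ ≤ b) ∧
      ∃ u ∈ sphere (0 : ℂ) s, ‖A.pull ω h u‖ = b := fun h => by
    obtain ⟨u, hu, hmax⟩ := (isCompact_sphere (0 : ℂ) s).exists_isMaxOn
      ⟨(s : ℂ), by simp [abs_of_pos R.s_pos]⟩ (D.continuousOn_pull R ht h).norm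
    exact ⟨_, fun w hw => hmax hw, u, hu, rfl⟩
  choose b hb hb' using hmax
  have hb0 : ∀ h, 0 ≤ b h := fun h => by
    obtain ⟨u, _, h2⟩ := hb' h
    rw [← h2]; positivity
  set M := 4 * A.c₂ * (3 + ε / η)
  have hM0 : 0 < M := by positivity
  -- Each end is controlled by half the other one; adding the two inequalities moves these halves to
  -- the left.
  have hstep : ∀ h, b h ≤ M * B (Γ.vert h) + 1 / 2 * b (opp h) := fun h => by
    obtain ⟨u, hu, hub⟩ := hb' h
    have h1 := (D.norm_node_le R ht (hB _) (hb (opp h))).2 u hu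
    rw [hub] at h1
    have h2 := mul_le_mul_of_nonneg_right (ht' h.1) (hb0 (opp h))
    have h3 : 4 * A.c₂ * ((3 + ε / η) * (B (Γ.vert h) + 4 / (σ * η) * (‖t h.1‖ * b (opp h)))) =
      M * B (Γ.vert h) + M * (4 / (σ * η)) * ‖t h.1‖ * b (opp h) := by ring
    linarith
  have hsum : B (Γ.vert h) + B (Γ.vert (opp h)) = B (Γ.src h.1) + B (Γ.tgt h.1) := by
    obtain ⟨e, c⟩ := h
    cases c <;> simp [MultiGraph.vert, opp, add_comm]
  have hB0 : ∀ h : E × Bool, 0 ≤ B (Γ.vert h) := fun h =>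
    (norm_nonneg _).trans (hB _ _ (R.sphere_subset_Omega h
      (show A.p h + ε ∈ sphere (A.p h) ε by simp [abs_of_pos hε])))
  have hbb : b h + b (opp h) ≤ 2 * M * (B (Γ.src h.1) + B (Γ.tgt h.1)) := by
    have h1 := hstep h
    have h2 := hstep (opp h)
    rw [opp_opp] at h2
    rw [← hsum]
    linarith
  refine ⟨fun u hu => (hb h u hu).trans (by linarith [hb0 (opp h)]), ?_⟩
  refine (D.norm_node_le R ht (hB _) (hb (opp h))).1.trans ?_
  have h1 : 4 / (σ * η) * (‖t h.1‖ * b (opp h)) ≤ B (Γ.src h.1) + B (Γ.tgt h.1) := by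
    have h2 := mul_le_mul_of_nonneg_right (ht' h.1) (hb0 (opp h))
    have h3 : M * (4 / (σ * η) * (‖t h.1‖ * b (opp h))) ≤
        M * (B (Γ.src h.1) + B (Γ.tgt h.1)) := by
      have := hb0 h
      linarith
    exact le_of_mul_le_mul_left h3 hM0
  have h2 := hB0 (opp h)
  gcongr
  linarith

/-- The estimate for the periods. -/
theorem norm_period_le (D : HasData A Q t ω α a) (R : Radii A Q r ε s η σ)
    (ht : ∀ e, ‖t e‖ ≤ σ * s / 2)
    (ht' : ∀ e, 4 * A.c₂ * (3 + ε / η) * (4 / (σ * η)) * ‖t e‖ ≤ 1 / 2) {B : V → ℝ}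
    (hB : ∀ v, ∀ x ∈ A.Omega Q ε v, ‖ω v x‖ ≤ B v) (e : E) :
    ‖α e‖ ≤ 4 * Real.pi * ε * (B (Γ.src e) + B (Γ.tgt e)) := by
  have h1 := (D.norm_edge_le R ht ht' hB (e, true)).2
  rw [norm_nodeResidue, inv_mul_le_iff₀ (by positivity)] at h1
  linarith

/-- The a priori estimate. -/
theorem norm_le (D : HasData A Q t ω α a) (R : Radii A Q r ε s η σ)
    (ht : ∀ e, ‖t e‖ ≤ σ * s / 2)
    (ht' : ∀ e, 4 * A.c₂ * (3 + ε / η) * (4 / (σ * η)) * ‖t e‖ ≤ 1 / 2) {B : V → ℝ}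
    (hB0 : ∀ v, 0 ≤ B v) (hB : ∀ v, ∀ x ∈ A.Omega Q ε v, ‖ω v x‖ ≤ B v) {K : ℕ}
    (hn : ∀ v, Q.n v ≤ K) (hm : ∀ v i, Q.m v i ≤ K) {P : V → ℝ} (hP : ∀ v, 0 ≤ P v)
    (ha : ∀ v i k, ‖a v i k‖ ≤ P v) {δ : ℝ} (hδ : ∀ e, ‖t e‖ ≤ δ) {v : V} {x : ℂ}
    (hx : x ∈ A.Omega Q ε v) :
    ‖ω v x‖ ≤ η⁻¹ * ∑ e ∈ Γ.edges v, ‖α e‖ + K * (K * max 1 η⁻¹ ^ K) * P v +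
      4 / (σ * η) * (δ * (2 * (4 * A.c₂ * (3 + ε / η))) *
        (2 * ∑ e ∈ Γ.edges v, (B (Γ.src e) + B (Γ.tgt e)))) := by
  have hε := R.ε_pos
  have hη := R.η_pos
  have hσ := R.σ_pos
  have hc := A.c₂_pos
  have hxη := R.Omega_subset v hx
  rw [(D.eq_and_sum_residue R ht v).1 x (fun h hh => ?_) fun i => R.ne_pole_of_Omega hxη i]
  · refine (norm_add_le _ _).trans (add_le_add (R.norm_base_le hn hm hP ha hxη) ?_)
    refine (R.norm_transfer_le ht (fun h => (D.norm_edge_le R ht ht' hB h).1) hxη).trans ?_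
    have h1 := Γ.sum_halfEdges_fst_le (A := fun e => B (Γ.src e) + B (Γ.tgt e))
      (fun e => add_nonneg (hB0 _) (hB0 _)) v
    refine mul_le_mul_of_nonneg_left (le_trans (Finset.sum_le_sum fun h _ =>
      mul_le_mul_of_nonneg_right (hδ h.1) ?_) ?_) (by positivity)
    · have := hB0 (Γ.src h.1)
      have := hB0 (Γ.tgt h.1)
      simp only [opp]
      positivity
    · by_cases hE : Nonempty E
      · have hδ0 : 0 ≤ δ := (norm_nonneg _).trans (hδ hE.some)
        simp only [opp]
        refine le_trans (le_of_eq ?_) (mul_le_mul_of_nonneg_left h1 (by positivity))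
        rw [Finset.mul_sum]
        exact Finset.sum_congr rfl fun h _ => by ring
      · have h2 : Γ.halfEdges v = ∅ := Finset.eq_empty_of_forall_notMem fun h => (hE ⟨h.1⟩).elim
        have h3 : Γ.edges v = ∅ := Finset.eq_empty_of_forall_notMem fun e => (hE ⟨e⟩).elim
        simp [h2, h3]
  · obtain rfl := Γ.mem_halfEdges.1 hh
    exact R.notMem_core_of_le (A.le_dist_of_Omega hxη)

/-- A differential that vanishes on the domains `Ω_{v,ε}` vanishes. -/
theorem eq_zero (D : HasData A Q t ω α a) (R : Radii A Q r ε s η σ)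
    (ht : ∀ e, ‖t e‖ ≤ σ * s / 2)
    (ht' : ∀ e, 4 * A.c₂ * (3 + ε / η) * (4 / (σ * η)) * ‖t e‖ ≤ 1 / 2)
    (h0 : ∀ v, ∀ x ∈ A.Omega Q ε v, ω v x = 0) (hα : α = 0) (ha : a = 0) : ω = 0 := by
  -- The edge estimate with bound zero. Vanishing on the circles kills the regular parts, and the
  -- integral equation then kills `ω` off the cores.
  have hpull : ∀ h, ∀ u ∈ sphere (0 : ℂ) s, A.pull ω h u = 0 := fun h u hu => by
    have := (D.norm_edge_le R ht ht' (B := 0) (fun v x hx => by simp [h0 v x hx]) h).1 u hu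
    simpa using this
  have hreg : ∀ h u, A.regular s ω h u = 0 := fun h u => by
    rw [AdmissibleCoordinates.regular, regularPart_eq,
      circleIntegral.integral_congr (g := fun _ => 0) R.s_pos.le fun w hw => by
        simp only [hpull h w hw, zero_div]]
    simp [circleIntegral]
  have hres : ∀ h, nodeResidue α h = 0 := fun h => by
    rw [← norm_eq_zero, norm_nodeResidue, hα]; simp
  have hglued : ∀ h u, gluedPart (t h.1) 0 (A.regular s ω (opp h)) u = 0 := fun h u => by
    simp [gluedPart, hreg]
  have hoff : ∀ v x, (∀ h ∈ Γ.halfEdges v, x ∉ A.core σ h) → (∀ i, (x : OnePoint ℂ) ≠ Q.q v i) →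
      ω v x = 0 := fun v x hx hxq => by
    rw [(D.eq_and_sum_residue R ht v).1 x hx hxq, AdmissibleCoordinates.base,
      AdmissibleCoordinates.transfer]
    have h1 : ∀ h ∈ Γ.halfEdges v, cauchyTransform (A.X h) σ
        (gluedPart (t h.1) 0 (A.regular s ω (opp h))) x = 0 := fun h _ => by
      rw [cauchyTransform_congr (M' := fun _ => 0) R.σ_pos.le fun u _ => hglued h u]
      simp [cauchyTransform, circleIntegral]
    have h2 : ∀ i, principalTerm (Q.q v i) (a v i) x = 0 := fun i => by
      rw [ha]; exact principalTerm_zero _ _ x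
    rw [Finset.sum_eq_zero h1]
    simp [hres, h2]
  have hbig : ∀ h u, σ < ‖u‖ → ‖u‖ < A.ρ → A.pull ω h u = 0 := fun h u hu hu' => by
    rw [AdmissibleCoordinates.pull, hoff _ _ (fun h' hh' hx => ?_)
      (R.ne_pole_of_source (A.X_mem hu')), zero_mul]
    by_cases hne : h' = h
    · subst hne
      have := hx.2
      rw [A.z_X hu'] at this
      linarith
    · exact A.notMem_core_of_source hne (Γ.mem_halfEdges.1 hh') (A.X_mem hu') _ hx
  funext v x
  by_cases hx : x ∈ A.piece Q t v
  · by_cases hc : ∀ h ∈ Γ.halfEdges v, x ∉ A.core σ h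
    · exact hoff v x hc hx.2
    · push Not at hc
      obtain ⟨h, hh, hxh⟩ := hc
      obtain rfl := Γ.mem_halfEdges.1 hh
      have hw : ‖t h.1‖ / A.ρ < ‖A.z h x‖ := by
        by_contra! hle
        exact hx.1 h rfl ⟨hxh.1, hle⟩
      have hws : ‖A.z h x‖ < s := hxh.2.trans_lt R.σ_lt_s
      have hz : A.pull ω h (A.z h x) = 0 := by
        -- Inside a core, the Laurent expansion covers `‖t‖ / s < ‖u‖ < s`. A point closer to the
        -- removed disk is glued to one with `‖w‖ ≥ s > σ` at the other end, where vanishing is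
        -- already known.
        by_cases hts : ‖t h.1‖ / s < ‖A.z h x‖
        · rw [(D.pull_eq R ht h).2 _ hts hws, hreg, hres, hglued, add_zero]
        · push Not at hts
          have hz0 : 0 < ‖A.z h x‖ := (div_nonneg (norm_nonneg _) A.ρ_pos.le).trans_lt hw
          have ht0 : t h.1 ≠ 0 := fun ht0 => by
            rw [ht0, norm_zero, zero_div] at hts
            linarith
          rw [D.pull_glue ht0 hw (hws.trans R.s_lt), hbig _ _ ?_ (norm_div_lt_of_lt A.ρ_pos hw),
            mul_zero]
          refine R.σ_lt_s.trans_le ?_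
          rw [norm_div, le_div_iff₀ hz0, mul_comm]
          rwa [le_div_iff₀ R.s_pos] at hts
      have h1 := A.deriv_X_mul_deriv_z hxh.1
      rw [AdmissibleCoordinates.pull, A.X_z hxh.1] at hz
      have h2 : deriv (A.X h) (A.z h x) ≠ 0 := fun h3 => by simp [h3] at h1
      simpa [h2] using hz
  · exact D.mero.off v x hx

end HasData

end OpeningNodes

-- Linearity and boundedness of the transfer operator

namespace OpeningNodes

open Complex Metric Set Filter MultiGraph
open scoped BoundedContinuousFunction

variable {V E : Type*} {Γ : MultiGraph V E}

theorem regularPart_const_mul (s : ℝ) (c : ℂ) (φ : ℂ → ℂ) (u : ℂ) :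
    regularPart s (fun v => c * φ v) u = c * regularPart s φ u := by
  rw [regularPart_eq, regularPart_eq, mul_left_comm, ← circleIntegral.integral_const_mul c]
  simp only [mul_div_assoc]

theorem regularPart_congr {s : ℝ} (hs : 0 ≤ s) {φ ψ : ℂ → ℂ} (h : EqOn φ ψ (sphere 0 s)) (u : ℂ) :
    regularPart s φ u = regularPart s ψ u := by
  rw [regularPart_eq, regularPart_eq,
    circleIntegral.integral_congr (g := fun ζ => ψ ζ / (ζ - u)) hs fun w hw => by
      simp only [h hw]]

namespace Radii

variable {A : AdmissibleCoordinates Γ} {Q : Poles V} {r ε s η σ : ℝ}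

theorem regular_congr (R : Radii A Q r ε s η σ) {f g : V → ℂ → ℂ}
    (h : ∀ v, EqOn (f v) (g v) (A.Omega Q η v)) (k : E × Bool) :
    A.regular s f k = A.regular s g k := by
  funext u
  refine regularPart_congr R.s_pos.le (fun w hw => ?_) u
  rw [AdmissibleCoordinates.pull, AdmissibleCoordinates.pull,
    h _ (R.circle_mem_Omega (mem_sphere_zero_iff_norm.1 hw))]

/-- The operator sees only the values on the circles `‖u‖ = s`, which lie in `Ω_{v,η}`. So the
equation can be solved there and the solution then defined elsewhere by the right-hand side. -/
theorem transfer_congr (R : Radii A Q r ε s η σ) (t : E → ℂ) {f g : V → ℂ → ℂ}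
    (h : ∀ v, EqOn (f v) (g v) (A.Omega Q η v)) : A.transfer s σ t f = A.transfer s σ t g := by
  funext v x
  simp only [AdmissibleCoordinates.transfer, R.regular_congr h]

theorem transfer_smul (t : E → ℂ) (c : ℂ) (f : V → ℂ → ℂ) (v : V) (x : ℂ) :
    A.transfer s σ t (c • f) v x = c * A.transfer s σ t f v x := by
  have h1 : ∀ h, A.regular s (c • f) h = fun u => c * A.regular s f h u := fun h => by
    funext u
    rw [AdmissibleCoordinates.regular, AdmissibleCoordinates.regular, ← regularPart_const_mul]
    congr 1
    funext w
    simp only [AdmissibleCoordinates.pull, Pi.smul_apply, smul_eq_mul, mul_assoc]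
  simp only [AdmissibleCoordinates.transfer, h1, Finset.mul_sum]
  refine Finset.sum_congr rfl fun h _ => ?_
  rw [← cauchyTransform_const_mul]
  congr 1
  funext u
  simp only [gluedPart]
  ring

theorem notMem_core_of_Omega (R : Radii A Q r ε s η σ) {v : V} {x : ℂ} (hx : x ∈ A.Omega Q η v) :
    ∀ h ∈ Γ.halfEdges v, x ∉ A.core σ h := fun h hh => by
  obtain rfl := Γ.mem_halfEdges.1 hh
  exact R.notMem_core_of_le (A.le_dist_of_Omega hx)

theorem transfer_add (R : Radii A Q r ε s η σ) {t : E → ℂ} (ht : ∀ e, ‖t e‖ ≤ σ * s / 2)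
    {f g : V → ℂ → ℂ} (hf : ∀ v, ContinuousOn (f v) (A.Omega Q η v))
    (hg : ∀ v, ContinuousOn (g v) (A.Omega Q η v)) {v : V} {x : ℂ} (hx : x ∈ A.Omega Q η v) :
    A.transfer s σ t (f + g) v x = A.transfer s σ t f v x + A.transfer s σ t g v x := by
  have hF := fun h => R.differentiableOn_regular (R.continuousOn_pull hf h)
  have hG := fun h => R.differentiableOn_regular (R.continuousOn_pull hg h)
  simp only [AdmissibleCoordinates.transfer]
  rw [← Finset.sum_add_distrib]
  refine Finset.sum_congr rfl fun h hh => ?_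
  have hcont : ∀ {k : ℂ → ℂ}, DifferentiableOn ℂ k (ball 0 s) →
      ContinuousOn (gluedPart (t h.1) 0 k) (sphere 0 σ) := fun hk =>
    (differentiableOn_gluedPart R.s_pos hk).continuousOn.mono
      (sphere_subset_of_lt (R.div_s_lt (ht h.1)))
  rw [← cauchyTransform_add R.σ_pos.le (hcont (hF (opp h))) (hcont (hG (opp h)))
    ((A.univalent h).continuousOn_sphere R.σ_lt)
    fun u hu => R.ne_X_of_notMem_core (R.notMem_core_of_Omega hx h hh)
      (mem_sphere_zero_iff_norm.1 hu).le]
  refine cauchyTransform_congr R.σ_pos.le fun u hu => ?_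
  rw [mem_sphere_zero_iff_norm] at hu
  have hw : ‖t h.1 / u‖ < s := by
    rw [norm_div, hu]
    exact (R.div_σ_le (ht h.1)).trans_lt (by linarith [R.s_pos])
  have h1 : A.regular s (f + g) (opp h) (t h.1 / u) =
      A.regular s f (opp h) (t h.1 / u) + A.regular s g (opp h) (t h.1 / u) := by
    rw [AdmissibleCoordinates.regular, AdmissibleCoordinates.regular,
      AdmissibleCoordinates.regular, ← regularPart_add R.s_pos.le (R.continuousOn_pull hf _)
        (R.continuousOn_pull hg _) hw]
    congr 1
    funext w
    simp only [AdmissibleCoordinates.pull, Pi.add_apply, add_mul]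
  simp only [gluedPart, h1]
  ring

theorem differentiableAt_transfer (R : Radii A Q r ε s η σ) {t : E → ℂ}
    (ht : ∀ e, ‖t e‖ ≤ σ * s / 2) {f : V → ℂ → ℂ} (hf : ∀ v, ContinuousOn (f v) (A.Omega Q η v))
    {v : V} {x : ℂ} (hx : ∀ h ∈ Γ.halfEdges v, x ∉ A.core σ h) :
    DifferentiableAt ℂ (A.transfer s σ t f v) x := by
  refine DifferentiableAt.fun_sum fun h hh => ?_
  exact R.differentiableAt_cauchyTransform (ht h.1)
    (R.differentiableOn_regular (R.continuousOn_pull hf (opp h))) (hx h hh)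

theorem sub_node_ne_zero (R : Radii A Q r ε s η σ) {h : E × Bool} {x : ℂ} (hx : x ∉ A.core σ h) :
    x - A.p h ≠ 0 := fun h0 => by
  rw [sub_eq_zero] at h0
  exact hx ⟨h0 ▸ A.p_mem h, by rw [h0, A.z_p, norm_zero]; exact R.σ_pos.le⟩

theorem differentiableAt_base (R : Radii A Q r ε s η σ) {α : E → ℂ} {a : Q.Parts}
    {v : V} {x : ℂ} (hx : ∀ h ∈ Γ.halfEdges v, x ∉ A.core σ h)
    (hxq : ∀ i, (x : OnePoint ℂ) ≠ Q.q v i) : DifferentiableAt ℂ (A.base Q α a v) x := by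
  refine DifferentiableAt.fun_add (DifferentiableAt.fun_sum fun h hh => ?_)
    (DifferentiableAt.fun_sum fun i _ => differentiableAt_principalTerm _ (hxq i))
  exact (differentiableAt_const _).div (differentiableAt_id.sub_const _)
    (R.sub_node_ne_zero (hx h hh))

/-- The extension by zero of functions on the domains `Ω_{v,η}`. -/
noncomputable def extend (A : AdmissibleCoordinates Γ) (Q : Poles V) (η : ℝ) :
    (∀ v, A.Omega Q η v →ᵇ ℂ) →ₗ[ℂ] (V → ℂ → ℂ) where
  toFun y v := Function.extend Subtype.val (y v) 0
  map_add' y y' := by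
    funext v
    simp only [Pi.add_apply, BoundedContinuousFunction.coe_add]
    rw [← Function.extend_add, add_zero]
  map_smul' c y := by
    funext v
    simp only [Pi.smul_apply, BoundedContinuousFunction.coe_smul, RingHom.id_apply]
    conv_rhs => rw [← Function.extend_smul, smul_zero]
    rfl

theorem extend_apply (y : ∀ v, A.Omega Q η v →ᵇ ℂ) {v : V} {x : ℂ} (hx : x ∈ A.Omega Q η v) :
    extend A Q η y v x = y v ⟨x, hx⟩ :=
  Subtype.val_injective.extend_apply (y v) 0 ⟨x, hx⟩

theorem continuousOn_extend (y : ∀ v, A.Omega Q η v →ᵇ ℂ) (v : V) :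
    ContinuousOn (extend A Q η y v) (A.Omega Q η v) := by
  rw [continuousOn_iff_continuous_domRestrict]
  convert (y v).continuous using 1
  funext x
  exact extend_apply y x.2

/-- The norms of the components. -/
noncomputable def fibreNorm (A : AdmissibleCoordinates Γ) (Q : Poles V) (η : ℝ) (v : V) :
    ESeminorm (∀ v, A.Omega Q η v →ᵇ ℂ) where
  toFun y := ‖y v‖ₑ
  add_le' _ _ := enorm_add_le _ _
  smul' c y := enorm_smul c (y v)

theorem norm_pull_extend_le (R : Radii A Q r ε s η σ) (y : ∀ v, A.Omega Q η v →ᵇ ℂ) (h : E × Bool) :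
    ∀ u ∈ sphere (0 : ℂ) s, ‖A.pull (extend A Q η y) h u‖ ≤ 4 * A.c₂ * ‖y (Γ.vert h)‖ :=
  fun u hu => by
    rw [mem_sphere_zero_iff_norm] at hu
    refine R.norm_pull_le hu ?_
    rw [extend_apply y (R.circle_mem_Omega hu)]
    exact (y _).norm_coe_le_norm _

theorem norm_transfer_extend_le (R : Radii A Q r ε s η σ) {t : E → ℂ}
    (ht : ∀ e, ‖t e‖ ≤ σ * s / 2) {δ : ℝ} (hδ : ∀ e, ‖t e‖ ≤ δ) (hδ0 : 0 ≤ δ)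
    (y : ∀ v, A.Omega Q η v →ᵇ ℂ) {v : V} {x : ℂ} (hx : x ∈ A.Omega Q η v) :
    ‖A.transfer s σ t (extend A Q η y) v x‖ ≤ 4 / (σ * η) * (δ * (4 * A.c₂)) *
      ∑ e ∈ Γ.edges v, (‖y (Γ.src e)‖ + ‖y (Γ.tgt e)‖) := by
  have hη := R.η_pos
  have hσ := R.σ_pos
  have hc := A.c₂_pos
  refine (R.norm_transfer_le ht (R.norm_pull_extend_le y) hx).trans ?_
  rw [mul_assoc (4 / (σ * η))]
  refine mul_le_mul_of_nonneg_left ?_ (by positivity)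
  refine le_trans ?_ (mul_le_mul_of_nonneg_left
    (Γ.sum_halfEdges_opp_le (B := fun v => ‖y v‖) (fun v => norm_nonneg _) v)
    (by positivity : 0 ≤ δ * (4 * A.c₂)))
  rw [Finset.mul_sum]
  refine Finset.sum_le_sum fun h _ => ?_
  rw [← mul_assoc (‖t h.1‖)]
  have := hδ h.1
  gcongr

end Radii

end OpeningNodes

-- Solution of the integral equation by a contraction

namespace OpeningNodes

open Complex Metric Set Filter MultiGraph
open scoped BoundedContinuousFunction

variable {V E : Type*} {Γ : MultiGraph V E}

/-- A linear map that preserves the finiteness of the norm, on the space of the vectors of finite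
norm. -/
def ESeminorm.restrict {X : Type*} [AddCommGroup X] [Module ℂ X] (p : ESeminorm X)
    (S : X →ₗ[ℂ] X) (hS : ∀ y, p y < ∞ → p (S y) < ∞) : p.Space →ₗ[ℂ] p.Space where
  toFun y := p.lift (S (p.val y)) (hS _ (p.val_lt_top y))
  map_add' y y' := p.val_injective (by simp only [map_add, p.val_lift])
  map_smul' b y := p.val_injective (by
    simp only [RingHom.id_apply, map_smul, p.val_lift])

namespace MonotonicNorm

variable {ι X : Type*} [AddCommGroup X] [Module ℂ X] (N : MonotonicNorm ι) {κ : ι → Type*}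
  (φ : ∀ i, κ i → X →ₗ[ℂ] ℂ)

theorem comp_supAbs_le {x : X} {B : ι → ℝ} (hB : ∀ i, 0 ≤ B i) (h : ∀ i k, ‖φ i k x‖ ≤ B i) :
    N.comp (fun i => ESeminorm.supAbs (φ i)) x ≤ N (fun i => (B i : ℂ)) :=
  N.comp_le _ hB fun i => iSup_le fun k => by
    rw [← ofReal_norm]
    exact ENNReal.ofReal_le_ofReal (h i k)

theorem exists_bound_of_comp_supAbs {x : X}
    (hx : N.comp (fun i => ESeminorm.supAbs (φ i)) x < ∞) :
    ∃ B : ι → ℝ, (∀ i, 0 ≤ B i) ∧ (∀ i k, ‖φ i k x‖ ≤ B i) ∧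
      N (fun i => (B i : ℂ)) = N.comp (fun i => ESeminorm.supAbs (φ i)) x := by
  refine ⟨fun i => (ESeminorm.supAbs (φ i) x).toReal, fun i => ENNReal.toReal_nonneg,
    fun i k => ?_, (N.comp_eq _ hx).symm⟩
  rw [← toReal_enorm]
  exact ENNReal.toReal_mono (N.ne_top_of_comp _ hx i) (le_iSup (fun k => ‖φ i k x‖ₑ) k)

end MonotonicNorm

/-- The constants in the two conditions that relate the norms on edges and on vertices. -/
structure NormConstants (Γ : MultiGraph V E) (NE : MonotonicNorm E) (NV : MonotonicNorm V)
    (C₁ C₂ : NNReal) : Prop where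
  edge_to_vertex : ∀ α : E → ℂ, NE α < ∞ →
    NV (fun v => ((∑ e ∈ Γ.edges v, ‖α e‖ : ℝ) : ℂ)) ≤ C₁ * NE α
  vertex_to_edge : ∀ u : V → ℂ, NV u < ∞ →
    NE (fun e => ((‖u (Γ.src e)‖ + ‖u (Γ.tgt e)‖ : ℝ) : ℂ)) ≤ C₂ * NV u

namespace NormConstants

variable {NE : MonotonicNorm E} {NV : MonotonicNorm V} {C₁ C₂ : NNReal}

theorem edge_le (h : NormConstants Γ NE NV C₁ C₂) {B : V → ℝ} (hB : ∀ v, 0 ≤ B v)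
    (hN : NV (fun v => (B v : ℂ)) < ∞) :
    NE (fun e => ((B (Γ.src e) + B (Γ.tgt e) : ℝ) : ℂ)) ≤ C₂ * NV (fun v => (B v : ℂ)) := by
  have h1 := h.vertex_to_edge _ hN
  simpa only [Complex.norm_of_nonneg (hB _)] using h1

theorem sum_le (h : NormConstants Γ NE NV C₁ C₂) {B : V → ℝ} (hB : ∀ v, 0 ≤ B v)
    (hN : NV (fun v => (B v : ℂ)) < ∞) :
    NV (fun v => ((∑ e ∈ Γ.edges v, (B (Γ.src e) + B (Γ.tgt e)) : ℝ) : ℂ)) ≤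
      C₁ * (C₂ * NV (fun v => (B v : ℂ))) := by
  have h1 := h.edge_le hB hN
  have h2 := h.edge_to_vertex _ (h1.trans_lt (ENNReal.mul_lt_top ENNReal.coe_lt_top hN))
  simp only [Complex.norm_of_nonneg (add_nonneg (hB _) (hB _))] at h2
  exact h2.trans (by gcongr)

end NormConstants

namespace Radii

variable {A : AdmissibleCoordinates Γ} {Q : Poles V} {r ε s η σ : ℝ}

/-- A bounded continuous function on a domain `Ω_{v,η}`. -/
noncomputable def bounded {v : V} {F : ℂ → ℂ} (hF : ContinuousOn F (A.Omega Q η v)) {B : ℝ}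
    (hB : ∀ x ∈ A.Omega Q η v, ‖F x‖ ≤ B) : A.Omega Q η v →ᵇ ℂ :=
  BoundedContinuousFunction.ofNormedAddCommGroup (fun x : A.Omega Q η v => F x)
    (continuousOn_iff_continuous_domRestrict.1 hF) B fun x => hB x x.2

theorem norm_bounded_le {v : V} {F : ℂ → ℂ} (hF : ContinuousOn F (A.Omega Q η v)) {B : ℝ}
    (hB : ∀ x ∈ A.Omega Q η v, ‖F x‖ ≤ B) (hB0 : 0 ≤ B) : ‖bounded hF hB‖ ≤ B :=
  BoundedContinuousFunction.norm_ofNormedAddCommGroup_le _ hB0 _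

theorem comp_fibreNorm_le (NV : MonotonicNorm V) {y : ∀ v, A.Omega Q η v →ᵇ ℂ} {B : V → ℝ}
    (h : ∀ v, ‖y v‖ ≤ B v) :
    NV.comp (fibreNorm A Q η) y ≤ NV (fun v => (B v : ℂ)) :=
  NV.comp_le _ (fun v => (norm_nonneg _).trans (h v)) fun v => by
    change ‖y v‖ₑ ≤ _
    rw [← ofReal_norm]
    exact ENNReal.ofReal_le_ofReal (h v)

theorem continuousOn_transfer (R : Radii A Q r ε s η σ) {t : E → ℂ}
    (ht : ∀ e, ‖t e‖ ≤ σ * s / 2) (y : ∀ v, A.Omega Q η v →ᵇ ℂ) (v : V) :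
    ContinuousOn (A.transfer s σ t (extend A Q η y) v) (A.Omega Q η v) := fun _ hx =>
  (R.differentiableAt_transfer ht (continuousOn_extend y)
    (R.notMem_core_of_Omega hx)).continuousAt.continuousWithinAt

theorem pos_half (R : Radii A Q r ε s η σ) : 0 ≤ σ * s / 2 := by
  have := R.σ_pos
  have := R.s_pos
  positivity

/-- The linear operator of the integral equation. -/
noncomputable def transferMap (R : Radii A Q r ε s η σ) {t : E → ℂ} (ht : ∀ e, ‖t e‖ ≤ σ * s / 2) :
    (∀ v, A.Omega Q η v →ᵇ ℂ) →ₗ[ℂ] (∀ v, A.Omega Q η v →ᵇ ℂ) where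
  toFun y v := bounded (R.continuousOn_transfer ht y v)
    fun _ hx => R.norm_transfer_extend_le ht ht R.pos_half y hx
  map_add' y y' := by
    funext v
    refine BoundedContinuousFunction.ext fun x => ?_
    have h1 := R.transfer_add ht (continuousOn_extend y) (continuousOn_extend y') x.2
    rw [← map_add] at h1
    exact h1
  map_smul' b y := by
    funext v
    refine BoundedContinuousFunction.ext fun x => ?_
    have h1 := transfer_smul (A := A) (s := s) (σ := σ) t b (extend A Q η y) v x
    rw [← map_smul] at h1
    exact h1

theorem norm_transferMap_le (R : Radii A Q r ε s η σ) {t : E → ℂ} (ht : ∀ e, ‖t e‖ ≤ σ * s / 2)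
    {δ : ℝ} (hδ0 : 0 ≤ δ) (hδ : ∀ e, ‖t e‖ ≤ δ) (y : ∀ v, A.Omega Q η v →ᵇ ℂ) (v : V) :
    ‖R.transferMap ht y v‖ ≤ 4 / (σ * η) * (δ * (4 * A.c₂)) *
      ∑ e ∈ Γ.edges v, (‖y (Γ.src e)‖ + ‖y (Γ.tgt e)‖) := by
  have := R.η_pos
  have := R.σ_pos
  have := A.c₂_pos
  refine (BoundedContinuousFunction.norm_le (mul_nonneg (by positivity)
    (Finset.sum_nonneg fun e _ => by positivity))).2 fun x => ?_
  exact R.norm_transfer_extend_le ht hδ hδ0 y x.2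

/-- The integral equation is solvable when the parameters are small. -/
theorem exists_solution (R : Radii A Q r ε s η σ) {NE : MonotonicNorm E} {NV : MonotonicNorm V}
    [CompleteSpace NV.Space] {C₁ C₂ : NNReal} (hC : NormConstants Γ NE NV C₁ C₂) {K : ℕ}
    (hn : ∀ v, Q.n v ≤ K) (hm : ∀ v i, Q.m v i ≤ K) {t : E → ℂ} (ht : ∀ e, ‖t e‖ ≤ σ * s / 2)
    {δ : ℝ} (hδ0 : 0 ≤ δ) (hδ : ∀ e, ‖t e‖ ≤ δ)
    (hδ' : 4 / (σ * η) * (δ * (4 * A.c₂)) * (C₁ * C₂) ≤ 1 / 2) {α : E → ℂ} (hα : NE α < ∞)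
    {a : Q.Parts} (ha : Q.partNorm NV a < ∞) :
    ∃ f : V → ℂ → ℂ, (∀ v, ContinuousOn (f v) (A.Omega Q η v)) ∧
      (∀ v x, f v x = A.base Q α a v x + A.transfer s σ t f v x) ∧
      ∃ B : V → ℝ, (∀ v, 0 ≤ B v) ∧ (∀ v, ∀ x ∈ A.Omega Q η v, ‖f v x‖ ≤ B v) ∧
        NV (fun v => (B v : ℂ)) < ∞ := by
  have hη := R.η_pos
  have hσ := R.σ_pos
  have hc := A.c₂_pos
  set N := NV.comp (fibreNorm A Q η)
  have : CompleteSpace N.Space := NV.completeSpace_comp (fibreNorm A Q η) fun _ _ => rfl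
  set c := 4 / (σ * η) * (δ * (4 * A.c₂))
  have hc0 : 0 ≤ c := by positivity
  have hval : ∀ y, N y < ∞ → N y = NV (fun v => (‖y v‖ : ℂ)) := fun y hy => by
    refine (NV.comp_eq _ hy).trans ?_
    congr 1
  set S := R.transferMap ht
  -- Passing from vertices to edges and back costs `C₁ C₂`; smallness of `δ` makes the total factor
  -- at most `1 / 2`.
  have hS : ∀ y, N y < ∞ → N (S y) ≤ ENNReal.ofReal (1 / 2) * N y := fun y hy => by
    have h1 : ∀ v, ‖S y v‖ ≤ c * ∑ e ∈ Γ.edges v, (‖y (Γ.src e)‖ + ‖y (Γ.tgt e)‖) :=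
      R.norm_transferMap_le ht hδ0 hδ y
    refine (comp_fibreNorm_le NV h1).trans ?_
    rw [NV.mul_real hc0]
    have h2 := hC.sum_le (B := fun v => ‖y v‖) (fun v => norm_nonneg _) (by rwa [← hval y hy])
    rw [← hval y hy] at h2
    refine (mul_le_mul_right h2 _).trans ?_
    rw [← mul_assoc (C₁ : ℝ≥0∞), ← mul_assoc (ENNReal.ofReal c)]
    refine mul_le_mul_left ?_ _
    rw [← ENNReal.ofReal_coe_nnreal, ← ENNReal.ofReal_coe_nnreal,
      ← ENNReal.ofReal_mul NNReal.zero_le_coe, ← ENNReal.ofReal_mul hc0]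
    exact ENNReal.ofReal_le_ofReal hδ'
  have hSfin : ∀ y, N y < ∞ → N (S y) < ∞ := fun y hy =>
    (hS y hy).trans_lt (ENNReal.mul_lt_top ENNReal.ofReal_lt_top hy)
  set T := N.restrict S hSfin
  obtain ⟨P, hP, haP, hPN⟩ := NV.exists_bound_of_comp_supAbs _ ha
  have haP' : ∀ v i k, ‖a v i k‖ ≤ P v := fun v i k => haP v ⟨i, k⟩
  set F : ∀ v, A.Omega Q η v →ᵇ ℂ := fun v => bounded (F := A.base Q α a v)
    (fun x hx => (R.differentiableAt_base (R.notMem_core_of_Omega hx)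
      (R.ne_pole_of_Omega hx)).continuousAt.continuousWithinAt)
    fun x hx => R.norm_base_le hn hm hP haP' hx
  have hF : N F < ∞ := by
    have h1 : ∀ v, ‖F v‖ ≤ η⁻¹ * ∑ e ∈ Γ.edges v, ‖α e‖ + K * (K * max 1 η⁻¹ ^ K) * P v :=
      fun v => norm_bounded_le _ _ (add_nonneg (mul_nonneg (by positivity)
        (Finset.sum_nonneg fun e _ => norm_nonneg _)) (mul_nonneg (by positivity) (hP v)))
    refine (comp_fibreNorm_le NV h1).trans_lt ((NV.add_real_le _ _).trans_lt ?_)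
    rw [NV.mul_real (by positivity), NV.mul_real (by positivity), hPN]
    exact ENNReal.add_lt_top.2 ⟨ENNReal.mul_lt_top ENNReal.ofReal_lt_top
      ((hC.edge_to_vertex α hα).trans_lt (ENNReal.mul_lt_top ENNReal.coe_lt_top hα)),
      ENNReal.mul_lt_top ENNReal.ofReal_lt_top ha⟩
  obtain ⟨y, hy⟩ := exists_norm_sub_add_eq_zero T (fun y => by
    have h1 := ENNReal.toReal_mono (ENNReal.mul_lt_top ENNReal.ofReal_lt_top
      (N.val_lt_top y)).ne (hS _ (N.val_lt_top y))
    rw [ENNReal.toReal_mul, ENNReal.toReal_ofReal (by norm_num)] at h1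
    exact h1) (N.lift F hF)
  set Y := N.val y
  -- Norm zero means genuine equality here, because a monotonic norm and the sup norms are definite.
  have hYv : ∀ v, Y v = F v + S Y v := fun v => by
    have h1 : N (Y - (F + S Y)) = 0 := by
      have := N.enorm_eq (y - (N.lift F hF + T y))
      rwa [hy, ENNReal.ofReal_zero, map_sub, map_add] at this
    have h2 : ‖(Y - (F + S Y)) v‖ₑ = 0 := NV.eq_zero_of_comp _ h1 v
    rw [enorm_eq_zero, Pi.sub_apply, sub_eq_zero] at h2
    exact h2
  -- Off `Ω_{v,η}` the solution is defined by the right-hand side, so that the equation holds at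
  -- every point.
  set f : V → ℂ → ℂ := fun v x => A.base Q α a v x + A.transfer s σ t (extend A Q η Y) v x
  have hfY : ∀ v, EqOn (f v) (extend A Q η Y v) (A.Omega Q η v) := fun v x hx => by
    rw [extend_apply Y hx, hYv v]
    rfl
  refine ⟨f, fun v => (continuousOn_extend Y v).congr (hfY v), fun v x => ?_, fun v => ‖Y v‖,
    fun v => norm_nonneg _, fun v x hx => ?_, ?_⟩
  · rw [R.transfer_congr t hfY]
  · rw [hfY v hx, extend_apply Y hx]
    exact (Y v).norm_coe_le_norm _
  · rw [← hval Y (N.val_lt_top y)]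
    exact N.val_lt_top y

end Radii

end OpeningNodes

-- Gluing a solution across the necks

namespace OpeningNodes

open Complex Metric Set Filter MultiGraph

variable {V E : Type*} {Γ : MultiGraph V E}

/-- A solution of the integral equation with periods `α` and principal parts `a`. -/
structure Solution (A : AdmissibleCoordinates Γ) (Q : Poles V) (η s σ : ℝ) (t : E → ℂ)
    (α : E → ℂ) (a : Q.Parts) (f : V → ℂ → ℂ) : Prop where
  cont : ∀ v, ContinuousOn (f v) (A.Omega Q η v)
  eq : ∀ v x, f v x = A.base Q α a v x + A.transfer s σ t f v x
  residue : ∀ v, ∑ h ∈ Γ.halfEdges v, nodeResidue α h + ∑ i, residue (a v i) = 0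

namespace Solution

variable {A : AdmissibleCoordinates Γ} {Q : Poles V} {t : E → ℂ} {f : V → ℂ → ℂ} {α : E → ℂ}
  {a : Q.Parts} {r ε s η σ : ℝ}

theorem differentiableOn_regular (F : Solution A Q η s σ t α a f) (R : Radii A Q r ε s η σ)
    (h : E × Bool) : DifferentiableOn ℂ (A.regular s f h) (ball 0 s) :=
  R.differentiableOn_regular (R.continuousOn_pull F.cont h)

theorem differentiableAt (F : Solution A Q η s σ t α a f) (R : Radii A Q r ε s η σ)
    (ht : ∀ e, ‖t e‖ ≤ σ * s / 2) {v : V} {x : ℂ} (hx : ∀ h ∈ Γ.halfEdges v, x ∉ A.core σ h)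
    (hxq : ∀ i, (x : OnePoint ℂ) ≠ Q.q v i) : DifferentiableAt ℂ (f v) x := by
  rw [show f v = fun x => A.base Q α a v x + A.transfer s σ t f v x from funext (F.eq v)]
  exact (R.differentiableAt_base hx hxq).add (R.differentiableAt_transfer ht F.cont hx)

theorem eq_sum (F : Solution A Q η s σ t α a f) (R : Radii A Q r ε s η σ)
    (ht : ∀ e, ‖t e‖ ≤ σ * s / 2) {v : V} {x : ℂ} (hx : ∀ h ∈ Γ.halfEdges v, x ∉ A.core σ h) :
    f v x = ∑ h ∈ Γ.halfEdges v, cauchyTransform (A.X h) σ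
      (gluedPart (t h.1) (nodeResidue α h) (A.regular s f (opp h))) x +
      ∑ i, principalTerm (Q.q v i) (a v i) x := by
  rw [F.eq, AdmissibleCoordinates.base, AdmissibleCoordinates.transfer, add_right_comm,
    ← Finset.sum_add_distrib]
  congr 1
  refine Finset.sum_congr rfl fun h hh => ?_
  exact (R.cauchyTransform_eq (ht h.1) (F.differentiableOn_regular R (opp h)) (hx h hh)).symm

theorem X_notMem_core {h : E × Bool} {u : ℂ} (hu : σ < ‖u‖) (hu' : ‖u‖ < A.ρ) :
    ∀ h' ∈ Γ.halfEdges (Γ.vert h), A.X h u ∉ A.core σ h' := fun h' hh' hx => by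
  by_cases hne : h' = h
  · subst hne
    have := hx.2
    rw [A.z_X hu'] at this
    linarith
  · exact A.notMem_core_of_source hne (Γ.mem_halfEdges.1 hh') (A.X_mem hu') _ hx

/-- The solution near a node is the sum of a holomorphic part and of the singular part that comes
from the other end of the edge. -/
theorem exists_holomorphic (F : Solution A Q η s σ t α a f) (R : Radii A Q r ε s η σ)
    (ht : ∀ e, ‖t e‖ ≤ σ * s / 2) :
    ∃ S : E × Bool → ℂ → ℂ, (∀ h, DifferentiableOn ℂ (S h) (ball 0 A.ρ)) ∧
      ∀ h u, σ < ‖u‖ → ‖u‖ < A.ρ →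
        A.pull f h u = S h u + gluedPart (t h.1) (nodeResidue α h) (S (opp h)) u := by
  classical
  have hreg := F.differentiableOn_regular R
  set M : E × Bool → ℂ → ℂ := fun h =>
    gluedPart (t h.1) (nodeResidue α h) (A.regular s f (opp h)) with hMdef
  have hM := fun h => differentiableOn_gluedPart (t := t h.1) (r := nodeResidue α h) R.s_pos
    (hreg (opp h))
  have hk := fun h => (A.univalent h).exists_regular_part (M := M h)
    (div_nonneg (norm_nonneg _) R.s_pos.le) ((hM h).mono fun u hu => hu.1)
    (R.div_s_lt (ht h.1)) R.σ_lt
  choose k hk hk' using hk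
  -- All contributions except that of `h` itself: these are holomorphic on the whole disk at `h`.
  set W : E × Bool → ℂ → ℂ := fun h x =>
    ∑ h' ∈ (Γ.halfEdges (Γ.vert h)).erase h, cauchyTransform (A.X h') σ (M h') x +
      ∑ i, principalTerm (Q.q (Γ.vert h) i) (a (Γ.vert h) i) x with hWdef
  set S : E × Bool → ℂ → ℂ := fun h u => W h (A.X h u) * deriv (A.X h) u - k h u with hSdef
  have hS : ∀ h, DifferentiableOn ℂ (S h) (ball 0 A.ρ) := fun h => by
    refine DifferentiableOn.sub (DifferentiableOn.mul (fun u hu => ?_) (A.univalent h).diff_deriv)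
      (hk h)
    rw [mem_ball_zero_iff] at hu
    refine DifferentiableAt.differentiableWithinAt ?_
    have h1 : DifferentiableAt ℂ (W h) (A.X h u) := by
      refine DifferentiableAt.fun_add (DifferentiableAt.fun_sum fun h' hh' => ?_)
        (DifferentiableAt.fun_sum fun i _ =>
          differentiableAt_principalTerm _ (R.ne_pole_of_source (A.X_mem hu) i))
      rw [Finset.mem_erase] at hh'
      exact R.differentiableAt_cauchyTransform (ht _) (hreg _)
        (A.notMem_core_of_source hh'.1 (Γ.mem_halfEdges.1 hh'.2) (A.X_mem hu) _)
    exact h1.comp u (A.differentiableAt_X hu)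
  have hpull : ∀ h u, σ < ‖u‖ → ‖u‖ < A.ρ → A.pull f h u = S h u + M h u := fun h u hu hu' => by
    rw [hk' h u hu hu', AdmissibleCoordinates.pull, F.eq_sum R ht (X_notMem_core hu hu'),
      ← Finset.add_sum_erase _ _ (Γ.mem_halfEdges.2 rfl : h ∈ Γ.halfEdges (Γ.vert h))]
    simp only [hSdef, hWdef, hMdef]
    ring
  -- The part `M h` is purely singular, so `S h` is the regular part of `f` and extends it to the
  -- full disk. Replacing the regular parts by `S` makes the expansion symmetric in the two ends.
  have hSreg : ∀ h u, ‖u‖ < s → A.regular s f h u = S h u := fun h u hu => by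
    have h1 : EqOn (A.pull f h) (fun u => S h u + M h u) (sphere 0 s) := fun w hw => by
      rw [mem_sphere_zero_iff_norm] at hw
      exact hpull h w (hw ▸ R.σ_lt_s) (hw ▸ R.s_lt)
    rw [AdmissibleCoordinates.regular, regularPart_congr R.s_pos.le h1,
      regularPart_add R.s_pos.le ((hS h).continuousOn.mono R.sphere_subset_ball)
        ((hM h).continuousOn.mono (sphere_subset_of_lt ((R.div_s_lt (ht _)).trans R.σ_lt_s))) hu,
      regularPart_of_diff R.s_lt (hS h) hu,
      regularPart_gluedPart R.s_pos (hreg _) ((R.div_s_lt (ht _)).trans R.σ_lt_s) hu, add_zero]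
  refine ⟨S, hS, fun h u hu hu' => ?_⟩
  rw [hpull h u hu hu']
  congr 1
  simp only [hMdef, gluedPart]
  rw [hSreg (opp h) _ (norm_div_lt_of_lt R.s_pos ((R.div_s_lt (ht _)).trans hu))]

/-- The limit at infinity. -/
theorem tendsto_mul_sub (F : Solution A Q η s σ t α a f) (R : Radii A Q r ε s η σ)
    (ht : ∀ e, ‖t e‖ ≤ σ * s / 2) (v : V) :
    Tendsto (fun x => x * (f v x - ∑ i, principalTerm (Q.q v i) (a v i) x)) (cocompact ℂ)
      (𝓝 (-∑ i, OpeningNodes.residue (a v i))) := by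
  -- The singular parts contribute the sum of the node residues; the residue condition makes it
  -- minus the sum of the residues at the poles.
  rw [← eq_neg_of_add_eq_zero_left (F.residue v)]
  refine (tendsto_finsetSum (Γ.halfEdges v) fun h _ => R.tendsto_mul_cauchyTransform (h := h)
    (c := nodeResidue α h) (ht h.1) (F.differentiableOn_regular R (opp h))).congr' ?_
  filter_upwards [(Finset.eventually_all _).2 fun h (_ : h ∈ Γ.halfEdges v) =>
    A.core_cocompact R.σ_lt h] with x hx
  rw [F.eq_sum R ht hx, ← Finset.mul_sum]
  ring

end Solution

/-- The holomorphic functions on the disks of the chart domains from which the differential is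
glued. -/
structure NodeData (A : AdmissibleCoordinates Γ) (t : E → ℂ) (σ : ℝ) (α : E → ℂ) (f : V → ℂ → ℂ)
    (S : E × Bool → ℂ → ℂ) : Prop where
  diff : ∀ h, DifferentiableOn ℂ (S h) (ball 0 A.ρ)
  pull : ∀ h u, σ < ‖u‖ → ‖u‖ < A.ρ →
    A.pull f h u = S h u + gluedPart (t h.1) (nodeResidue α h) (S (opp h)) u

/-- The coefficient of the differential in the coordinate at a node. -/
noncomputable def nodeCoeff (t α : E → ℂ) (S : E × Bool → ℂ → ℂ) (h : E × Bool) (u : ℂ) : ℂ :=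
  S h u + gluedPart (t h.1) (nodeResidue α h) (S (opp h)) u

open Classical in
/-- The differential on `Σ_t` that is glued from a solution of the integral equation. -/
noncomputable def glued (A : AdmissibleCoordinates Γ) (Q : Poles V) (t α : E → ℂ)
    (f : V → ℂ → ℂ) (S : E × Bool → ℂ → ℂ) (v : V) (x : ℂ) : ℂ :=
  if x ∈ A.piece Q t v then
    if h : ∃ h, Γ.vert h = v ∧ x ∈ (A.z h).source then
      nodeCoeff t α S h.choose (A.z h.choose x) * deriv (A.z h.choose) x
    else f v x
  else 0

section glued

variable {A : AdmissibleCoordinates Γ} {Q : Poles V} {t : E → ℂ} {f : V → ℂ → ℂ} {α : E → ℂ}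
  {a : Q.Parts} {r ε s η σ : ℝ} {S : E × Bool → ℂ → ℂ}

theorem glued_off {v : V} {x : ℂ} (hx : x ∉ A.piece Q t v) : glued A Q t α f S v x = 0 :=
  if_neg hx

theorem glued_of_source {h : E × Bool} {x : ℂ} (hx : x ∈ A.piece Q t (Γ.vert h))
    (hxh : x ∈ (A.z h).source) : glued A Q t α f S (Γ.vert h) x =
      nodeCoeff t α S h (A.z h x) * deriv (A.z h) x := by
  have hex : ∃ k, Γ.vert k = Γ.vert h ∧ x ∈ (A.z k).source := ⟨h, rfl, hxh⟩
  have hk : hex.choose = h := by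
    by_contra hne
    exact Set.disjoint_left.1 (A.disjoint _ _ hne hex.choose_spec.1) hex.choose_spec.2 hxh
  rw [glued, if_pos hx, dif_pos hex, hk]

/-- The two definitions of the differential agree on `σ < ‖z‖ < ρ`, by `NodeData.pull`. -/
theorem glued_of_notMem_core (N : NodeData A t σ α f S) (R : Radii A Q r ε s η σ)
    (ht : ∀ e, ‖t e‖ ≤ σ * s / 2) {v : V} {x : ℂ} (hx : ∀ h ∈ Γ.halfEdges v, x ∉ A.core σ h)
    (hxq : ∀ i, (x : OnePoint ℂ) ≠ Q.q v i) : glued A Q t α f S v x = f v x := by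
  have hp := HasData.mem_piece_of_notMem_core R ht hx hxq
  by_cases hex : ∃ h, Γ.vert h = v ∧ x ∈ (A.z h).source
  · obtain ⟨h, rfl, hxh⟩ := hex
    have hσ : σ < ‖A.z h x‖ := by
      by_contra! hle
      exact hx h (Γ.mem_halfEdges.2 rfl) ⟨hxh, hle⟩
    rw [glued_of_source hp hxh, nodeCoeff, ← N.pull h _ hσ (A.norm_z_lt hxh),
      AdmissibleCoordinates.pull, A.X_z hxh, mul_assoc, A.deriv_X_mul_deriv_z hxh, mul_one]
  · rw [glued, if_pos hp, dif_neg hex]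

theorem NodeData.differentiableAt_nodeCoeff (N : NodeData A t σ α f S) {h : E × Bool} {u : ℂ}
    (hu : ‖t h.1‖ / A.ρ < ‖u‖) (hu' : ‖u‖ < A.ρ) : DifferentiableAt ℂ (nodeCoeff t α S h) u := by
  refine ((N.diff h).differentiableAt (isOpen_ball.mem_nhds (mem_ball_zero_iff.2 hu'))).add ?_
  exact (differentiableOn_gluedPart A.ρ_pos (N.diff (opp h))).differentiableAt
    ((isOpen_lt continuous_const continuous_norm).mem_nhds hu)

theorem lt_norm_z_of_piece {h : E × Bool} {x : ℂ} (hx : x ∈ A.piece Q t (Γ.vert h))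
    (hxh : x ∈ (A.z h).source) : ‖t h.1‖ / A.ρ < ‖A.z h x‖ := by
  by_contra! hle
  exact hx.1 h rfl ⟨hxh, hle⟩

theorem isOpen_notMem_core (A : AdmissibleCoordinates Γ) {σ : ℝ} (hσ : σ < A.ρ) (v : V) :
    IsOpen {x | ∀ h ∈ Γ.halfEdges v, x ∉ A.core σ h} := by
  have h1 : {x | ∀ h ∈ Γ.halfEdges v, x ∉ A.core σ h} =
      (⋃ h ∈ Γ.halfEdges v, A.core σ h)ᶜ := by
    ext x; simp
  rw [h1]
  exact (isClosed_biUnion_finset fun h _ => A.isClosed_core hσ h).isOpen_compl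

/-- Under `u ↦ t / u` the term in `S h` and the term in `S (opp h)` are exchanged, and `r du / u` is
preserved since the residues at the two ends are opposite. This is the gluing condition. -/
theorem nodeCoeff_opp (t α : E → ℂ) (S : E × Bool → ℂ → ℂ) {h : E × Bool} (ht : t h.1 ≠ 0) {u : ℂ}
    (hu : u ≠ 0) :
    nodeCoeff t α S h u = -(t h.1 / u ^ 2) * nodeCoeff t α S (opp h) (t h.1 / u) := by
  have h1 : (opp h).1 = h.1 := rfl
  rw [nodeCoeff, nodeCoeff, gluedPart, gluedPart, opp_opp, nodeResidue_opp, h1,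
    div_div_cancel₀ ht]
  field_simp
  ring

/-- The principal part of the glued differential at a closed node. -/
theorem NodeData.hasPrincipalPart_node (N : NodeData A t σ α f S) (R : Radii A Q r ε s η σ)
    {h : E × Bool} (ht : t h.1 = 0) : HasPrincipalPart (glued A Q t α f S (Γ.vert h)) (A.p h)
      (fun _ : Fin 1 => nodeResidue α h) := by
  have hX := A.univalent h
  have h0 : (0 : ℂ) ∈ ball (0 : ℂ) A.ρ := mem_ball_self A.ρ_pos
  rw [hasPrincipalPart_coe_iff]
  -- The correction turns `du / u` into `dx / (x - p)`: by `logDeriv_sub` they differ by the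
  -- logarithmic derivative of `dslope (A.X h) 0`.
  set L : ℂ → ℂ := fun u => S h u -
    nodeResidue α h * (deriv (dslope (A.X h) 0) u / dslope (A.X h) 0 u)
  have hL : DifferentiableOn ℂ L (ball 0 A.ρ) :=
    (N.diff h).sub (DifferentiableOn.const_mul (((hX.diff_dslope h0).deriv isOpen_ball).div
      (hX.diff_dslope h0) fun v hv => hX.dslope_ne h0 hv) _)
  refine ⟨fun x => L (A.z h x) * deriv (A.z h) x, ?_, ?_⟩
  · refine DifferentiableOn.analyticAt (s := (A.z h).source) (DifferentiableOn.mul ?_ ?_)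
      ((A.z h).open_source.mem_nhds (A.p_mem h))
    · exact hL.comp (A.holo h) fun x hx => mem_ball_zero_iff.2 (A.norm_z_lt hx)
    · exact (A.holo h).deriv (A.z h).open_source
  · filter_upwards [self_mem_nhdsWithin,
      nhdsWithin_le_nhds ((A.z h).open_source.mem_nhds (A.p_mem h))] with x hxp hxs
    have hzx := A.norm_z_lt hxs
    have hz0 : A.z h x ≠ 0 := fun h1 => hxp (by
      rw [mem_singleton_iff, ← A.X_z hxs, h1, A.X_zero])
    have hpiece : x ∈ A.piece Q t (Γ.vert h) := by
      have h1 := HasData.X_mem_piece R t (h := h) (u := A.z h x) (by simpa [ht] using hz0) hzx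
      rwa [A.X_z hxs] at h1
    rw [glued_of_source hpiece hxs, principalTerm_coe]
    simp only [Finset.univ_unique, Fin.default_eq_zero, Fin.val_zero, zero_add, pow_one,
      Finset.sum_singleton, nodeCoeff, gluedPart, ht, zero_div, zero_mul, sub_zero, L]
    have h1 := hX.logDeriv_sub h0 (mem_ball_zero_iff.2 hzx) hz0
    rw [sub_zero, A.X_zero, A.X_z hxs] at h1
    have h2 := A.deriv_X_mul_deriv_z hxs
    have h3 : x - A.p h ≠ 0 := sub_ne_zero.2 hxp
    have h4 : (x - A.p h)⁻¹ = deriv (A.X h) (A.z h x) / (x - A.p h) * deriv (A.z h) x := by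
      rw [div_mul_eq_mul_div, h2, one_div]
    rw [div_eq_mul_inv _ (x - A.p h), h4, h1]
    ring

end glued

end OpeningNodes

-- The glued differential has the prescribed data

namespace OpeningNodes

open Complex Metric Set Filter MultiGraph

variable {V E : Type*} {Γ : MultiGraph V E}

section glued

variable {A : AdmissibleCoordinates Γ} {Q : Poles V} {t : E → ℂ} {f : V → ℂ → ℂ} {α : E → ℂ}
  {a : Q.Parts} {r ε s η σ : ℝ} {S : E × Bool → ℂ → ℂ}

theorem isOpen_ne_poles (Q : Poles V) (v : V) :
    IsOpen {x : ℂ | ∀ i, (x : OnePoint ℂ) ≠ Q.q v i} := by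
  have h1 : {x : ℂ | ∀ i, (x : OnePoint ℂ) ≠ Q.q v i} =
      (⋃ i : Fin (Q.n v), {x : ℂ | (x : OnePoint ℂ) = Q.q v i})ᶜ := by
    ext x; simp
  rw [h1]
  refine (isClosed_iUnion_of_finite fun i => ?_).isOpen_compl
  refine Set.Subsingleton.isClosed fun x hx y hy => ?_
  exact OnePoint.coe_injective ((show (x : OnePoint ℂ) = _ from hx).trans
    (show (y : OnePoint ℂ) = _ from hy).symm)

theorem NodeData.differentiableAt_glued (N : NodeData A t σ α f S) (F : Solution A Q η s σ t α a f)
    (R : Radii A Q r ε s η σ) (ht : ∀ e, ‖t e‖ ≤ σ * s / 2) {v : V} {x : ℂ}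
    (hx : x ∈ A.piece Q t v) : DifferentiableAt ℂ (glued A Q t α f S v) x := by
  by_cases hex : ∃ h, Γ.vert h = v ∧ x ∈ (A.z h).source
  · obtain ⟨h, rfl, hxh⟩ := hex
    have h1 : DifferentiableAt ℂ
        (fun y => nodeCoeff t α S h (A.z h y) * deriv (A.z h) y) x := by
      refine DifferentiableAt.mul ?_ (((A.holo h).deriv (A.z h).open_source).differentiableAt
        ((A.z h).open_source.mem_nhds hxh))
      exact (N.differentiableAt_nodeCoeff (lt_norm_z_of_piece hx hxh) (A.norm_z_lt hxh)).comp x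
        (A.differentiableAt_z hxh)
    refine h1.congr_of_eventuallyEq ?_
    filter_upwards [(A.z h).open_source.mem_nhds hxh,
      (A.isOpen_piece Q (fun e => R.norm_lt_sq (ht e)) _).mem_nhds hx] with y hy hy'
    exact glued_of_source hy' hy
  · have hc : ∀ h ∈ Γ.halfEdges v, x ∉ A.core σ h := fun h hh hxh =>
      hex ⟨h, Γ.mem_halfEdges.1 hh, hxh.1⟩
    refine (F.differentiableAt R ht hc hx.2).congr_of_eventuallyEq ?_
    filter_upwards [(isOpen_notMem_core A R.σ_lt v).mem_nhds hc,
      (isOpen_ne_poles Q v).mem_nhds hx.2] with y hy hy'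
    exact glued_of_notMem_core N R ht hy hy'

theorem eventually_cocompact (R : Radii A Q r ε s η σ) (v : V) :
    ∀ᶠ x : ℂ in cocompact ℂ, (∀ h ∈ Γ.halfEdges v, x ∉ A.core σ h) ∧
      ∀ i, (x : OnePoint ℂ) ≠ Q.q v i :=
  ((Finset.eventually_all _).2 fun h _ => A.core_cocompact R.σ_lt h).and
    (eventually_all.2 fun _ => ne_of_cocompact _)

/-- The hypothesis serves two cases: infinity is one of the poles, with part `b`, or it is not, with
`b` empty. -/
theorem NodeData.hasPrincipalPart_infty (N : NodeData A t σ α f S)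
    (F : Solution A Q η s σ t α a f) (R : Radii A Q r ε s η σ) (ht : ∀ e, ‖t e‖ ≤ σ * s / 2) {v : V}
    {m : ℕ} {b : Fin m → ℂ} (h : Tendsto (fun x => x * (∑ i, principalTerm (Q.q v i) (a v i) x -
      principalTerm OnePoint.infty b x)) (cocompact ℂ)
      (𝓝 (∑ i, residue (a v i) - residue b))) :
    HasPrincipalPart (glued A Q t α f S v) OnePoint.infty b := by
  refine hasPrincipalPart_infty_of_tendsto ?_ ?_
  · filter_upwards [eventually_cocompact R v] with x hx
    exact N.differentiableAt_glued F R ht (HasData.mem_piece_of_notMem_core R ht hx.1 hx.2)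
  · have h1 := (F.tendsto_mul_sub R ht v).add h
    rw [neg_add_eq_sub, sub_sub_cancel_left] at h1
    refine h1.congr' ?_
    filter_upwards [eventually_cocompact R v] with x hx
    rw [glued_of_notMem_core N R ht hx.1 hx.2]
    ring

theorem tendsto_mul_principalTerm_of_ne {q : OnePoint ℂ} (hq : q ≠ OnePoint.infty) {m : ℕ}
    (b : Fin m → ℂ) :
    Tendsto (fun x => x * principalTerm q b x) (cocompact ℂ) (𝓝 (residue b)) := by
  obtain ⟨c, rfl⟩ := OnePoint.ne_infty_iff_exists.1 hq
  exact tendsto_mul_principalTerm c b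

theorem NodeData.hasPrincipalPart_glued (N : NodeData A t σ α f S)
    (F : Solution A Q η s σ t α a f) (R : Radii A Q r ε s η σ) (ht : ∀ e, ‖t e‖ ≤ σ * s / 2)
    (v : V) (i : Fin (Q.n v)) :
    HasPrincipalPart (glued A Q t α f S v) (Q.q v i) (a v i) := by
  by_cases hi : Q.q v i = OnePoint.infty
  · rw [hi]
    refine N.hasPrincipalPart_infty F R ht ?_
    have h1 := tendsto_finsetSum (Finset.univ.erase i) fun j hj =>
      tendsto_mul_principalTerm_of_ne (q := Q.q v j) (fun h =>
        (Finset.mem_erase.1 hj).1 (Q.q_inj v (h.trans hi.symm))) (a v j)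
    rw [← Finset.add_sum_erase _ _ (Finset.mem_univ i), add_sub_cancel_left]
    refine h1.congr fun x => ?_
    rw [← Finset.add_sum_erase _ _ (Finset.mem_univ i), hi, add_sub_cancel_left, Finset.mul_sum]
  · obtain ⟨c, hc⟩ := OnePoint.ne_infty_iff_exists.1 hi
    have hcr : c ∈ disk (Q.q v i) r := mem_disk_self hc R.r_pos
    have hcc : ∀ h ∈ Γ.halfEdges v, c ∉ A.core σ h := fun h hh hx =>
      Set.disjoint_left.1 (R.sep.1 v i h (Γ.mem_halfEdges.1 hh)) hx.1 hcr
    have hcq : ∀ j ∈ Finset.univ.erase i, (c : OnePoint ℂ) ≠ Q.q v j := fun j hj h =>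
      (Finset.mem_erase.1 hj).1 (Q.q_inj v (h.symm.trans hc))
    rw [← hc, hasPrincipalPart_coe_iff]
    -- Near this pole the singular parts of the nodes and the principal terms of the other poles are
    -- holomorphic.
    refine ⟨fun x => ∑ h ∈ Γ.halfEdges v, cauchyTransform (A.X h) σ
      (gluedPart (t h.1) (nodeResidue α h) (A.regular s f (opp h))) x +
      ∑ j ∈ Finset.univ.erase i, principalTerm (Q.q v j) (a v j) x, ?_, ?_⟩
    · have h2 : ∀ᶠ x : ℂ in 𝓝 c, ∀ j ∈ Finset.univ.erase i, (x : OnePoint ℂ) ≠ Q.q v j := by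
        refine (Finset.eventually_all _).2 fun j hj => ?_
        have := ((OnePoint.continuous_coe (X := ℂ)).isOpen_preimage _
          (isOpen_compl_singleton (x := Q.q v j))).mem_nhds (hcq j hj)
        exact this
      rw [analyticAt_iff_eventually_differentiableAt]
      filter_upwards [(isOpen_notMem_core A R.σ_lt v).mem_nhds hcc, h2] with x hx hxq
      exact DifferentiableAt.fun_add (DifferentiableAt.fun_sum fun h hh =>
        R.differentiableAt_cauchyTransform (ht _) (F.differentiableOn_regular R _) (hx h hh))
        (DifferentiableAt.fun_sum fun j hj => differentiableAt_principalTerm _ (hxq j hj))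
    · have h3 : ∀ᶠ x : ℂ in 𝓝 c, x ∈ disk (Q.q v i) r := by
        filter_upwards [isOpen_ball.mem_nhds (mem_ball_self R.r_pos)] with x hx
          using Or.inl ⟨c, hc.symm, hx⟩
      filter_upwards [nhdsWithin_le_nhds ((isOpen_notMem_core A R.σ_lt v).mem_nhds hcc),
        nhdsWithin_le_nhds h3, self_mem_nhdsWithin] with x hx hxr hxc
      have hxi : (x : OnePoint ℂ) ≠ Q.q v i := fun h => hxc (by
        rw [← hc] at h; exact OnePoint.coe_injective h)
      rw [glued_of_notMem_core N R ht hx (R.mem_piece_of_disk t hxr hxi).2, F.eq_sum R ht hx,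
        ← Finset.add_sum_erase _ _ (Finset.mem_univ i), hc]
      ring

/-- The differential that is glued from a solution of the integral equation has the prescribed
periods and principal parts. -/
theorem NodeData.hasData_glued (N : NodeData A t σ α f S) (F : Solution A Q η s σ t α a f)
    (R : Radii A Q r ε s η σ) (ht : ∀ e, ‖t e‖ ≤ σ * s / 2) :
    HasData A Q t (glued A Q t α f S) α a where
  mero :=
    { holo := fun v x hx => (N.differentiableAt_glued F R ht hx).differentiableWithinAt
      off := fun v x hx => glued_off hx
      infty := fun v hv => by
        refine N.hasPrincipalPart_infty F R ht ?_
        have h1 := tendsto_finsetSum Finset.univ fun i _ =>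
          tendsto_mul_principalTerm_of_ne (hv i) (a v i)
        have h0 : residue (0 : Fin 0 → ℂ) = 0 := by simp [residue]
        rw [h0, sub_zero]
        refine h1.congr fun x => ?_
        rw [principalTerm_zero, sub_zero, Finset.mul_sum]
      pole := fun v i => ⟨a v i, N.hasPrincipalPart_glued F R ht v i⟩
      neck := fun e he x hx hx' => by
        set u := A.z (e, false) x with hu
        have hu0 : u ≠ 0 := norm_pos_iff.1
          ((div_nonneg (norm_nonneg _) A.ρ_pos.le : 0 ≤ ‖t e‖ / A.ρ).trans_lt hx')
        have huρ : ‖u‖ < A.ρ := A.norm_z_lt hx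
        have htu : ‖t e / u‖ < A.ρ := norm_div_lt_of_lt A.ρ_pos hx'
        have htu' : ‖t e‖ / A.ρ < ‖t e / u‖ := by
          rw [norm_div]
          have := norm_pos_iff.2 hu0
          have := norm_pos_iff.2 he
          gcongr
        have h1 : x ∈ A.piece Q t (Γ.src e) := by
          have := HasData.X_mem_piece R t (h := (e, false)) (u := u) hx' huρ
          rwa [hu, A.X_z hx] at this
        have h2 : A.X (e, true) (t e / u) ∈ A.piece Q t (Γ.tgt e) :=
          HasData.X_mem_piece R t (h := (e, true)) htu' htu
        have h3 := glued_of_source (t := t) (f := f) (α := α) (S := S) (h := (e, false)) h1 hx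
        have h4 := glued_of_source (t := t) (f := f) (α := α) (S := S) (h := (e, true)) h2
          (A.X_mem htu)
        rw [A.z_X htu] at h4
        have h5 := nodeCoeff_opp t α S (h := (e, false)) he hu0
        have h6 : A.glue t e x = A.X (e, true) (t e / u) := rfl
        have h7 := A.deriv_X_mul_deriv_z (h := (e, true)) (A.X_mem htu)
        rw [A.z_X htu] at h7
        rw [h6, (A.hasDerivAt_glue t hx hu0 htu).deriv]
        refine (congrArg (· * _) h4).trans (Eq.trans ?_ h3.symm)
        rw [h5]
        simp only [opp, Bool.not_false, ← hu]
        linear_combination (-(nodeCoeff t α S (e, true) (t e / u) * t e *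
          deriv (A.z (e, false)) x / u ^ 2)) * h7
      node := fun e he => by
        refine ⟨nodeResidue α (e, true), N.hasPrincipalPart_node R (h := (e, true)) he, ?_⟩
        rw [← nodeResidue_opp]
        exact N.hasPrincipalPart_node R (h := (e, false)) he }
  period := fun e b hb hb' => by
    have hb0 : 0 < b := (div_nonneg (norm_nonneg _) A.ρ_pos.le).trans_lt hb
    have h1 : A.cycleIntegral (glued A Q t α f S (Γ.tgt e)) e b =
        ∮ u in C(0, b), nodeCoeff t α S (e, true) u := by
      refine circleIntegral.integral_congr hb0.le fun u hu => ?_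
      rw [mem_sphere_zero_iff_norm] at hu
      have huρ : ‖u‖ < A.ρ := hu.trans_lt hb'
      have h2 := glued_of_source (t := t) (f := f) (α := α) (S := S) (h := (e, true))
        (HasData.X_mem_piece R t (h := (e, true)) (u := u) (hu.symm ▸ hb) huρ) (A.X_mem huρ)
      have h3 := A.deriv_X_mul_deriv_z (h := (e, true)) (A.X_mem huρ)
      rw [A.z_X huρ] at h2 h3
      refine (congrArg (· * _) h2).trans ?_
      change _ * deriv (A.X (e, true)) u = _
      rw [mul_assoc, mul_comm (deriv (A.z (e, true)) _), h3, mul_one]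
    have hsub : sphere (0 : ℂ) b ⊆ ball 0 A.ρ :=
      sphere_subset_closedBall.trans (closedBall_subset_ball hb')
    rw [h1]
    -- The holomorphic part `S` integrates to zero; only the residue of `gluedPart` remains.
    have h4 := (circleIntegral.integral_add (c := (0 : ℂ)) (R := b) (f := S (e, true))
      (g := gluedPart (t e) (nodeResidue α (e, true)) (S (opp (e, true))))
      (((N.diff _).continuousOn.mono hsub).circleIntegrable hb0.le)
      (((differentiableOn_gluedPart A.ρ_pos (N.diff _)).continuousOn.mono
        (sphere_subset_of_lt hb)).circleIntegrable hb0.le))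
    rw [circleIntegral_eq_zero_of_ball hb0.le hb' (N.diff _),
      circleIntegral_gluedPart A.ρ_pos (N.diff _) hb, zero_add] at h4
    refine Eq.trans ?_ h4.symm
    rw [nodeResidue, mul_inv_cancel_left₀ two_pi_I_ne_zero]
    rfl
  part := N.hasPrincipalPart_glued F R ht

end glued

end OpeningNodes

-- Linearity, uniqueness and norm bounds for the data

namespace OpeningNodes

open Complex Metric Set Filter MultiGraph

variable {V E : Type*} {Γ : MultiGraph V E}

namespace HasData

variable {A : AdmissibleCoordinates Γ} {Q : Poles V} {t : E → ℂ} {α α' : E → ℂ}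
  {a a' : Q.Parts} {r ε s η σ : ℝ}

/-- A meromorphic differential has periods and principal parts. -/
theorem exists_of_isMeromorphic (R : Radii A Q r ε s η σ) (ht : ∀ e, ‖t e‖ < A.ρ ^ 2)
    {ω : V → ℂ → ℂ} (hω : A.IsMeromorphic Q t ω) : ∃ α a, HasData A Q t ω α a := by
  choose a ha using hω.pole
  have h0 : ∀ e, 0 ≤ ‖t e‖ / A.ρ := fun e => div_nonneg (norm_nonneg _) A.ρ_pos.le
  have hlt : ∀ e, ‖t e‖ / A.ρ < A.ρ := fun e => by
    rw [div_lt_iff₀ A.ρ_pos, ← sq]; exact ht e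
  choose b hb hb' using fun e => exists_between (hlt e)
  refine ⟨fun e => A.cycleIntegral (ω (Γ.tgt e)) e (b e), a, hω, fun e c hc hc' => ?_, ha⟩
  have hd := hω.differentiableOn_pull R ht (e, true)
  rcases le_total (b e) c with h | h
  · exact (circleIntegral_eq_of_annulus (h0 e) hd (hb e) h hc').symm
  · exact circleIntegral_eq_of_annulus (h0 e) hd hc h (hb' e)

theorem add {ω ω' : V → ℂ → ℂ} (D : HasData A Q t ω α a) (D' : HasData A Q t ω' α' a')
    (R : Radii A Q r ε s η σ) (ht : ∀ e, ‖t e‖ < A.ρ ^ 2) :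
    HasData A Q t (ω + ω') (α + α') (a + a') where
  mero := (A.forms Q t).add_mem D.mero D'.mero
  period e c hc hc' := by
    have hc0 : 0 < c := (div_nonneg (norm_nonneg _) A.ρ_pos.le).trans_lt hc
    have hint : ∀ {ω : V → ℂ → ℂ}, A.IsMeromorphic Q t ω →
        CircleIntegrable (A.pull ω (e, true)) 0 c := fun hω =>
      ((hω.differentiableOn_pull R ht (e, true)).continuousOn.mono fun u hu => by
        rw [mem_sphere_zero_iff_norm] at hu
        rw [Set.mem_ofPred_eq, hu]
        exact ⟨hc, hc'⟩).circleIntegrable hc0.le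
    have h1 := circleIntegral.integral_add (hint D.mero) (hint D'.mero)
    rw [Pi.add_apply, D.period e c hc hc', D'.period e c hc hc']
    refine h1.symm.trans (circleIntegral.integral_congr hc0.le fun u _ => ?_)
    simp only [AdmissibleCoordinates.pull, Pi.add_apply, add_mul]
    rfl
  part v i := (D.part v i).add (D'.part v i)

theorem smul {ω : V → ℂ → ℂ} (c : ℂ) (D : HasData A Q t ω α a) :
    HasData A Q t (c • ω) (c • α) (c • a) where
  mero := (A.forms Q t).smul_mem c D.mero
  period e b hb hb' := by
    rw [Pi.smul_apply, smul_eq_mul, D.period e b hb hb', AdmissibleCoordinates.cycleIntegral,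
      AdmissibleCoordinates.cycleIntegral, ← circleIntegral.integral_const_mul]
    simp only [Pi.smul_apply, smul_eq_mul, mul_assoc]
  part v i := (D.part v i).smul c

/-- The difference is a principal part of the zero function, whose coefficients vanish by
`HasPrincipalPart.norm_le` with bound `0`. -/
theorem _root_.OpeningNodes.HasPrincipalPart.unique {f : ℂ → ℂ} {q : OnePoint ℂ} {m : ℕ}
    {b b' : Fin m → ℂ} (h : HasPrincipalPart f q b) (h' : HasPrincipalPart f q b') : b = b' := by
  have h1 := h.add (h'.smul (-1))
  have h0 : f + (-1 : ℂ) • f = 0 := by simp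
  rw [h0] at h1
  have h2 : localCoeff 0 q = 0 := by
    funext u
    simp [localCoeff]
  funext k
  have h3 := h1.norm_le (σ := 1) (r := 2) (B := 0) one_pos one_lt_two
    (by rw [h2]; exact differentiableOn_const 0) (fun u _ => by rw [h2]; simp) k
  simp only [mul_zero, norm_le_zero_iff, Pi.add_apply, Pi.smul_apply, smul_eq_mul] at h3
  linear_combination h3

theorem unique {ω : V → ℂ → ℂ} (D : HasData A Q t ω α a) (D' : HasData A Q t ω α' a')
    (ht : ∀ e, ‖t e‖ < A.ρ ^ 2) : α = α' ∧ a = a' := by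
  refine ⟨funext fun e => ?_, funext fun v => funext fun i => (D.part v i).unique (D'.part v i)⟩
  have hlt : ‖t e‖ / A.ρ < A.ρ := by
    rw [div_lt_iff₀ A.ρ_pos, ← sq]; exact ht e
  obtain ⟨b, hb, hb'⟩ := exists_between hlt
  rw [D.period e b hb hb', D'.period e b hb hb']

variable {NE : MonotonicNorm E} {NV : MonotonicNorm V} {C₁ C₂ : NNReal} {K : ℕ}
  {ω : A.forms Q t}

theorem exists_bound (h : A.formNorm Q t NV ε ω < ∞) : ∃ B : V → ℝ, (∀ v, 0 ≤ B v) ∧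
    (∀ v, ∀ x ∈ A.Omega Q ε v, ‖ω.1 v x‖ ≤ B v) ∧
    NV (fun v => (B v : ℂ)) = A.formNorm Q t NV ε ω := by
  obtain ⟨B, hB, hωB, hN⟩ := NV.exists_bound_of_comp_supAbs _ h
  exact ⟨B, hB, fun v x hx => hωB v ⟨x, hx⟩, hN⟩

theorem formNorm_le {B : V → ℝ} (hB : ∀ v, 0 ≤ B v)
    (h : ∀ v, ∀ x ∈ A.Omega Q ε v, ‖ω.1 v x‖ ≤ B v) :
    A.formNorm Q t NV ε ω ≤ NV (fun v => (B v : ℂ)) :=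
  NV.comp_supAbs_le _ hB fun v x => h v x x.2

/-- The norm of the data is controlled by the norm of the differential. -/
theorem data_le (D : HasData A Q t ω.1 α a) (R : Radii A Q r ε s η σ)
    (hC : NormConstants Γ NE NV C₁ C₂) (hm : ∀ v i, Q.m v i ≤ K) (ht : ∀ e, ‖t e‖ ≤ σ * s / 2)
    (ht' : ∀ e, 4 * A.c₂ * (3 + ε / η) * (4 / (σ * η)) * ‖t e‖ ≤ 1 / 2)
    (hω : A.formNorm Q t NV ε ω < ∞) :
    NE α ≤ ENNReal.ofReal (4 * Real.pi * ε) * (C₂ * A.formNorm Q t NV ε ω) ∧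
    Q.partNorm NV a ≤ ENNReal.ofReal (max 1 ((ε + r) / 2) ^ K * max 1 (((ε + r) / 2) ^ 2)⁻¹) *
      A.formNorm Q t NV ε ω := by
  have hε := R.ε_pos
  obtain ⟨B, hB, hωB, hN⟩ := exists_bound hω
  rw [← hN] at hω ⊢
  constructor
  · refine le_trans ?_ (mul_le_mul_right (hC.edge_le hB hω) _)
    rw [← NE.mul_real (by positivity), ← NE.apply_norm α]
    exact NE.mono_real (fun e => norm_nonneg _) (D.norm_period_le R ht ht' hωB)
  · rw [← NV.mul_real (by positivity)]
    refine NV.comp_supAbs_le _ (fun v => mul_nonneg (by positivity) (hB v)) fun v k => ?_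
    rw [mul_assoc]
    exact D.norm_part_le R (fun e => R.norm_lt_sq (ht e)) hm (hωB v) (hB v) k.1 k.2

/-- The norm of the differential is controlled by the norm of the data. -/
theorem form_le (D : HasData A Q t ω.1 α a) (R : Radii A Q r ε s η σ)
    (hC : NormConstants Γ NE NV C₁ C₂) (hn : ∀ v, Q.n v ≤ K) (hm : ∀ v i, Q.m v i ≤ K)
    (ht : ∀ e, ‖t e‖ ≤ σ * s / 2)
    (ht' : ∀ e, 4 * A.c₂ * (3 + ε / η) * (4 / (σ * η)) * ‖t e‖ ≤ 1 / 2)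
    {δ : ℝ} (hδ0 : 0 ≤ δ) (hδ : ∀ e, ‖t e‖ ≤ δ)
    (hδ' : 4 / (σ * η) * (δ * (2 * (4 * A.c₂ * (3 + ε / η)))) * 2 * (C₁ * C₂) ≤ 1 / 2)
    (hω : A.formNorm Q t NV ε ω < ∞) (hα : NE α < ∞) (ha : Q.partNorm NV a < ∞) :
    A.formNorm Q t NV ε ω ≤ 2 * (ENNReal.ofReal η⁻¹ * (C₁ * NE α) +
      ENNReal.ofReal (K * (K * max 1 η⁻¹ ^ K)) * Q.partNorm NV a) := by
  have hε := R.ε_pos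
  have hη := R.η_pos
  have hσ := R.σ_pos
  have hc := A.c₂_pos
  obtain ⟨B, hB, hωB, hN⟩ := exists_bound hω
  obtain ⟨P, hP, haP, hPN⟩ := NV.exists_bound_of_comp_supAbs _ ha
  set X := ENNReal.ofReal η⁻¹ * (C₁ * NE α) +
      ENNReal.ofReal (K * (K * max 1 η⁻¹ ^ K)) * Q.partNorm NV a
  set c := 4 / (σ * η) * (δ * (2 * (4 * A.c₂ * (3 + ε / η)))) * 2
  have hc0 : 0 ≤ c := by positivity
  have hsum0 : ∀ v, 0 ≤ ∑ e ∈ Γ.edges v, (B (Γ.src e) + B (Γ.tgt e)) := fun v =>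
    Finset.sum_nonneg fun e _ => add_nonneg (hB _) (hB _)
  have hα0 : ∀ v, 0 ≤ ∑ e ∈ Γ.edges v, ‖α e‖ := fun v => Finset.sum_nonneg fun e _ => norm_nonneg _
  -- The transfer term costs at most half the norm of `ω`; that norm is finite, so it can be moved
  -- to the left, whence the factor `2`.
  have hkey : A.formNorm Q t NV ε ω ≤ X + ENNReal.ofReal (1 / 2) * A.formNorm Q t NV ε ω := by
    refine (formNorm_le (B := fun v => η⁻¹ * ∑ e ∈ Γ.edges v, ‖α e‖ +
      K * (K * max 1 η⁻¹ ^ K) * P v + c * ∑ e ∈ Γ.edges v, (B (Γ.src e) + B (Γ.tgt e)))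
      (fun v => add_nonneg (add_nonneg (mul_nonneg (by positivity) (hα0 v))
        (mul_nonneg (by positivity) (hP v))) (mul_nonneg hc0 (hsum0 v))) fun v x hx => ?_).trans ?_
    · refine (D.norm_le R ht ht' hB hωB hn hm hP (fun v i k => haP v ⟨i, k⟩) hδ hx).trans_eq ?_
      simp only [c]
      ring
    · refine (NV.add_real_le _ _).trans (add_le_add ((NV.add_real_le _ _).trans ?_) ?_)
      · rw [NV.mul_real (by positivity), NV.mul_real (by positivity), hPN]
        exact add_le_add (mul_le_mul_right (hC.edge_to_vertex α hα) _) le_rfl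
      · rw [NV.mul_real hc0]
        refine (mul_le_mul_right (hC.sum_le hB (hN.symm ▸ hω)) _).trans ?_
        rw [hN, ← mul_assoc (C₁ : ℝ≥0∞), ← mul_assoc (ENNReal.ofReal c)]
        refine mul_le_mul_left ?_ _
        rw [← ENNReal.ofReal_coe_nnreal, ← ENNReal.ofReal_coe_nnreal,
          ← ENNReal.ofReal_mul NNReal.zero_le_coe, ← ENNReal.ofReal_mul hc0]
        exact ENNReal.ofReal_le_ofReal hδ'
  have hX : X ≠ ∞ := ENNReal.add_ne_top.2 ⟨ENNReal.mul_ne_top ENNReal.ofReal_ne_top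
    (ENNReal.mul_ne_top ENNReal.coe_ne_top hα.ne), ENNReal.mul_ne_top ENNReal.ofReal_ne_top ha.ne⟩
  have h2 := ENNReal.toReal_mono (ENNReal.add_ne_top.2 ⟨hX, ENNReal.mul_ne_top
    ENNReal.ofReal_ne_top hω.ne⟩) hkey
  rw [ENNReal.toReal_add hX (ENNReal.mul_ne_top ENNReal.ofReal_ne_top hω.ne), ENNReal.toReal_mul,
    ENNReal.toReal_ofReal (by norm_num)] at h2
  rw [← ENNReal.toReal_le_toReal hω.ne (ENNReal.mul_ne_top ENNReal.ofNat_ne_top hX),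
    ENNReal.toReal_mul, ENNReal.toReal_ofNat]
  linarith

/-- A differential without periods and principal parts vanishes. -/
theorem eq_zero_of_data (D : HasData A Q t ω.1 0 0) (R : Radii A Q r ε s η σ)
    (hC : NormConstants Γ NE NV C₁ C₂) (hn : ∀ v, Q.n v ≤ K) (hm : ∀ v i, Q.m v i ≤ K)
    (ht : ∀ e, ‖t e‖ ≤ σ * s / 2)
    (ht' : ∀ e, 4 * A.c₂ * (3 + ε / η) * (4 / (σ * η)) * ‖t e‖ ≤ 1 / 2)
    {δ : ℝ} (hδ0 : 0 ≤ δ) (hδ : ∀ e, ‖t e‖ ≤ δ)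
    (hδ' : 4 / (σ * η) * (δ * (2 * (4 * A.c₂ * (3 + ε / η)))) * 2 * (C₁ * C₂) ≤ 1 / 2)
    (hω : A.formNorm Q t NV ε ω < ∞) : ω = 0 := by
  have h0 : NE 0 = 0 := NE.toESeminorm.map_zero
  have h0' : Q.partNorm NV 0 = 0 := (Q.partNorm NV).map_zero
  have h1 := D.form_le R hC hn hm ht ht' hδ0 hδ hδ' hω (by rw [h0]; exact ENNReal.zero_lt_top)
    (by rw [h0']; exact ENNReal.zero_lt_top)
  rw [h0, h0', mul_zero, mul_zero, mul_zero, add_zero, mul_zero, nonpos_iff_eq_zero] at h1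
  obtain ⟨B, hB, hωB, hN⟩ := exists_bound hω
  rw [h1] at hN
  have hB0 := NV.eq_zero' _ hN
  refine Subtype.ext (D.eq_zero R ht ht' (fun v x hx => ?_) rfl rfl)
  have h2 : B v = 0 := by simpa using congrFun hB0 v
  have h3 := hωB v x hx
  rw [h2] at h3
  exact norm_le_zero_iff.1 h3

/-- The residue condition. -/
theorem residue_condition (D : HasData A Q t ω.1 α a) (R : Radii A Q r ε s η σ)
    (ht : ∀ e, ‖t e‖ ≤ σ * s / 2) (v : V) :
    ∑ e ∈ Γ.inEdges v, α e - ∑ e ∈ Γ.outEdges v, α e +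
      2 * Real.pi * I * ∑ i, a v i ⟨0, Q.m_pos v i⟩ = 0 := by
  have h1 := (D.eq_and_sum_residue R ht v).2
  simp only [sum_nodeResidue, residue_eq (Q.m_pos v _)] at h1
  have h2 := congrArg (2 * Real.pi * I * ·) h1
  simpa only [mul_add, mul_inv_cancel_left₀ two_pi_I_ne_zero, mul_zero] using h2

/-- The differential with given data exists. -/
theorem exists_form [CompleteSpace NV.Space] (R : Radii A Q r ε s η σ)
    (hC : NormConstants Γ NE NV C₁ C₂) (hn : ∀ v, Q.n v ≤ K) (hm : ∀ v i, Q.m v i ≤ K)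
    (ht : ∀ e, ‖t e‖ ≤ σ * s / 2) {δ : ℝ} (hδ0 : 0 ≤ δ) (hδ : ∀ e, ‖t e‖ ≤ δ)
    (hδ' : 4 / (σ * η) * (δ * (4 * A.c₂)) * (C₁ * C₂) ≤ 1 / 2)
    (hα : NE α < ∞) (ha : Q.partNorm NV a < ∞)
    (hres : ∀ v, ∑ e ∈ Γ.inEdges v, α e - ∑ e ∈ Γ.outEdges v, α e +
      2 * Real.pi * I * ∑ i, a v i ⟨0, Q.m_pos v i⟩ = 0) :
    ∃ ω : A.forms Q t, A.formNorm Q t NV ε ω < ∞ ∧ HasData A Q t ω.1 α a := by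
  obtain ⟨f, hf, hfeq, B, hB, hfB, hBN⟩ := R.exists_solution hC hn hm ht hδ0 hδ hδ' hα ha
  have F : Solution A Q η s σ t α a f := ⟨hf, hfeq, fun v => by
    simp only [sum_nodeResidue, residue_eq (Q.m_pos v _)]
    have h2 := congrArg ((2 * Real.pi * I : ℂ)⁻¹ * ·) (hres v)
    simpa only [mul_add, inv_mul_cancel_left₀ two_pi_I_ne_zero, mul_zero] using h2⟩
  obtain ⟨S, hS, hS'⟩ := F.exists_holomorphic R ht
  have N : NodeData A t σ α f S := ⟨hS, hS'⟩
  have D := N.hasData_glued F R ht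
  refine ⟨⟨glued A Q t α f S, D.mero⟩, (formNorm_le hB fun v x hx => ?_).trans_lt hBN, D⟩
  have hx' := R.Omega_subset v hx
  change ‖glued A Q t α f S v x‖ ≤ B v
  rw [glued_of_notMem_core N R ht (R.notMem_core_of_Omega hx') (R.ne_pole_of_Omega hx')]
  exact hfB v x hx'

end HasData

/-- The residue condition defines a complete space. -/
theorem completeSpace_residueSubspace (Γ : MultiGraph V E) (Q : Poles V) (NE : MonotonicNorm E)
    (NV : MonotonicNorm V) [CompleteSpace NE.Space] [CompleteSpace NV.Space] :
    CompleteSpace (residueSubspace Γ Q NE NV) := by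
  have := Q.completeSpace_parts NV
  have hpart : ∀ v i k, Continuous fun x : (Q.partNorm NV).Space =>
      (Q.partNorm NV).val x v i k := by
    intro v i k
    obtain ⟨C, hC⟩ := NV.exists_eval_bound v
    refine AddMonoidHomClass.continuous_of_bound (LinearMap.proj k ∘ₗ LinearMap.proj i ∘ₗ
      LinearMap.proj v ∘ₗ (Q.partNorm NV).val : (Q.partNorm NV).Space →ₗ[ℂ] ℂ) C fun x => ?_
    obtain ⟨P, hP, hxP, hN⟩ := NV.exists_bound_of_comp_supAbs _ ((Q.partNorm NV).val_lt_top x)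
    have hfin : NV (fun v => (P v : ℂ)) < ∞ := by rw [hN]; exact (Q.partNorm NV).val_lt_top x
    -- The vector of suprema has the same norm as `x`, so evaluation on vertex sequences bounds each
    -- coefficient.
    have h1 := hC (NV.toESeminorm.lift _ hfin)
    have h2 : ‖NV.toESeminorm.lift _ hfin‖ = ‖x‖ := congrArg ENNReal.toReal hN
    rw [h2, NV.toESeminorm.val_lift, Complex.norm_of_nonneg (hP v)] at h1
    exact (hxP v ⟨i, k⟩).trans h1
  have hclosed : IsClosed (residueSubspace Γ Q NE NV : Set (NE.Space × (Q.partNorm NV).Space)) := by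
    have h1 : (residueSubspace Γ Q NE NV : Set (NE.Space × (Q.partNorm NV).Space)) =
        ⋂ v, {x | ∑ e ∈ Γ.inEdges v, NE.toESeminorm.val x.1 e
          - ∑ e ∈ Γ.outEdges v, NE.toESeminorm.val x.1 e
          + 2 * Real.pi * Complex.I *
            ∑ i, (Q.partNorm NV).val x.2 v i ⟨0, Q.m_pos v i⟩ = 0} := by
      ext x
      rw [mem_iInter]
      rfl
    rw [h1]
    refine isClosed_iInter fun v => isClosed_eq ?_ continuous_const
    refine ((continuous_finsetSum _ fun e _ => ?_).sub (continuous_finsetSum _ fun e _ => ?_)).add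
      (continuous_const.mul (continuous_finsetSum _ fun i _ => ?_))
    · exact (NE.continuous_eval e).comp continuous_fst
    · exact (NE.continuous_eval e).comp continuous_fst
    · exact (hpart v i _).comp continuous_snd
  exact hclosed.completeSpace_coe

end OpeningNodes

-- The isomorphism

namespace OpeningNodes

open Complex Metric Set Filter MultiGraph

variable {V E : Type*} {Γ : MultiGraph V E}

/-- The hypotheses on the radii, on the constants and on the parameters under which the data
determine the differential. -/
structure Small (A : AdmissibleCoordinates Γ) (Q : Poles V) (NE : MonotonicNorm E)
    (NV : MonotonicNorm V) (t : E → ℂ) (r ε s η σ : ℝ) (C₁ C₂ : NNReal) (K : ℕ) (δ : ℝ) : Prop where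
  radii : Radii A Q r ε s η σ
  const : NormConstants Γ NE NV C₁ C₂
  n_le : ∀ v, Q.n v ≤ K
  m_le : ∀ v i, Q.m v i ≤ K
  δ_nonneg : 0 ≤ δ
  le : ∀ e, ‖t e‖ ≤ δ
  δ_le : δ ≤ σ * s / 2
  δ_mul_le : 4 / (σ * η) * (δ * (2 * (4 * A.c₂ * (3 + ε / η)))) * 2 * (1 + C₁ * C₂) ≤ 1 / 2

namespace Small

variable {A : AdmissibleCoordinates Γ} {Q : Poles V} {NE : MonotonicNorm E} {NV : MonotonicNorm V}
  {t : E → ℂ} {r ε s η σ : ℝ} {C₁ C₂ : NNReal} {K : ℕ} {δ : ℝ}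

theorem norm_le (H : Small A Q NE NV t r ε s η σ C₁ C₂ K δ) : ∀ e, ‖t e‖ ≤ σ * s / 2 :=
  fun e => (H.le e).trans H.δ_le

theorem mul_nonneg (H : Small A Q NE NV t r ε s η σ C₁ C₂ K δ) :
    0 ≤ 4 / (σ * η) * (δ * (2 * (4 * A.c₂ * (3 + ε / η)))) * 2 := by
  have := H.radii.ε_pos
  have := H.radii.η_pos
  have := H.radii.σ_pos
  have := A.c₂_pos
  have := H.δ_nonneg
  positivity

/-- The summand `1` in `1 + C₁ * C₂` provides this bound, needed on a single edge where the norm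
constants do not enter. -/
theorem norm_le' (H : Small A Q NE NV t r ε s η σ C₁ C₂ K δ) :
    ∀ e, 4 * A.c₂ * (3 + ε / η) * (4 / (σ * η)) * ‖t e‖ ≤ 1 / 2 := fun e => by
  have h1 := H.δ_mul_le
  have h2 := H.mul_nonneg
  have := H.radii.ε_pos
  have := H.radii.η_pos
  have := H.radii.σ_pos
  have := A.c₂_pos
  have h3 : 4 * A.c₂ * (3 + ε / η) * (4 / (σ * η)) * ‖t e‖ ≤
      4 * A.c₂ * (3 + ε / η) * (4 / (σ * η)) * δ :=
    mul_le_mul_of_nonneg_left (H.le e) (by positivity)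
  have h4 : (0 : ℝ) ≤ C₁ * C₂ := by positivity
  nlinarith [_root_.mul_nonneg h2 h4]

theorem le_form (H : Small A Q NE NV t r ε s η σ C₁ C₂ K δ) :
    4 / (σ * η) * (δ * (2 * (4 * A.c₂ * (3 + ε / η)))) * 2 * (C₁ * C₂) ≤ 1 / 2 :=
  (mul_le_mul_of_nonneg_left (by simp) H.mul_nonneg).trans H.δ_mul_le

theorem le_exists (H : Small A Q NE NV t r ε s η σ C₁ C₂ K δ) :
    4 / (σ * η) * (δ * (4 * A.c₂)) * (C₁ * C₂) ≤ 1 / 2 := by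
  have := H.radii.ε_pos
  have := H.radii.η_pos
  have := H.radii.σ_pos
  have := A.c₂_pos
  have := H.δ_nonneg
  refine (mul_le_mul_of_nonneg_right ?_ (by positivity)).trans H.le_form
  have h1 : 0 ≤ 4 / (σ * η) * (δ * (4 * A.c₂)) := by positivity
  have h2 : 0 ≤ ε / η := by positivity
  nlinarith [_root_.mul_nonneg h1 h2]

/-- The isomorphism between the differentials and their periods and principal parts. -/
theorem exists_equiv (H : Small A Q NE NV t r ε s η σ C₁ C₂ K δ) [CompleteSpace NV.Space] :
    ∃ L : A.M1 Q t NV ε ≃L[ℂ] residueSubspace Γ Q NE NV, ∀ ω : A.M1 Q t NV ε,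
      HasData A Q t ((A.formNorm Q t NV ε).val ω).1 (NE.toESeminorm.val (L ω).1.1)
        ((Q.partNorm NV).val (L ω).1.2) := by
  have R := H.radii
  have htρ := fun e => R.norm_lt_sq (H.norm_le e)
  set p := A.formNorm Q t NV ε
  -- The data are chosen, but `HasData.unique` determines them, which yields linearity below.
  choose α a D using fun ω : A.M1 Q t NV ε => HasData.exists_of_isMeromorphic R htρ (p.val ω).2
  have hle := fun ω => (D ω).data_le R H.const H.m_le H.norm_le H.norm_le' (p.val_lt_top ω)
  have hα : ∀ ω, NE (α ω) < ∞ := fun ω => (hle ω).1.trans_lt (ENNReal.mul_lt_top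
    ENNReal.ofReal_lt_top (ENNReal.mul_lt_top ENNReal.coe_lt_top (p.val_lt_top ω)))
  have ha : ∀ ω, Q.partNorm NV (a ω) < ∞ := fun ω => (hle ω).2.trans_lt (ENNReal.mul_lt_top
    ENNReal.ofReal_lt_top (p.val_lt_top ω))
  have hadd : ∀ ω ω', α (ω + ω') = α ω + α ω' ∧ a (ω + ω') = a ω + a ω' := fun ω ω' => by
    refine (D (ω + ω')).unique ?_ htρ
    rw [map_add]
    exact (D ω).add (D ω') R htρ
  have hsmul : ∀ (c : ℂ) ω, α (c • ω) = c • α ω ∧ a (c • ω) = c • a ω := fun c ω => by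
    refine (D (c • ω)).unique ?_ htρ
    rw [map_smul]
    exact (D ω).smul c
  set L₀ : A.M1 Q t NV ε →ₗ[ℂ] residueSubspace Γ Q NE NV :=
    { toFun := fun ω => ⟨(NE.toESeminorm.lift (α ω) (hα ω), (Q.partNorm NV).lift (a ω) (ha ω)),
        (D ω).residue_condition R H.norm_le⟩
      map_add' := fun ω ω' => Subtype.ext (Prod.ext
        (NE.toESeminorm.val_injective (hadd ω ω').1)
        ((Q.partNorm NV).val_injective (hadd ω ω').2))
      map_smul' := fun c ω => Subtype.ext (Prod.ext
        (NE.toESeminorm.val_injective (hsmul c ω).1)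
        ((Q.partNorm NV).val_injective (hsmul c ω).2)) } with hL₀
  have hinj : Function.Injective L₀ := by
    rw [← LinearMap.ker_eq_bot, LinearMap.ker_eq_bot']
    intro ω hω
    have h1 : α ω = 0 := congrArg (fun y => NE.toESeminorm.val y.1.1) hω
    have h2 : a ω = 0 := congrArg (fun y => (Q.partNorm NV).val y.1.2) hω
    have h3 := D ω
    rw [h1, h2] at h3
    exact p.val_injective (h3.eq_zero_of_data R H.const H.n_le H.m_le H.norm_le H.norm_le'
      H.δ_nonneg H.le H.le_form (p.val_lt_top ω))
  have hsurj : Function.Surjective L₀ := fun y => by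
    obtain ⟨ω, hω, D'⟩ := HasData.exists_form (ε := ε) (t := t) R H.const H.n_le H.m_le H.norm_le
      H.δ_nonneg H.le H.le_exists (NE.toESeminorm.val_lt_top y.1.1)
      ((Q.partNorm NV).val_lt_top y.1.2) y.2
    obtain ⟨h1, h2⟩ := (D (p.lift ω hω)).unique D' htρ
    exact ⟨p.lift ω hω, Subtype.ext (Prod.ext (NE.toESeminorm.val_injective h1)
      ((Q.partNorm NV).val_injective h2))⟩
  set L₁ := LinearEquiv.ofBijective L₀ ⟨hinj, hsurj⟩
  set c₁ := ENNReal.ofReal (4 * Real.pi * ε) * C₂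
  set c₂ := ENNReal.ofReal (max 1 ((ε + r) / 2) ^ K * max 1 (((ε + r) / 2) ^ 2)⁻¹)
  set b₁ := ENNReal.ofReal η⁻¹ * C₁
  set b₂ := ENNReal.ofReal (K * (K * max 1 η⁻¹ ^ K))
  have hto : ∀ ω, ‖L₁ ω‖ ≤ (c₁.toReal + c₂.toReal) * ‖ω‖ := fun ω => by
    have h1 : ‖(L₁ ω).1.1‖ ≤ c₁.toReal * ‖ω‖ := by
      have := ENNReal.toReal_mono (ENNReal.mul_ne_top (ENNReal.mul_ne_top ENNReal.ofReal_ne_top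
        ENNReal.coe_ne_top) (p.val_lt_top ω).ne) ((hle ω).1.trans_eq (mul_assoc _ _ _).symm)
      rwa [ENNReal.toReal_mul] at this
    have h2 : ‖(L₁ ω).1.2‖ ≤ c₂.toReal * ‖ω‖ := by
      have := ENNReal.toReal_mono (ENNReal.mul_ne_top ENNReal.ofReal_ne_top
        (p.val_lt_top ω).ne) (hle ω).2
      rwa [ENNReal.toReal_mul] at this
    have h3 : 0 ≤ c₁.toReal * ‖ω‖ := by positivity
    have h4 : 0 ≤ c₂.toReal * ‖ω‖ := by positivity
    rw [add_mul]
    exact max_le (h1.trans (le_add_of_nonneg_right h4)) (h2.trans (le_add_of_nonneg_left h3))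
  have hinv : ∀ ω, ‖ω‖ ≤ 2 * (b₁.toReal + b₂.toReal) * ‖L₁ ω‖ := fun ω => by
    have h1 := (D ω).form_le R H.const H.n_le H.m_le H.norm_le H.norm_le' H.δ_nonneg H.le H.le_form
      (p.val_lt_top ω) (hα ω) (ha ω)
    rw [← mul_assoc (ENNReal.ofReal η⁻¹)] at h1
    have hb₁ : b₁ * NE (α ω) ≠ ∞ := ENNReal.mul_ne_top (ENNReal.mul_ne_top ENNReal.ofReal_ne_top
      ENNReal.coe_ne_top) (hα ω).ne
    have hb₂ : b₂ * Q.partNorm NV (a ω) ≠ ∞ := ENNReal.mul_ne_top ENNReal.ofReal_ne_top (ha ω).ne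
    have h2 := ENNReal.toReal_mono (ENNReal.mul_ne_top ENNReal.ofNat_ne_top
      (ENNReal.add_ne_top.2 ⟨hb₁, hb₂⟩)) h1
    rw [ENNReal.toReal_mul, ENNReal.toReal_add hb₁ hb₂, ENNReal.toReal_mul (a := b₁),
      ENNReal.toReal_mul (a := b₂), ENNReal.toReal_ofNat] at h2
    have h3 : (NE (α ω)).toReal ≤ ‖L₁ ω‖ := le_max_left _ _
    have h4 : (Q.partNorm NV (a ω)).toReal ≤ ‖L₁ ω‖ := le_max_right _ _
    refine h2.trans ?_
    rw [mul_assoc, add_mul]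
    gcongr
  refine ⟨L₁.toContinuousLinearEquivOfBounds (c₁.toReal + c₂.toReal)
    (2 * (b₁.toReal + b₂.toReal)) hto fun y => ?_, fun ω => D ω⟩
  have := hinv (L₁.symm y)
  rwa [L₁.apply_symm_apply] at this

end Small

end OpeningNodes

theorem theorem6 {V E : Type*} (Γ : OpeningNodes.MultiGraph V E) (hΓ : Γ.Connected)
    (A : OpeningNodes.AdmissibleCoordinates Γ)
    (NE : OpeningNodes.MonotonicNorm E) (NV : OpeningNodes.MonotonicNorm V)
    (hN : OpeningNodes.AdmissibleNorms Γ NE NV)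
    (Q : OpeningNodes.Poles V) (hQ : Q.UniformlyBounded)
    (r : ℝ) (hr : 0 < r) (hsep : Q.Separated A r)
    (ε : ℝ) (hε : 0 < ε) (hεc : ε ≤ A.ρ * A.c₁) (hεr : ε < r) :
    ∃ δ : ℝ, 0 < δ ∧ δ < A.ρ ^ 2 ∧ ∀ t : E → ℂ, (∀ e, ‖t e‖ ≤ δ) →
      CompleteSpace (A.M1 Q t NV ε) ∧
      ∃ L : A.M1 Q t NV ε ≃L[ℂ] OpeningNodes.residueSubspace Γ Q NE NV,
        ∀ ω : A.M1 Q t NV ε,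
          (∀ e, ∀ s : ℝ, ‖t e‖ / A.ρ < s → s < A.ρ →
            NE.toESeminorm.val (L ω).1.1 e = A.cycleIntegral (A.coeff ω (Γ.tgt e)) e s) ∧
          ∀ v i, OpeningNodes.HasPrincipalPart (A.coeff ω v) (Q.q v i)
            ((Q.partNorm NV).val (L ω).1.2 v i) := by
  obtain ⟨s, η, σ, R⟩ := OpeningNodes.exists_radii hsep hε hεc hεr
  obtain ⟨K, hK⟩ := hQ
  obtain ⟨C₁, hC₁⟩ := hN.edge_to_vertex
  obtain ⟨C₂, hC₂⟩ := hN.vertex_to_edge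
  have hη := R.η_pos
  have hσ := R.σ_pos
  have hs := R.s_pos
  have hc := A.c₂_pos
  -- The coefficient of `δ` in the condition `Small.δ_mul_le`, which then reads `δ M ≤ 1 / 2`.
  set M : ℝ := 4 / (σ * η) * (2 * (4 * A.c₂ * (3 + ε / η))) * 2 * (1 + C₁ * C₂)
  have hM : 0 < M := by positivity
  set δ := min (σ * s / 2) (1 / 2 / M)
  have hδ0 : 0 < δ := lt_min (by positivity) (by positivity)
  have hδρ : ‖(δ : ℂ)‖ < A.ρ ^ 2 := R.norm_lt_sq (by
    rw [Complex.norm_of_nonneg hδ0.le]; exact min_le_left _ _)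
  rw [Complex.norm_of_nonneg hδ0.le] at hδρ
  refine ⟨δ, hδ0, hδρ, fun t ht => ?_⟩
  have H : OpeningNodes.Small A Q NE NV t r ε s η σ C₁ C₂ K δ :=
    ⟨R, ⟨hC₁, hC₂⟩, fun v => (hK v).1, fun v => (hK v).2, hδ0.le, ht, min_le_left _ _, by
      have h1 : δ * M ≤ 1 / 2 := (mul_le_mul_of_nonneg_right (min_le_right _ _) hM.le).trans_eq
        (div_mul_cancel₀ _ hM.ne')
      refine le_trans (le_of_eq ?_) h1
      simp only [M]
      ring⟩
  have := hN.complete_edge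
  have := hN.complete_vertex
  obtain ⟨L, hL⟩ := H.exists_equiv
  have := OpeningNodes.completeSpace_residueSubspace Γ Q NE NV
  -- Completeness of the space of differentials is inherited from the closed residue subspace
  -- through the isomorphism.
  exact ⟨(completeSpace_congr (e := L.toEquiv) L.isUniformEmbedding).2 this, L, fun ω =>
    ⟨(hL ω).period, (hL ω).part⟩⟩
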